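/- Let $d\ge 1$ be a fixed integer. For each $n$ put $N=nd$ and let $M_n$ be a random real symmetric (Hermitian) $N\times N$ matrix, all $M_n$ being defined on one probability space, viewed as an $n\times n$ array of $d\times d$ blocks $M_n[i,j]$, $1\le i,j\le n$. Let $DM_n$ be the block-diagonal part of $M_n$ (the matrix with the same diagonal blocks as $M_n$ and all other blocks zero). For a square matrix $A$ let $\|A\|$ be its largest singular value. A random $d\times d$ real matrix $B$ with rows $r_1,\dots,r_d$ (row vectors) has $\sigma$-simple structure with $2+\varepsilon$ moments if its entries are in $L^{2+\varepsilon}$; for all $j\ne k$ the matrix $\mathbb E(r_j^{\top}r_k)$ is antisymmetric, with norm bounded by a finite constant; and $\mathbb E(r_j^{\top}r_j)=\sigma^2 I_d$ for all $j$. Suppose that: 1. for every $n$, the blocks $M_n[i,j]$, $i<j$, are independent, and the block columns $(M_n[i,j])_{1\le i\le j}$, $j=1,\dots,n$ (diagonal blocks included), are independent of one another. (This holds in particular when $M_n$ is obtained by bordering $M_{n-1}$ with a block column, and its transpose, that is independent of $M_{n-1}$ and whose off-diagonal blocks are independent. Nothing is assumed about the joint law of $M_n$ and $M_{n'}$ for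 $n\ne n'$.) 2. $\|DM_n\|/\sqrt N\to 0$ in probability as $n\to\infty$. 3. $\operatorname{rank}\,\mathbb E(M_n-DM_n)=o(N)$. 4. For some $\varepsilon>0$ and all $n$ and $i<j$, the centered block $M_n[i,j]-\mathbb E M_n[i,j]$ has $\sigma$-simple structure with $\sigma=1$ and $2+\varepsilon$ moments. The absolute $(2+\varepsilon)$-th moments of the entries of these centered blocks, and the norms of the cross-covariance matrices between different rows of each off-diagonal block, are bounded uniformly in the block and in $n$. Then, almost surely, the empirical spectral distribution of $M_n/\sqrt N$, that is $\frac1N\sum_{k=1}^N\delta_{\lambda_k(M_n/\sqrt N)}$, converges weakly as $n\to\infty$ to the Wigner semicircle law, which has density $\frac1{2\pi}\sqrt{4-x^2}$ on $[-2,2]$. -/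

import Mathlib

open MeasureTheory ProbabilityTheory Filter Topology
open scoped ENNReal NNReal

/-- The `d × d` block in position `(i, j)` of an `n × n` block matrix. -/
def block {n d : ℕ} (A : Matrix (Fin n × Fin d) (Fin n × Fin d) ℝ) (i j : Fin n) :
    Matrix (Fin d) (Fin d) ℝ :=
  Matrix.of fun a b => A (i, a) (j, b)

/-- The block-diagonal part `DA` of a block matrix `A`: blocks off the diagonal are set to zero. -/
def blockDiagPart {n d : ℕ} (A : Matrix (Fin n × Fin d) (Fin n × Fin d) ℝ) :
    Matrix (Fin n × Fin d) (Fin n × Fin d) ℝ :=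
  Matrix.of fun p q => if p.1 = q.1 then A p q else 0

/-- The operator norm (largest singular value) of a square real matrix. -/
noncomputable def opNorm {ι : Type*} [Fintype ι] [DecidableEq ι] (A : Matrix ι ι ℝ) : ℝ :=
  ‖Matrix.toEuclideanCLM (𝕜 := ℝ) A‖

/-- The entrywise expectation of a random matrix. -/
noncomputable def expectation {Ω : Type*} [MeasurableSpace Ω] (μ : Measure Ω) {ι κ : Type*}
    (B : Ω → Matrix ι κ ℝ) : Matrix ι κ ℝ :=
  Matrix.of fun a b => ∫ ω, B ω a b ∂μ

/-- The matrix `E[r_jᵀ r_k]`, where `r_j`, `r_k` are the `j`-th and `k`-th rows of the random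
matrix `B`, regarded as row vectors. -/
noncomputable def rowCrossMoment {Ω : Type*} [MeasurableSpace Ω] (μ : Measure Ω) {d : ℕ}
    (B : Ω → Matrix (Fin d) (Fin d) ℝ) (j k : Fin d) : Matrix (Fin d) (Fin d) ℝ :=
  expectation μ fun ω => Matrix.vecMulVec (B ω j) (B ω k)

/-- `B` has `σ`-simple structure with `2 + ε` moments. -/
structure HasSimpleStructure {Ω : Type*} [MeasurableSpace Ω] (μ : Measure Ω) {d : ℕ}
    (σ ε : ℝ) (B : Ω → Matrix (Fin d) (Fin d) ℝ) : Prop where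
  moments : ∀ a b, MemLp (fun ω => B ω a b) (ENNReal.ofReal (2 + ε)) μ
  antisymm : ∀ j k, j ≠ k → (rowCrossMoment μ B j k).transpose = -rowCrossMoment μ B j k
  bounded : ∃ C > 0, ∀ j k, j ≠ k → opNorm (rowCrossMoment μ B j k) ≤ C
  isotropic : ∀ j, rowCrossMoment μ B j j = σ ^ 2 • (1 : Matrix (Fin d) (Fin d) ℝ)

/-- The centered block `B - E[B]`, with `B` the `(i, j)` block of the random matrix `M`. -/
noncomputable def centeredBlock {Ω : Type*} [MeasurableSpace Ω] (μ : Measure Ω) {n d : ℕ}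
    (M : Ω → Matrix (Fin n × Fin d) (Fin n × Fin d) ℝ) (i j : Fin n) :
    Ω → Matrix (Fin d) (Fin d) ℝ :=
  fun ω => block (M ω) i j - expectation μ fun ω' => block (M ω') i j

/-- The empirical spectral distribution: mass `1 / N` at each of the `N` eigenvalues, counted with
multiplicity (and the zero measure when `N = 0`). -/
noncomputable def empiricalSpectralDistribution {ι : Type*} [Fintype ι] [DecidableEq ι]
    (A : Matrix ι ι ℝ) (hA : A.IsHermitian) : FiniteMeasure ℝ :=
  ⟨((Fintype.card ι : ℝ≥0)⁻¹) • ∑ i, Measure.dirac (hA.eigenvalues i), inferInstance⟩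

theorem isHermitian_real_smul {ι : Type*} {A : Matrix ι ι ℝ} (hA : A.IsHermitian) (c : ℝ) :
    (c • A).IsHermitian := by
  simpa [Matrix.IsHermitian, Matrix.conjTranspose_smul] using congrArg (fun B => c • B) hA

/-- The density of the standard Wigner semicircle law. -/
noncomputable def semicircleDensity (x : ℝ) : ℝ :=
  if |x| ≤ 2 then (2 * Real.pi)⁻¹ * √(4 - x ^ 2) else 0

/-- The Wigner semicircle law on `[-2, 2]`, of variance one, as a measure. -/
noncomputable def semicircleMeasure : Measure ℝ :=
  volume.withDensity fun x => ENNReal.ofReal (semicircleDensity x)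

theorem integrable_semicircleDensity_and_integral :
    Integrable semicircleDensity ∧ ∫ x, semicircleDensity x = 1 := by
  have hind : semicircleDensity =
      (Set.Icc (-2 : ℝ) 2).indicator fun x => (2 * Real.pi)⁻¹ * √(4 - x ^ 2) := by
    funext x
    simp only [semicircleDensity, Set.indicator_apply, Set.mem_Icc, abs_le]
  have hcont : Continuous fun x : ℝ => (2 * Real.pi)⁻¹ * √(4 - x ^ 2) := by fun_prop
  constructor
  · rw [hind, integrable_indicator_iff measurableSet_Icc]
    exact hcont.continuousOn.integrableOn_compact isCompact_Icc
  · rw [hind, integral_indicator measurableSet_Icc, integral_Icc_eq_integral_Ioc,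
      ← intervalIntegral.integral_of_le (by norm_num)]
    have h := intervalIntegral.smul_integral_comp_mul_left (a := (-1 : ℝ)) (b := 1)
      (fun x : ℝ => (2 * Real.pi)⁻¹ * √(4 - x ^ 2)) 2
    have h2 : ∀ x : ℝ, √(4 - (2 * x) ^ 2) = 2 * √(1 - x ^ 2) := by
      intro x
      rw [show 4 - (2 * x) ^ 2 = 2 ^ 2 * (1 - x ^ 2) by ring, Real.sqrt_mul (by norm_num),
        Real.sqrt_sq (by norm_num)]
    simp only [h2, intervalIntegral.integral_const_mul, integral_sqrt_one_sub_sq] at h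
    rw [intervalIntegral.integral_const_mul]
    norm_num at h ⊢
    rw [← h]
    field_simp

instance isProbabilityMeasure_semicircleMeasure : IsProbabilityMeasure semicircleMeasure := by
  refine ⟨?_⟩
  have hnn : ∀ x, 0 ≤ semicircleDensity x := by
    intro x
    unfold semicircleDensity
    split_ifs <;> positivity
  rw [semicircleMeasure, withDensity_apply _ MeasurableSet.univ, Measure.restrict_univ,
    ← ofReal_integral_eq_lintegral_ofReal integrable_semicircleDensity_and_integral.1
      (Filter.Eventually.of_forall hnn), integrable_semicircleDensity_and_integral.2,
    ENNReal.ofReal_one]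

/-- The Wigner semicircle law. -/
noncomputable def semicircleLaw : FiniteMeasure ℝ :=
  ⟨semicircleMeasure, inferInstance⟩

/-! The proof follows the Stieltjes transform `s_n(z) = N⁻¹ tr (M_n / √N - z)⁻¹`, `resolventMean`,
for `z` in the upper half plane, and shows that it converges almost surely to the Stieltjes
transform `m(z)` of the semicircle law.

*Concentration.* Changing one block column changes `M_n` by a matrix of rank at most `2d`, hence
`s_n(z)` by `O(1 / n)`. The block columns being independent, McDiarmid's inequality gives
sub-Gaussian tails that are summable in `n`, and `s_n(z) - E s_n(z) → 0` almost surely by the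
Borel–Cantelli lemma, with no assumption on the joint law for different `n`
(`ae_tendsto_resolventMean_sub_integral`). It remains to find the limit of `E s_n(z)`.

*Reduction.* Setting the diagonal blocks to zero changes `s_n(z)` by at most a multiple of
`‖DM_n‖ / √N`, and then subtracting the mean changes it by at most a multiple of the rank of the
mean divided by `N`. So it may be assumed that the diagonal blocks vanish and the others are
centered (`IsCenteredBlockWigner`).

*Loop equation.* The trace of `(A - z) (A - z)⁻¹ = 1` expresses `1 + z s_n` as a sum over pairs of
blocks of the block times a block of the resolvent. Expanding the resolvent to second order around
the one of the matrix with this pair of blocks removed, which is independent of the block, the first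
order vanishes since the block is centered. In the second order the covariance of the block enters
against symmetric matrices, so that the antisymmetric covariances of different rows cancel and the
isotropic ones produce the product of the traces of two diagonal blocks of the resolvent
(`sum_covariance_mul`). The error of the expansion is controlled by moments of order `2 + δ`. The
outcome is `1 + z E s_n + E s_n² → 0` (`IsCenteredBlockWigner.norm_loop_equation_le`). By concentration
`E s_n²` may be replaced by `(E s_n)²`, and the quadratic equation `m² + z m + 1 = 0` has a single,
stable root in the upper half plane, which is the Stieltjes transform of the semicircle law
(`norm_sub_le_of_quadratic`, `stieltjes_semicircle_quadratic`).

*Weak convergence.* The imaginary part of the Stieltjes transform on the line `Im z = η` is the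
density of the convolution with a Cauchy kernel. Pointwise convergence of these densities is
convergence in `L¹` by Scheffé's lemma, which gives convergence of the characteristic functions
after division by the Fourier transform of the kernel, and Lévy's continuity theorem concludes
(`tendsto_of_tendsto_stieltjes`). -/

/-! ### Resolvents of real symmetric matrices -/

section Resolvent

open scoped Matrix.Norms.L2Operator
open Matrix

variable {ι : Type*} [Fintype ι] [DecidableEq ι]

set_option linter.unusedSectionVars false

/-- The resolvent `(A - z)⁻¹` of a real square matrix `A` at the complex number `z`. -/
noncomputable def resolventMatrix (A : Matrix ι ι ℝ) (z : ℂ) : Matrix ι ι ℂ :=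
  (A.map Complex.ofReal - z • (1 : Matrix ι ι ℂ))⁻¹

theorem ofReal_sub_ne_zero {z : ℂ} (hz : 0 < z.im) (x : ℝ) : (x : ℂ) - z ≠ 0 := by
  intro h
  have := congrArg Complex.im h
  simp at this
  exact hz.ne' this

theorem norm_inv_ofReal_sub_le {z : ℂ} (hz : 0 < z.im) (x : ℝ) :
    ‖((x : ℂ) - z)⁻¹‖ ≤ z.im⁻¹ := by
  rw [norm_inv]
  refine inv_anti₀ hz ?_
  have := Complex.abs_im_le_norm ((x : ℂ) - z)
  simpa [abs_of_pos hz] using this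

theorem map_ofReal_mul (A B : Matrix ι ι ℝ) :
    (A * B).map Complex.ofReal = A.map Complex.ofReal * B.map Complex.ofReal :=
  Matrix.map_mul (f := Complex.ofRealHom)

theorem isHermitian_apply_comm {A : Matrix ι ι ℝ} (hA : A.IsHermitian) (p q : ι) :
    A p q = A q p := by
  simpa using hA.apply q p

/-- Over the reals a Hermitian matrix and its resolvents are diagonalized by a common
unitary change of basis `U`. -/
theorem exists_resolventMatrix_eq {A : Matrix ι ι ℝ} (hA : A.IsHermitian) :
    ∃ U : Matrix ι ι ℂ, U ∈ unitaryGroup ι ℂ ∧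
      A.map Complex.ofReal = U * diagonal (fun i => (hA.eigenvalues i : ℂ)) * star U ∧
      ∀ z : ℂ, 0 < z.im →
        (A.map Complex.ofReal - z • (1 : Matrix ι ι ℂ)) * resolventMatrix A z = 1 ∧
        resolventMatrix A z = U * diagonal (fun i => ((hA.eigenvalues i : ℂ) - z)⁻¹) * star U := by
  set V : Matrix ι ι ℝ := (hA.eigenvectorUnitary : Matrix ι ι ℝ) with hV
  set U : Matrix ι ι ℂ := V.map Complex.ofReal with hU
  have hstV : star U = (star V).map Complex.ofReal := by
    ext i j
    simp [hU, Matrix.star_apply]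
  have h1 : U * star U = 1 := by
    rw [hstV, hU, ← map_ofReal_mul, Unitary.mul_star_self_of_mem hA.eigenvectorUnitary.2]
    ext i j
    simp [Matrix.one_apply, apply_ite]
  have h2 : star U * U = 1 := by
    rw [hstV, hU, ← map_ofReal_mul, Unitary.star_mul_self_of_mem hA.eigenvectorUnitary.2]
    ext i j
    simp [Matrix.one_apply, apply_ite]
  have hspec : A.map Complex.ofReal = U * diagonal (fun i => (hA.eigenvalues i : ℂ)) * star U := by
    have := hA.spectral_theorem
    rw [Unitary.conjStarAlgAut_apply] at this
    conv_lhs => rw [this]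
    rw [map_ofReal_mul, map_ofReal_mul, hstV]
    congr 2
    ext i j
    by_cases h : i = j <;> simp [h]
  refine ⟨U, mem_unitaryGroup_iff.2 h1, hspec, fun z hz => ?_⟩
  have hdec : A.map Complex.ofReal - z • (1 : Matrix ι ι ℂ) =
      U * diagonal (fun i => (hA.eigenvalues i : ℂ) - z) * star U := by
    have : diagonal (fun i => (hA.eigenvalues i : ℂ) - z) =
        diagonal (fun i => (hA.eigenvalues i : ℂ)) - z • (1 : Matrix ι ι ℂ) := by
      ext i j
      by_cases h : i = j <;> simp [h]
    rw [this, mul_sub, sub_mul, ← hspec]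
    simp [h1]
  have hinv : (A.map Complex.ofReal - z • (1 : Matrix ι ι ℂ)) *
      (U * diagonal (fun i => ((hA.eigenvalues i : ℂ) - z)⁻¹) * star U) = 1 := by
    rw [hdec]
    calc _ = U * (diagonal (fun i => (hA.eigenvalues i : ℂ) - z) * (star U * U) *
          diagonal (fun i => ((hA.eigenvalues i : ℂ) - z)⁻¹)) * star U := by
            simp only [mul_assoc]
      _ = 1 := by
        rw [h2, mul_one, diagonal_mul_diagonal]
        simp [mul_inv_cancel₀ (ofReal_sub_ne_zero hz _), h1]
  have hres : resolventMatrix A z =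
      U * diagonal (fun i => ((hA.eigenvalues i : ℂ) - z)⁻¹) * star U :=
    Matrix.inv_eq_right_inv hinv
  exact ⟨hres ▸ hinv, hres⟩

theorem sub_mul_resolventMatrix {A : Matrix ι ι ℝ} (hA : A.IsHermitian) {z : ℂ} (hz : 0 < z.im) :
    (A.map Complex.ofReal - z • (1 : Matrix ι ι ℂ)) * resolventMatrix A z = 1 := by
  obtain ⟨U, -, -, h⟩ := exists_resolventMatrix_eq hA
  exact (h z hz).1

theorem resolventMatrix_mul_sub {A : Matrix ι ι ℝ} (hA : A.IsHermitian) {z : ℂ} (hz : 0 < z.im) :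
    resolventMatrix A z * (A.map Complex.ofReal - z • (1 : Matrix ι ι ℂ)) = 1 :=
  mul_eq_one_comm.1 (sub_mul_resolventMatrix hA hz)

theorem transpose_resolventMatrix {A : Matrix ι ι ℝ} (hA : A.IsHermitian) (z : ℂ) :
    (resolventMatrix A z)ᵀ = resolventMatrix A z := by
  rw [resolventMatrix, Matrix.transpose_nonsing_inv]
  congr 1
  ext p q
  simp [Matrix.one_apply, eq_comm, isHermitian_apply_comm hA q p]

theorem resolventMatrix_apply_comm {A : Matrix ι ι ℝ} (hA : A.IsHermitian) (z : ℂ) (p q : ι) :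
    resolventMatrix A z p q = resolventMatrix A z q p := by
  conv_lhs => rw [← transpose_resolventMatrix hA z]
  rfl

theorem trace_resolventMatrix {A : Matrix ι ι ℝ} (hA : A.IsHermitian) {z : ℂ} (hz : 0 < z.im) :
    (resolventMatrix A z).trace = ∑ i, ((hA.eigenvalues i : ℂ) - z)⁻¹ := by
  obtain ⟨U, hU, -, h⟩ := exists_resolventMatrix_eq hA
  rw [(h z hz).2, Matrix.trace_mul_cycle, mem_unitaryGroup_iff'.1 hU, one_mul, trace_diagonal]

theorem norm_resolventMatrix_le {A : Matrix ι ι ℝ} (hA : A.IsHermitian) {z : ℂ} (hz : 0 < z.im) :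
    ‖resolventMatrix A z‖ ≤ z.im⁻¹ := by
  obtain ⟨U, hU, -, h⟩ := exists_resolventMatrix_eq hA
  rw [(h z hz).2, CStarRing.norm_mul_mem_unitary _ (Unitary.star_mem hU),
    CStarRing.norm_mem_unitary_mul _ hU, l2_opNorm_diagonal]
  exact (pi_norm_le_iff_of_nonneg (by positivity)).2 fun i => norm_inv_ofReal_sub_le hz _

theorem sum_norm_sq_col_le (B : Matrix ι ι ℂ) (q : ι) : ∑ p, ‖B p q‖ ^ 2 ≤ ‖B‖ ^ 2 := by
  have h := l2_opNorm_mulVec B (EuclideanSpace.single q (1 : ℂ))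
  rw [PiLp.norm_single, norm_one, mul_one] at h
  have h2 := pow_le_pow_left₀ (norm_nonneg _) h 2
  rw [EuclideanSpace.norm_sq_eq] at h2
  simpa using h2

theorem sum_norm_sq_resolventMatrix_le {A : Matrix ι ι ℝ} (hA : A.IsHermitian) {z : ℂ}
    (hz : 0 < z.im) (p : ι) : ∑ q, ‖resolventMatrix A z p q‖ ^ 2 ≤ (z.im⁻¹) ^ 2 := by
  calc ∑ q, ‖resolventMatrix A z p q‖ ^ 2 = ∑ q, ‖resolventMatrix A z q p‖ ^ 2 := by
        simp_rw [resolventMatrix_apply_comm hA z p]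
    _ ≤ _ := sum_norm_sq_col_le _ _
    _ ≤ _ := pow_le_pow_left₀ (norm_nonneg _) (norm_resolventMatrix_le hA hz) 2

theorem norm_resolventMatrix_apply_le {A : Matrix ι ι ℝ} (hA : A.IsHermitian) {z : ℂ}
    (hz : 0 < z.im) (p q : ι) : ‖resolventMatrix A z p q‖ ≤ z.im⁻¹ := by
  refine le_of_sq_le_sq ?_ (by positivity)
  exact (Finset.single_le_sum (f := fun q => ‖resolventMatrix A z p q‖ ^ 2)
    (fun _ _ => by positivity) (Finset.mem_univ q)).trans (sum_norm_sq_resolventMatrix_le hA hz p)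

/-- The second resolvent identity. -/
theorem resolventMatrix_sub {A B : Matrix ι ι ℝ} (hA : A.IsHermitian) (hB : B.IsHermitian) {z : ℂ}
    (hz : 0 < z.im) : resolventMatrix A z - resolventMatrix B z =
      -(resolventMatrix B z * (A - B).map Complex.ofReal * resolventMatrix A z) := by
  have h : (A - B).map Complex.ofReal = (A.map Complex.ofReal - z • (1 : Matrix ι ι ℂ)) -
      (B.map Complex.ofReal - z • (1 : Matrix ι ι ℂ)) := by
    ext p q
    simp
  rw [h, mul_sub, sub_mul, resolventMatrix_mul_sub hB hz, mul_assoc,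
    sub_mul_resolventMatrix hA hz, mul_one, one_mul, neg_sub]

/-- The trace of a matrix is at most its rank times its operator norm: it is the trace of the
compression to the range. -/
theorem norm_trace_le_rank_mul_norm (B : Matrix ι ι ℂ) : ‖B.trace‖ ≤ B.rank * ‖B‖ := by
  set T : EuclideanSpace ℂ ι →ₗ[ℂ] EuclideanSpace ℂ ι := Matrix.toEuclideanLin B with hT
  have htr : B.trace = LinearMap.trace ℂ _ T := by
    rw [hT, Matrix.toEuclideanLin, Matrix.toLpLin_eq_toLin, Matrix.trace_toLin_eq]
  have hmem : ∀ x, T x ∈ LinearMap.range T := fun x => LinearMap.mem_range_self T x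
  have hrank : Module.finrank ℂ (LinearMap.range T) = B.rank := by
    rw [Matrix.rank_eq_finrank_range_toLin B (PiLp.basisFun 2 ℂ ι) (PiLp.basisFun 2 ℂ ι), hT,
      Matrix.toEuclideanLin, Matrix.toLpLin_eq_toLin]
  rw [htr, ← LinearMap.trace_restrict_eq_of_forall_mem (LinearMap.range T) T hmem,
    LinearMap.trace_eq_sum_inner _ (stdOrthonormalBasis ℂ (LinearMap.range T))]
  refine (norm_sum_le _ _).trans ?_
  refine (Finset.sum_le_card_nsmul _ _ ‖B‖ fun i _ => ?_).trans ?_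
  · set e := stdOrthonormalBasis ℂ (LinearMap.range T) i with he
    have h1 : ‖e‖ = 1 := (stdOrthonormalBasis ℂ (LinearMap.range T)).orthonormal.1 i
    refine (norm_inner_le_norm _ _).trans ?_
    rw [h1, one_mul]
    have h3 := l2_opNorm_mulVec B (e : EuclideanSpace ℂ ι)
    have h2 : ‖(e : EuclideanSpace ℂ ι)‖ = 1 := h1
    rw [h2, mul_one] at h3
    exact h3
  · simp [hrank]

theorem rank_map_ofReal_le {A : Matrix ι ι ℝ} (hA : A.IsHermitian) :
    (A.map Complex.ofReal).rank ≤ A.rank := by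
  obtain ⟨U, -, h, -⟩ := exists_resolventMatrix_eq hA
  rw [h, hA.rank_eq_card_non_zero_eigs]
  refine (rank_mul_le_left _ _).trans ((rank_mul_le_right _ _).trans ?_)
  rw [rank_diagonal]
  simp

/-- Changing a Hermitian matrix by a matrix of rank `r` changes the trace of the resolvent by at
most `2 r / Im z`. -/
theorem norm_trace_resolventMatrix_sub_le_rank {A B : Matrix ι ι ℝ} (hA : A.IsHermitian)
    (hB : B.IsHermitian) {z : ℂ} (hz : 0 < z.im) :
    ‖(resolventMatrix A z).trace - (resolventMatrix B z).trace‖ ≤ (A - B).rank * (2 * z.im⁻¹) := by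
  rw [← trace_sub]
  refine (norm_trace_le_rank_mul_norm _).trans ?_
  refine mul_le_mul ?_ ?_ (norm_nonneg _) (by positivity)
  · rw [resolventMatrix_sub hA hB hz, ← neg_mul, ← neg_mul]
    exact_mod_cast (rank_mul_le_left _ _).trans ((rank_mul_le_right _ _).trans
      (rank_map_ofReal_le (hA.sub hB)))
  · have h1 := norm_resolventMatrix_le hA hz
    have h2 := norm_resolventMatrix_le hB hz
    linarith [norm_sub_le (resolventMatrix A z) (resolventMatrix B z)]

theorem rank_add_le_add_rank (A B : Matrix ι ι ℝ) : (A + B).rank ≤ A.rank + B.rank := by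
  have h := LinearMap.rank_add_le A.mulVecLin B.mulVecLin
  rw [← Matrix.mulVecLin_add, LinearMap.rank, LinearMap.rank, LinearMap.rank,
    ← Module.finrank_eq_rank, ← Module.finrank_eq_rank, ← Module.finrank_eq_rank] at h
  exact_mod_cast h

/-- A matrix supported on the rows and the columns indexed by `S` has rank at most
`2 |S|`. -/
theorem rank_le_two_mul_card {D : Matrix ι ι ℝ} (S : Finset ι)
    (hD : ∀ p q, p ∉ S → q ∉ S → D p q = 0) : D.rank ≤ 2 * S.card := by
  have h : D = Matrix.of (fun p q => if p ∈ S then D p q else 0) +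
      (Matrix.of fun q p => if p ∈ S then 0 else D p q)ᵀ := by
    ext p q
    by_cases hp : p ∈ S <;> simp [hp]
  rw [h, two_mul]
  refine (rank_add_le_add_rank _ _).trans (add_le_add ?_ ?_)
  · refine rank_le_card_of_support_subset _ S fun p hp => ?_
    by_contra hpS
    have hpS' : p ∉ S := by simpa using hpS
    refine hp (funext fun q => ?_)
    simp [Matrix.row, hpS']
  · rw [rank_transpose]
    refine rank_le_card_of_support_subset _ S fun q hq => ?_
    by_contra hqS
    have hqS' : q ∉ S := by simpa using hqS
    refine hq (funext fun p => ?_)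
    by_cases hp : p ∈ S <;> simp [Matrix.row, hp, hqS', hD]

theorem norm_apply_le_l2_opNorm (B : Matrix ι ι ℂ) (p q : ι) : ‖B p q‖ ≤ ‖B‖ := by
  refine le_of_sq_le_sq ?_ (norm_nonneg _)
  exact (Finset.single_le_sum (f := fun p => ‖B p q‖ ^ 2)
    (fun _ _ => by positivity) (Finset.mem_univ p)).trans (sum_norm_sq_col_le B q)

/-- Changing a Hermitian matrix by `D` changes the trace of the resolvent by at most
`(∑ |D p q|) / (Im z)²`. -/
theorem norm_trace_resolventMatrix_sub_le_sum {A B : Matrix ι ι ℝ} (hA : A.IsHermitian)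
    (hB : B.IsHermitian) {z : ℂ} (hz : 0 < z.im) :
    ‖(resolventMatrix A z).trace - (resolventMatrix B z).trace‖ ≤
      (∑ p, ∑ q, |(A - B) p q|) * z.im⁻¹ ^ 2 := by
  have hG : ‖resolventMatrix A z * resolventMatrix B z‖ ≤ z.im⁻¹ ^ 2 := by
    rw [sq]
    exact (norm_mul_le _ _).trans (mul_le_mul (norm_resolventMatrix_le hA hz)
      (norm_resolventMatrix_le hB hz) (norm_nonneg _) (by positivity))
  rw [← trace_sub, resolventMatrix_sub hA hB hz, trace_neg, norm_neg, trace_mul_cycle,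
    trace_mul_comm, Finset.sum_mul]
  simp only [Matrix.trace, Matrix.diag]
  refine (norm_sum_le _ _).trans (Finset.sum_le_sum fun p _ => ?_)
  rw [Matrix.mul_apply, Finset.sum_mul]
  refine (norm_sum_le _ _).trans (Finset.sum_le_sum fun q _ => ?_)
  rw [norm_mul]
  refine mul_le_mul (by
    rw [Matrix.map_apply, Complex.norm_real, Real.norm_eq_abs])
    ((norm_apply_le_l2_opNorm _ _ _).trans hG) (norm_nonneg _) (abs_nonneg _)

theorem measurable_resolventMatrix_apply {Ω : Type*} [MeasurableSpace Ω] {A : Ω → Matrix ι ι ℝ}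
    (hA : ∀ p q, Measurable fun ω => A ω p q) (z : ℂ) (p q : ι) :
    Measurable fun ω => resolventMatrix (A ω) z p q := by
  set B : Ω → Matrix ι ι ℂ := fun ω => (A ω).map Complex.ofReal - z • (1 : Matrix ι ι ℂ) with hB
  have hBm : ∀ p q, Measurable fun ω => B ω p q := fun p q => by
    simp only [hB, Matrix.sub_apply, Matrix.map_apply]
    exact (Complex.measurable_ofReal.comp (hA p q)).sub_const _
  have hdet : Measurable fun ω => (B ω).det := by
    simp only [Matrix.det_apply]
    exact Finset.measurable_sum _ fun σ _ =>
      (Finset.measurable_prod _ fun i _ => hBm _ _).const_smul _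
  have hadj : Measurable fun ω => (B ω).adjugate p q := by
    simp only [Matrix.adjugate_apply, Matrix.det_apply]
    refine Finset.measurable_sum _ fun σ _ =>
      (Finset.measurable_prod _ fun i _ => ?_).const_smul _
    by_cases h : σ i = q
    · simp [Matrix.updateRow_apply, h]
    · simpa [Matrix.updateRow_apply, h] using hBm _ _
  have h : (fun ω => resolventMatrix (A ω) z p q) =
      fun ω => ((B ω).det)⁻¹ * (B ω).adjugate p q := by
    funext ω
    simp only [resolventMatrix, Matrix.inv_def, hB, Ring.inverse_eq_inv', Matrix.smul_apply,
      smul_eq_mul]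
  rw [h]
  exact hdet.inv.mul hadj

/-- The normalized trace of the resolvent, which is the Stieltjes transform of the empirical
spectral distribution. -/
noncomputable def resolventMean (A : Matrix ι ι ℝ) (z : ℂ) : ℂ :=
  (Fintype.card ι : ℂ)⁻¹ * (resolventMatrix A z).trace

theorem measurable_resolventMean {Ω : Type*} [MeasurableSpace Ω] {A : Ω → Matrix ι ι ℝ}
    (hA : ∀ p q, Measurable fun ω => A ω p q) (z : ℂ) :
    Measurable fun ω => resolventMean (A ω) z := by
  unfold resolventMean Matrix.trace
  exact (Finset.measurable_sum _ fun p _ =>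
    measurable_resolventMatrix_apply hA z p p).const_mul _

theorem norm_resolventMean_sub_le_rank {A B : Matrix ι ι ℝ} (hA : A.IsHermitian)
    (hB : B.IsHermitian) {z : ℂ} (hz : 0 < z.im) :
    ‖resolventMean A z - resolventMean B z‖ ≤
      ((A - B).rank / (Fintype.card ι : ℝ)) * (2 * z.im⁻¹) := by
  rw [resolventMean, resolventMean, ← mul_sub, norm_mul, norm_inv, Complex.norm_natCast,
    div_eq_inv_mul, mul_assoc]
  exact mul_le_mul_of_nonneg_left (norm_trace_resolventMatrix_sub_le_rank hA hB hz) (by positivity)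

theorem norm_resolventMean_sub_le_sum {A B : Matrix ι ι ℝ} (hA : A.IsHermitian)
    (hB : B.IsHermitian) {z : ℂ} (hz : 0 < z.im) :
    ‖resolventMean A z - resolventMean B z‖ ≤
      (Fintype.card ι : ℝ)⁻¹ * (∑ p, ∑ q, |(A - B) p q|) * z.im⁻¹ ^ 2 := by
  rw [resolventMean, resolventMean, ← mul_sub, norm_mul, norm_inv, Complex.norm_natCast, mul_assoc]
  exact mul_le_mul_of_nonneg_left (norm_trace_resolventMatrix_sub_le_sum hA hB hz) (by positivity)

theorem norm_resolventMean_le {A : Matrix ι ι ℝ} (hA : A.IsHermitian) {z : ℂ} (hz : 0 < z.im) :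
    ‖resolventMean A z‖ ≤ z.im⁻¹ := by
  rw [resolventMean, norm_mul, norm_inv, Complex.norm_natCast]
  have h : ‖(resolventMatrix A z).trace‖ ≤ Fintype.card ι * z.im⁻¹ := by
    refine (norm_sum_le_of_le _ fun p _ => norm_resolventMatrix_apply_le hA hz p p).trans ?_
    simp
  rcases (Nat.cast_nonneg (α := ℝ) (Fintype.card ι)).eq_or_lt with h0 | h0
  · rw [← h0]
    simp
    positivity
  · rwa [inv_mul_le_iff₀ h0]

theorem resolventMean_im_nonneg {A : Matrix ι ι ℝ} (hA : A.IsHermitian) {z : ℂ} (hz : 0 < z.im) :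
    0 ≤ (resolventMean A z).im := by
  rw [resolventMean, trace_resolventMatrix hA hz, ← Complex.ofReal_natCast, ← Complex.ofReal_inv,
    Complex.im_ofReal_mul, Complex.im_sum]
  refine mul_nonneg (by positivity) (Finset.sum_nonneg fun i _ => ?_)
  rw [Complex.inv_im]
  refine div_nonneg ?_ (Complex.normSq_nonneg _)
  simp [hz.le]

end Resolvent

/-! ### Bounded differences on product spaces -/

section BoundedDifferences

/-- **McDiarmid's inequality**, on a product space and in the form of a bound on the
moment-generating function: a function with bounded differences `c` in each of its `n` arguments is
sub-Gaussian around its mean with variance proxy `n c²`. The proof integrates out one argument at a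
time, with Hoeffding's lemma in that argument. -/
theorem integral_exp_sub_integral_le {n : ℕ} {α : Fin n → Type*} [∀ i, MeasurableSpace (α i)]
    (ν : ∀ i, Measure (α i)) [∀ i, IsProbabilityMeasure (ν i)] (f : (∀ i, α i) → ℝ)
    (hf : Measurable f) (c : ℝ) (C : ℝ) (hC : ∀ x, |f x| ≤ C)
    (hc : ∀ x y : ∀ i, α i, ∀ i, (∀ j, j ≠ i → x j = y j) → |f x - f y| ≤ c) (t : ℝ) :
    ∫ x, Real.exp (t * (f x - ∫ y, f y ∂Measure.pi ν)) ∂Measure.pi ν ≤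
      Real.exp (n * c ^ 2 * t ^ 2 / 2) := by
  induction n with
  | zero =>
    have : ∀ x, f x = ∫ y, f y ∂Measure.pi ν := by
      intro x
      have : f = fun _ => f x := by
        funext y
        congr 1
        exact Subsingleton.elim _ _
      rw [this]
      simp
    have h1 : (fun x => Real.exp (t * (f x - ∫ y, f y ∂Measure.pi ν))) = fun _ => 1 := by
      funext x
      rw [← this x, sub_self, mul_zero, Real.exp_zero]
    rw [h1]
    simp
  | succ n ih =>
    set ν' : ∀ i : Fin n, Measure (α (Fin.succ i)) := fun i => ν i.succ
    have hmp := (measurePreserving_piFinSuccAbove ν 0).symm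
    set e := (MeasurableEquiv.piFinSuccAbove α 0).symm with he
    have he0 : ∀ p, e p 0 = p.1 := fun p => rfl
    have hes : ∀ p (k : Fin n), e p k.succ = p.2 k := fun p k => rfl
    set F : α 0 × (∀ i : Fin n, α i.succ) → ℝ := fun p => f (e p) with hF
    have hFm : Measurable F := hf.comp e.measurable
    have hFC : ∀ p, |F p| ≤ C := fun p => hC _
    -- the conditional mean given all the arguments but the first
    set g : (∀ i : Fin n, α i.succ) → ℝ := fun y => ∫ a, F (a, y) ∂ν 0 with hg
    have hgm : Measurable g := by
      have := (hFm.comp measurable_swap).stronglyMeasurable.integral_prod_right' (ν := ν 0)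
      exact this.measurable
    have hFint : ∀ y, Integrable (fun a => F (a, y)) (ν 0) := fun y =>
      Integrable.of_bound (hFm.comp measurable_prodMk_right).aestronglyMeasurable C
        (Eventually.of_forall fun a => by rw [Real.norm_eq_abs]; exact hFC _)
    have hgC : ∀ y, |g y| ≤ C := by
      intro y
      have := norm_integral_le_of_norm_le_const (μ := ν 0) (f := fun a => F (a, y)) (C := C)
        (Eventually.of_forall fun a => by rw [Real.norm_eq_abs]; exact hFC _)
      simpa using this
    have hgc : ∀ x y : ∀ i : Fin n, α i.succ, ∀ i, (∀ j, j ≠ i → x j = y j) → |g x - g y| ≤ c := by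
      intro x y i hxy
      have h1 : g x - g y = ∫ a, (F (a, x) - F (a, y)) ∂ν 0 :=
        (integral_sub (hFint x) (hFint y)).symm
      rw [h1]
      have := norm_integral_le_of_norm_le_const (μ := ν 0) (f := fun a => F (a, x) - F (a, y))
        (C := c) (Eventually.of_forall fun a => by
          refine hc _ _ i.succ fun j hj => ?_
          refine Fin.cases ?_ (fun k hk => ?_) j hj
          · intro _
            exact (he0 (a, x)).trans (he0 (a, y)).symm
          · have : k ≠ i := fun h => hk (by rw [h])
            exact (hes (a, x) k).trans ((hxy k this).trans (hes (a, y) k).symm))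
      simpa using this
    have hmean : ∫ y, f y ∂Measure.pi ν = ∫ y, g y ∂Measure.pi ν' := by
      rw [← hmp.integral_comp' f]
      refine integral_prod_symm _ ?_
      exact Integrable.of_bound hFm.aestronglyMeasurable C
        (Eventually.of_forall fun a => by rw [Real.norm_eq_abs]; exact hFC _)
    set m := ∫ y, g y ∂Measure.pi ν' with hm
    have hexpbd : ∀ x, |x| ≤ 2 * C → Real.exp (t * x) ≤ Real.exp (|t| * (2 * C)) := fun x hx =>
      Real.exp_le_exp.2 ((le_abs_self _).trans (by rw [abs_mul]; gcongr))
    have hmC : |m| ≤ C := by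
      have := norm_integral_le_of_norm_le_const (μ := Measure.pi ν') (f := g) (C := C)
        (Eventually.of_forall fun a => by rw [Real.norm_eq_abs]; exact hgC _)
      simpa using this
    rw [hmean]
    -- Hoeffding's lemma in the first argument
    have hHoeff : ∀ y, ∫ a, Real.exp (t * (F (a, y) - g y)) ∂ν 0 ≤
        Real.exp (c ^ 2 * t ^ 2 / 2) := by
      intro y
      obtain ⟨a₀⟩ : Nonempty (α 0) := (ν 0).nonempty_of_neZero
      have h := (hasSubgaussianMGF_of_mem_Icc (μ := ν 0) (X := fun a => F (a, y))
        (a := F (a₀, y) - c) (b := F (a₀, y) + c)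
        (hFm.comp measurable_prodMk_right).aemeasurable (Eventually.of_forall fun a => by
          have := hc (e (a, y)) (e (a₀, y)) 0 (fun j hj => by
            obtain ⟨k, rfl⟩ := Fin.exists_succ_eq.2 hj
            exact (hes (a, y) k).trans (hes (a₀, y) k).symm)
          have := abs_le.1 this
          have hFa : ∀ a, F (a, y) = f (e (a, y)) := fun a => rfl
          rw [hFa, hFa]
          constructor <;> linarith)).mgf_le t
      refine h.trans (Real.exp_le_exp.2 ?_)
      have : F (a₀, y) + c - (F (a₀, y) - c) = 2 * c := by ring
      rw [this]
      simp
    calc ∫ x, Real.exp (t * (f x - m)) ∂Measure.pi ν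
        = ∫ p, Real.exp (t * (F p - m)) ∂((ν 0).prod (Measure.pi ν')) :=
          (hmp.integral_comp' fun x => Real.exp (t * (f x - m))).symm
      _ = ∫ y, ∫ a, Real.exp (t * (F (a, y) - m)) ∂ν 0 ∂Measure.pi ν' := by
          refine integral_prod_symm _ (Integrable.of_bound ?_ (Real.exp (|t| * (2 * C))) ?_)
          · exact (Real.measurable_exp.comp ((hFm.sub_const _).const_mul _)).aestronglyMeasurable
          · refine Eventually.of_forall fun p => ?_
            rw [Real.norm_eq_abs, Real.abs_exp]
            refine hexpbd _ ?_
            have := abs_sub (F p) m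
            linarith [hFC p]
      _ ≤ ∫ y, Real.exp (c ^ 2 * t ^ 2 / 2) * Real.exp (t * (g y - m)) ∂Measure.pi ν' := by
          refine integral_mono_of_nonneg (Eventually.of_forall fun y => by positivity) ?_
            (Eventually.of_forall fun y => ?_)
          · refine Integrable.const_mul (Integrable.of_bound ?_ (Real.exp (|t| * (2 * C))) ?_) _
            · exact (Real.measurable_exp.comp
                ((hgm.sub_const _).const_mul _)).aestronglyMeasurable
            · refine Eventually.of_forall fun p => ?_
              rw [Real.norm_eq_abs, Real.abs_exp]
              refine hexpbd _ ?_
              have := abs_sub (g p) m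
              linarith [hgC p]
          · have : ∀ a, Real.exp (t * (F (a, y) - m)) =
                Real.exp (t * (F (a, y) - g y)) * Real.exp (t * (g y - m)) := by
              intro a
              rw [← Real.exp_add]
              ring_nf
            simp only [this, integral_mul_const]
            exact mul_le_mul_of_nonneg_right (hHoeff y) (by positivity)
      _ = Real.exp (c ^ 2 * t ^ 2 / 2) * ∫ y, Real.exp (t * (g y - m)) ∂Measure.pi ν' :=
          integral_const_mul _ _
      _ ≤ Real.exp (c ^ 2 * t ^ 2 / 2) * Real.exp (n * c ^ 2 * t ^ 2 / 2) := by
          gcongr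
          exact ih ν' g hgm hgC hgc
      _ = _ := by
          rw [← Real.exp_add]
          push_cast
          ring_nf

end BoundedDifferences

/-! ### Concentration of the Stieltjes transform -/

section Concentration

/-- McDiarmid's inequality for a function of independent random variables. -/
theorem hasSubgaussianMGF_of_bounded_differences {Ω : Type*} [MeasurableSpace Ω] {μ : Measure Ω}
    [IsProbabilityMeasure μ] {n : ℕ} {α : Fin n → Type*} [∀ i, MeasurableSpace (α i)]
    {X : ∀ i, Ω → α i} (hX : ∀ i, Measurable (X i)) (hind : iIndepFun X μ) {f : (∀ i, α i) → ℝ}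
    (hf : Measurable f) {c C : ℝ} (hC : ∀ x, |f x| ≤ C)
    (hc : ∀ x y : ∀ i, α i, ∀ i, (∀ j, j ≠ i → x j = y j) → |f x - f y| ≤ c) :
    HasSubgaussianMGF (fun ω => f (fun i => X i ω) - ∫ ω', f (fun i => X i ω') ∂μ)
      (Real.toNNReal (n * c ^ 2)) μ := by
  have hXm : Measurable fun ω i => X i ω := measurable_pi_lambda _ hX
  have hmap := (iIndepFun_iff_map_fun_eq_pi_map fun i => (hX i).aemeasurable).1 hind
  have hprob : ∀ i, IsProbabilityMeasure (μ.map (X i)) := fun i =>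
    Measure.isProbabilityMeasure_map (hX i).aemeasurable
  have hmean : ∫ ω', f (fun i => X i ω') ∂μ = ∫ x, f x ∂Measure.pi fun i => μ.map (X i) := by
    rw [← hmap, integral_map hXm.aemeasurable hf.aestronglyMeasurable]
  have hm : |∫ ω', f (fun i => X i ω') ∂μ| ≤ C := by
    have := norm_integral_le_of_norm_le_const (μ := μ) (f := fun ω' => f (fun i => X i ω')) (C := C)
      (Eventually.of_forall fun a => by rw [Real.norm_eq_abs]; exact hC _)
    simpa using this
  refine ⟨fun t => ?_, fun t => ?_⟩
  · refine integrable_exp_mul_of_mem_Icc (a := -(2 * C)) (b := 2 * C)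
      ((hf.comp hXm).sub_const _).aemeasurable (Eventually.of_forall fun ω => ?_)
    have h1 := abs_le.1 (hC fun i => X i ω)
    have h2 := abs_le.1 hm
    constructor <;> linarith
  · have h := integral_exp_sub_integral_le (fun i => μ.map (X i)) f hf c C hC hc t
    rw [← hmean, ← hmap, integral_map hXm.aemeasurable
      (Measurable.aestronglyMeasurable (by fun_prop))] at h
    rw [Real.coe_toNNReal _ (by positivity)]
    exact h

/-- The symmetric block matrix with prescribed block columns on and above the block diagonal. The
diagonal blocks, which need not be symmetric, are symmetrized, so that the result is symmetric for
every choice of the block columns. -/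
noncomputable def ofBlockColumns {n d : ℕ}
    (x : (j : Fin n) → {i : Fin n // i ≤ j} → Fin d → Fin d → ℝ) :
    Matrix (Fin n × Fin d) (Fin n × Fin d) ℝ :=
  Matrix.of fun p q =>
    ((if h : p.1 ≤ q.1 then x q.1 ⟨p.1, h⟩ p.2 q.2 else x p.1 ⟨q.1, (not_le.1 h).le⟩ q.2 p.2) +
      (if h : q.1 ≤ p.1 then x p.1 ⟨q.1, h⟩ q.2 p.2 else x q.1 ⟨p.1, (not_le.1 h).le⟩ p.2 q.2)) / 2

theorem isHermitian_ofBlockColumns {n d : ℕ}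
    (x : (j : Fin n) → {i : Fin n // i ≤ j} → Fin d → Fin d → ℝ) :
    (ofBlockColumns x).IsHermitian := by
  ext p q
  simp only [Matrix.conjTranspose_apply, ofBlockColumns, Matrix.of_apply, star_trivial]
  rw [add_comm]

theorem ofBlockColumns_of_isHermitian {n d : ℕ} {A : Matrix (Fin n × Fin d) (Fin n × Fin d) ℝ}
    (hA : A.IsHermitian) :
    ofBlockColumns (fun j (i : {i : Fin n // i ≤ j}) a b => A (i.1, a) (j, b)) = A := by
  ext p q
  have h := isHermitian_apply_comm hA p q
  simp only [ofBlockColumns, Matrix.of_apply, Prod.mk.eta, h]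
  simp

theorem measurable_ofBlockColumns_apply {n d : ℕ} (p q : Fin n × Fin d) :
    Measurable fun x : (j : Fin n) → {i : Fin n // i ≤ j} → Fin d → Fin d → ℝ =>
      ofBlockColumns x p q := by
  simp only [ofBlockColumns, Matrix.of_apply]
  refine Measurable.div_const (Measurable.add ?_ ?_) _ <;> split_ifs <;> fun_prop

theorem rank_ofBlockColumns_sub_le {n d : ℕ}
    (x y : (j : Fin n) → {i : Fin n // i ≤ j} → Fin d → Fin d → ℝ) (k : Fin n)
    (hxy : ∀ j, j ≠ k → x j = y j) (c : ℝ) :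
    (c • ofBlockColumns x - c • ofBlockColumns y).rank ≤ 2 * d := by
  have h := rank_le_two_mul_card (D := c • ofBlockColumns x - c • ofBlockColumns y)
    ((Finset.univ : Finset (Fin d)).map ⟨fun a => (k, a), fun a b h => (Prod.mk.inj h).2⟩)
    (fun p q hp hq => by
      have hp' : p.1 ≠ k := fun h => hp (by simp [← h])
      have hq' : q.1 ≠ k := fun h => hq (by simp [← h])
      simp [ofBlockColumns, hxy _ hp', hxy _ hq'])
  simpa using h

/-- The Stieltjes transform of a random symmetric matrix with independent block columns is
sub-Gaussian around its mean with variance proxy of order `1 / n`, since one block column moves it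
by `O(1 / n)`. Here `φ` is the real or the imaginary part. -/
theorem hasSubgaussianMGF_resolventMean {Ω : Type*} [MeasurableSpace Ω] {μ : Measure Ω}
    [IsProbabilityMeasure μ] {n d : ℕ} (hd : 0 < d)
    {M : Ω → Matrix (Fin n × Fin d) (Fin n × Fin d) ℝ} (hM : ∀ ω, (M ω).IsHermitian)
    (hmeas : ∀ p q, Measurable fun ω => M ω p q)
    (hcolumns : iIndepFun (fun (j : Fin n) (ω : Ω) (i : {i : Fin n // i ≤ j}) (a b : Fin d) =>
        M ω (i.1, a) (j, b)) μ) (c : ℝ) {z : ℂ} (hz : 0 < z.im) (φ : ℂ →L[ℝ] ℝ)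
    (hφ : ∀ w, |φ w| ≤ ‖w‖) :
    HasSubgaussianMGF (fun ω => φ (resolventMean (c • M ω) z) -
      ∫ ω', φ (resolventMean (c • M ω') z) ∂μ) (Real.toNNReal (16 * z.im⁻¹ ^ 2 / n)) μ := by
  have hH : ∀ x : (j : Fin n) → {i : Fin n // i ≤ j} → Fin d → Fin d → ℝ,
    (c • ofBlockColumns x).IsHermitian :=
      fun x => isHermitian_real_smul (isHermitian_ofBlockColumns x) c
  have h := hasSubgaussianMGF_of_bounded_differences (μ := μ)
    (X := fun (j : Fin n) (ω : Ω) (i : {i : Fin n // i ≤ j}) (a b : Fin d) => M ω (i.1, a) (j, b))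
    (fun j => measurable_pi_lambda _ fun i => measurable_pi_lambda _ fun a =>
      measurable_pi_lambda _ fun b => hmeas _ _) hcolumns
    (f := fun x => φ (resolventMean (c • ofBlockColumns x) z))
    (φ.measurable.comp (measurable_resolventMean (fun p q => by
      simpa using (measurable_ofBlockColumns_apply p q).const_mul c) z))
    (c := 4 * z.im⁻¹ / n) (C := z.im⁻¹)
    (fun x => (hφ _).trans (norm_resolventMean_le (hH x) hz))
    (fun x y k hxy => by
      rw [← map_sub]
      refine (hφ _).trans ((norm_resolventMean_sub_le_rank (hH x) (hH y) hz).trans ?_)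
      have hr : ((c • ofBlockColumns x - c • ofBlockColumns y).rank : ℝ) ≤ 2 * d := by
        exact_mod_cast rank_ofBlockColumns_sub_le x y k hxy c
      have hn : 0 < (n : ℝ) := by exact_mod_cast Fin.pos k
      have hd' : 0 < (d : ℝ) := by exact_mod_cast hd
      simp only [Fintype.card_prod, Fintype.card_fin, Nat.cast_mul]
      calc _ ≤ (2 * d) / ((n : ℝ) * d) * (2 * z.im⁻¹) := by gcongr
        _ = _ := by field_simp; ring)
  simp only [ofBlockColumns_of_isHermitian (hM _)] at h
  convert h using 2
  rcases Nat.eq_zero_or_pos n with rfl | hn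
  · simp
  · have hn : 0 < (n : ℝ) := by exact_mod_cast hn
    field_simp
    ring

/-- Almost sure concentration: the sub-Gaussian tails are summable, so that the Borel–Cantelli lemma
applies whatever the dependence between different `n`. -/
theorem ae_tendsto_resolventMean_sub_integral {Ω : Type*} [MeasurableSpace Ω] {μ : Measure Ω}
    [IsProbabilityMeasure μ] {d : ℕ} (hd : 0 < d)
    {M : (n : ℕ) → Ω → Matrix (Fin n × Fin d) (Fin n × Fin d) ℝ} (hM : ∀ n ω, (M n ω).IsHermitian)
    (hmeas : ∀ n p q, Measurable fun ω => M n ω p q)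
    (hcolumns : ∀ n, iIndepFun
      (fun (j : Fin n) (ω : Ω) (i : {i : Fin n // i ≤ j}) (a b : Fin d) =>
        M n ω (i.1, a) (j, b)) μ) (c : ℕ → ℝ) {z : ℂ} (hz : 0 < z.im) :
    ∀ᵐ ω ∂μ, Tendsto (fun n => resolventMean (c n • M n ω) z -
      ∫ ω', resolventMean (c n • M n ω') z ∂μ) atTop (𝓝 0) := by
  have hint : ∀ n, Integrable (fun ω => resolventMean (c n • M n ω) z) μ := fun n =>
    Integrable.of_bound (measurable_resolventMean (fun p q => by
      simpa using (hmeas n p q).const_mul (c n)) z).aestronglyMeasurable z.im⁻¹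
      (Eventually.of_forall fun ω => norm_resolventMean_le (isHermitian_real_smul (hM n ω) _) hz)
  have key : ∀ φ : ℂ →L[ℝ] ℝ, (∀ w, |φ w| ≤ ‖w‖) → ∀ᵐ ω ∂μ,
      Tendsto (fun n => φ (resolventMean (c n • M n ω) z -
        ∫ ω', resolventMean (c n • M n ω') z ∂μ)) atTop (𝓝 0) := by
    intro φ hφ
    set Y : ℕ → Ω → ℝ := fun n ω => φ (resolventMean (c n • M n ω) z -
        ∫ ω', resolventMean (c n • M n ω') z ∂μ) with hY
    have hsub : ∀ n, HasSubgaussianMGF (Y n) (Real.toNNReal (16 * z.im⁻¹ ^ 2 / n)) μ := by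
      intro n
      have := hasSubgaussianMGF_resolventMean hd (hM n) (hmeas n) (hcolumns n) (c n) hz φ hφ
      refine this.congr (Eventually.of_forall fun ω => ?_)
      simp only [hY, map_sub]
      rw [φ.integral_comp_comm (hint n)]
    have htail : ∀ t : ℝ, 0 < t → ∀ᵐ ω ∂μ, ∀ᶠ n in atTop, |Y n ω| < t := by
      intro t ht
      set r : ℝ := t ^ 2 * z.im ^ 2 / 32 with hr
      have hr0 : 0 < r := by positivity
      have hb : ∀ n : ℕ, μ {ω | t ≤ |Y n ω|} ≤ ENNReal.ofReal (2 * Real.exp (-r) ^ n) := by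
        intro n
        have hexp : Real.exp (-t ^ 2 / (2 * (Real.toNNReal (16 * z.im⁻¹ ^ 2 / n) : ℝ≥0))) ≤
            Real.exp (-r) ^ n ∨ n = 0 := by
          rcases Nat.eq_zero_or_pos n with h0 | hn
          · exact Or.inr h0
          · left
            have hn : 0 < (n : ℝ) := by exact_mod_cast hn
            rw [Real.coe_toNNReal _ (by positivity), ← Real.exp_nat_mul, Real.exp_le_exp, hr]
            apply le_of_eq
            field_simp
            norm_num
        rcases hexp with hexp | rfl
        · have h1 := ((hsub n).measure_ge_le ht.le).trans hexp
          have h2 := ((hsub n).neg.measure_ge_le ht.le).trans hexp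
          rw [← ENNReal.ofReal_toReal (measure_ne_top μ _)]
          apply ENNReal.ofReal_le_ofReal
          have hset : {ω | t ≤ |Y n ω|} ⊆ {ω | t ≤ Y n ω} ∪ {ω | t ≤ (-Y n) ω} := by
            intro ω hω
            simpa [le_abs] using hω
          change μ.real _ ≤ _
          refine (measureReal_mono hset).trans ((measureReal_union_le _ _).trans ?_)
          linarith
        · refine prob_le_one.trans ?_
          rw [pow_zero, mul_one, ← ENNReal.ofReal_one]
          exact ENNReal.ofReal_le_ofReal (by norm_num)
      have hsum : ∑' n, μ {ω | t ≤ |Y n ω|} ≠ ∞ := by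
        have hs : Summable fun n : ℕ => 2 * Real.exp (-r) ^ n :=
          (summable_geometric_of_lt_one (Real.exp_pos _).le
            (Real.exp_lt_one_iff.2 (by linarith))).mul_left 2
        exact ne_top_of_le_ne_top hs.tsum_ofReal_ne_top (ENNReal.tsum_le_tsum hb)
      filter_upwards [ae_eventually_notMem hsum] with ω hω
      filter_upwards [hω] with n hn
      simpa using hn
    have hall : ∀ᵐ ω ∂μ, ∀ k : ℕ, ∀ᶠ n in atTop, |Y n ω| < 1 / ((k : ℝ) + 1) :=
      ae_all_iff.2 fun k => htail _ (by positivity)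
    filter_upwards [hall] with ω hω
    rw [Metric.tendsto_atTop]
    intro ε hε
    obtain ⟨k, hk⟩ := exists_nat_one_div_lt hε
    obtain ⟨N, hN⟩ := eventually_atTop.1 (hω k)
    exact ⟨N, fun n hn => by
      rw [Real.dist_eq, sub_zero]
      exact (hN n hn).trans hk⟩
  filter_upwards [key Complex.reCLM Complex.abs_re_le_norm, key Complex.imCLM
    Complex.abs_im_le_norm] with ω hre him
  have h := ((Complex.continuous_ofReal.tendsto 0).comp hre).add
    (((Complex.continuous_ofReal.tendsto 0).comp him).mul_const Complex.I)
  simpa only [Function.comp_def, Complex.reCLM_apply, Complex.imCLM_apply, Complex.re_add_im,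
    Complex.ofReal_zero, zero_mul, add_zero] using h

end Concentration

/-! ### Second-order expansion of the resolvent -/

section ResolventExpansion

variable {ι : Type*} [Fintype ι] [DecidableEq ι]

theorem norm_sum_mul_mul_le {ι : Type*} [Fintype ι] {D : Matrix ι ι ℝ} {f g : ι → ℂ} {F G : ℝ}
    (hf : ∀ r, ‖f r‖ ≤ F) (hg : ∀ s, ‖g s‖ ≤ G) (hF : 0 ≤ F) :
    ‖∑ r, ∑ s, f r * (D r s : ℂ) * g s‖ ≤ (∑ r, ∑ s, |D r s|) * (F * G) := by
  rw [Finset.sum_mul]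
  refine (norm_sum_le _ _).trans (Finset.sum_le_sum fun r _ => ?_)
  rw [Finset.sum_mul]
  refine (norm_sum_le _ _).trans (Finset.sum_le_sum fun s _ => ?_)
  rw [norm_mul, norm_mul, Complex.norm_real, Real.norm_eq_abs]
  calc ‖f r‖ * |D r s| * ‖g s‖ ≤ F * |D r s| * G := by
        gcongr
        · exact hf r
        · exact hg s
    _ = _ := by ring

theorem resolventMatrix_apply_sub {A B : Matrix ι ι ℝ} (hA : A.IsHermitian) (hB : B.IsHermitian)
    {z : ℂ} (hz : 0 < z.im) (p q : ι) : resolventMatrix A z p q - resolventMatrix B z p q =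
      -∑ r, ∑ s, resolventMatrix B z p r * ((A - B) r s : ℝ) * resolventMatrix A z s q := by
  have h := congrFun (congrFun (resolventMatrix_sub hA hB hz) p) q
  rw [Matrix.sub_apply, Matrix.neg_apply, mul_assoc, Matrix.mul_apply] at h
  rw [h]
  simp only [Matrix.mul_apply, Matrix.map_apply, Finset.mul_sum, mul_assoc]

theorem norm_resolventMatrix_apply_sub_le {A B : Matrix ι ι ℝ} (hA : A.IsHermitian)
    (hB : B.IsHermitian) {z : ℂ} (hz : 0 < z.im) (p q : ι) :
    ‖resolventMatrix A z p q - resolventMatrix B z p q‖ ≤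
      (∑ r, ∑ s, |(A - B) r s|) * (z.im⁻¹ * z.im⁻¹) := by
  rw [resolventMatrix_apply_sub hA hB hz, norm_neg]
  exact norm_sum_mul_mul_le (fun r => norm_resolventMatrix_apply_le hB hz _ _)
    (fun s => norm_resolventMatrix_apply_le hA hz _ _) (by positivity)

/-- Second-order expansion of the resolvent. The error is at most quadratic and at most linear in
the size `S` of the perturbation, hence `O(S ^ (1 + δ))` for every `δ ∈ [0, 1]`; this is what makes
`2 + δ` moments sufficient. -/
theorem norm_resolventMatrix_expansion_le {A B : Matrix ι ι ℝ} (hA : A.IsHermitian)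
    (hB : B.IsHermitian) {z : ℂ} (hz : 0 < z.im) {δ : ℝ} (hδ : 0 < δ) (hδ1 : δ ≤ 1) (p q : ι) :
    ‖resolventMatrix A z p q - resolventMatrix B z p q +
        ∑ r, ∑ s, resolventMatrix B z p r * ((A - B) r s : ℝ) * resolventMatrix B z s q‖ ≤
      2 * z.im⁻¹ ^ (2 + δ) * (∑ r, ∑ s, |(A - B) r s|) ^ (1 + δ) := by
  set S := ∑ r, ∑ s, |(A - B) r s| with hS
  set h := z.im⁻¹ with hh
  have hh0 : 0 < h := inv_pos.2 hz
  have hS0 : 0 ≤ S := Finset.sum_nonneg fun r _ => Finset.sum_nonneg fun s _ => abs_nonneg _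
  have heq : resolventMatrix A z p q - resolventMatrix B z p q +
      ∑ r, ∑ s, resolventMatrix B z p r * ((A - B) r s : ℝ) * resolventMatrix B z s q =
      ∑ r, ∑ s, resolventMatrix B z p r * ((A - B) r s : ℝ) *
        (resolventMatrix B z s q - resolventMatrix A z s q) := by
    rw [resolventMatrix_apply_sub hA hB hz]
    simp only [mul_sub, Finset.sum_sub_distrib]
    ring
  have hmin : ∀ s, ‖resolventMatrix B z s q - resolventMatrix A z s q‖ ≤ 2 * h * (S * h) ^ δ := by
    intro s
    have hx0 : 0 ≤ S * h := by positivity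
    rcases le_total (S * h) 1 with hx | hx
    · rw [norm_sub_rev]
      refine (norm_resolventMatrix_apply_sub_le hA hB hz s q).trans ?_
      have : S * h ≤ (S * h) ^ δ := Real.self_le_rpow_of_le_one hx0 hx hδ1
      calc S * (h * h) = h * (S * h) := by ring
        _ ≤ h * (S * h) ^ δ := by gcongr
        _ ≤ 2 * h * (S * h) ^ δ := by
          have : 0 ≤ h * (S * h) ^ δ := by positivity
          linarith
    · refine (norm_sub_le _ _).trans ?_
      have h1 : 1 ≤ (S * h) ^ δ := Real.one_le_rpow hx hδ.le
      have h2 := norm_resolventMatrix_apply_le hA hz s q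
      have h3 := norm_resolventMatrix_apply_le hB hz s q
      nlinarith
  rw [heq]
  refine (norm_sum_mul_mul_le (F := h) (fun r => norm_resolventMatrix_apply_le hB hz _ _) hmin
    hh0.le).trans (le_of_eq ?_)
  rw [Real.mul_rpow hS0 hh0.le, Real.rpow_add hh0, Real.rpow_two,
    Real.rpow_add' hS0 (by positivity), Real.rpow_one]
  ring

end ResolventExpansion

/-! ### Removing a block of a block matrix -/

section RemoveBlock

variable {n d : ℕ}

/-- The matrix obtained by setting the blocks in positions `(i, j)` and `(j, i)` to zero. -/
def removeBlock (A : Matrix (Fin n × Fin d) (Fin n × Fin d) ℝ) (i j : Fin n) :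
    Matrix (Fin n × Fin d) (Fin n × Fin d) ℝ :=
  Matrix.of fun p q => if (p.1 = i ∧ q.1 = j) ∨ (p.1 = j ∧ q.1 = i) then 0 else A p q

theorem isHermitian_removeBlock {A : Matrix (Fin n × Fin d) (Fin n × Fin d) ℝ}
    (hA : A.IsHermitian) (i j : Fin n) : (removeBlock A i j).IsHermitian := by
  ext p q
  simp only [Matrix.conjTranspose_apply, removeBlock, Matrix.of_apply, star_trivial,
    isHermitian_apply_comm hA q p]
  congr 1
  apply propext
  tauto

theorem sub_removeBlock_apply (A : Matrix (Fin n × Fin d) (Fin n × Fin d) ℝ) (u : ℝ)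
    (i j : Fin n) (p q : Fin n × Fin d) : (u • A - u • removeBlock A i j) p q =
      if (p.1 = i ∧ q.1 = j) ∨ (p.1 = j ∧ q.1 = i) then u * A p q else 0 := by
  simp only [removeBlock, Matrix.sub_apply, Matrix.smul_apply, Matrix.of_apply, smul_eq_mul]
  split_ifs <;> simp

theorem sum_sum_sub_removeBlock {R : Type*} [AddCommMonoid R] {i j : Fin n} (hij : i ≠ j)
    (F : (Fin n × Fin d) → (Fin n × Fin d) → R)
    (hF : ∀ p q, ¬((p.1 = i ∧ q.1 = j) ∨ (p.1 = j ∧ q.1 = i)) → F p q = 0) :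
    ∑ p, ∑ q, F p q = ∑ a, ∑ b, (F (i, a) (j, b) + F (j, b) (i, a)) := by
  have hrow : ∀ p, ∑ q, F p q = (if p.1 = i then ∑ b, F p (j, b) else 0) +
      (if p.1 = j then ∑ a, F p (i, a) else 0) := by
    intro p
    rw [Fintype.sum_prod_type]
    by_cases hpi : p.1 = i
    · have hpj : p.1 ≠ j := fun h => hij (hpi ▸ h)
      rw [if_pos hpi, if_neg hpj, add_zero]
      refine Finset.sum_eq_single j
        (fun k _ hk => Finset.sum_eq_zero fun b _ => hF _ _ ?_) (by simp)
      simp [hpj, hk]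
    · by_cases hpj : p.1 = j
      · rw [if_neg hpi, if_pos hpj, zero_add]
        refine Finset.sum_eq_single i
          (fun k _ hk => Finset.sum_eq_zero fun b _ => hF _ _ ?_) (by simp)
        simp [hpi, hk]
      · rw [if_neg hpi, if_neg hpj, add_zero]
        exact Finset.sum_eq_zero fun k _ => Finset.sum_eq_zero fun b _ =>
          hF _ _ (by simp [hpi, hpj])
  simp only [hrow, Finset.sum_add_distrib]
  rw [Fintype.sum_prod_type, Fintype.sum_prod_type]
  congr 1
  · rw [Finset.sum_eq_single i (fun k _ hk => by simp [hk]) (by simp)]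
    simp
  · rw [Finset.sum_eq_single j (fun k _ hk => by simp [hk]) (by simp), Finset.sum_comm]
    simp

theorem sum_abs_sub_removeBlock {A : Matrix (Fin n × Fin d) (Fin n × Fin d) ℝ}
    (hA : A.IsHermitian) {u : ℝ} (hu : 0 ≤ u) {i j : Fin n} (hij : i ≠ j) :
    ∑ p, ∑ q, |(u • A - u • removeBlock A i j) p q| =
      2 * u * ∑ a, ∑ b, |A (i, a) (j, b)| := by
  rw [sum_sum_sub_removeBlock hij _ fun p q h => by rw [sub_removeBlock_apply, if_neg h, abs_zero],
    Finset.mul_sum]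
  refine Finset.sum_congr rfl fun a _ => ?_
  rw [Finset.mul_sum]
  refine Finset.sum_congr rfl fun b _ => ?_
  rw [sub_removeBlock_apply, sub_removeBlock_apply, if_pos (by simp), if_pos (by simp),
    isHermitian_apply_comm hA (j, b), abs_mul, abs_of_nonneg hu]
  ring

theorem sum_mul_sub_removeBlock_mul {A : Matrix (Fin n × Fin d) (Fin n × Fin d) ℝ}
    (hA : A.IsHermitian) (u : ℝ) {i j : Fin n} (hij : i ≠ j) (f g : (Fin n × Fin d) → ℂ) :
    ∑ p, ∑ q, f p * ((u • A - u • removeBlock A i j) p q : ℝ) * g q =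
      ∑ a, ∑ b, ((u * A (i, a) (j, b) : ℝ) : ℂ) *
        (f (i, a) * g (j, b) + f (j, b) * g (i, a)) := by
  rw [sum_sum_sub_removeBlock hij _ fun p q h => by
    rw [sub_removeBlock_apply, if_neg h, Complex.ofReal_zero, mul_zero, zero_mul]]
  refine Finset.sum_congr rfl fun a _ => Finset.sum_congr rfl fun b _ => ?_
  rw [sub_removeBlock_apply, sub_removeBlock_apply, if_pos (by simp), if_pos (by simp),
    isHermitian_apply_comm hA (j, b)]
  ring

/-- If the blocks above the block diagonal are independent and the block diagonal vanishes, a block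
is independent of the rest of the matrix. -/
theorem indepFun_block_removeBlock {Ω : Type*} [MeasurableSpace Ω] {μ : Measure Ω}
    {Y : Ω → Matrix (Fin n × Fin d) (Fin n × Fin d) ℝ} (hY : ∀ ω, (Y ω).IsHermitian)
    (hmeas : ∀ p q, Measurable fun ω => Y ω p q) (hdiag : ∀ ω p q, p.1 = q.1 → Y ω p q = 0)
    (hindep : iIndepFun (fun (p : {p : Fin n × Fin n // p.1 < p.2}) (ω : Ω) (a b : Fin d) =>
        Y ω (p.1.1, a) (p.1.2, b)) μ) {i j : Fin n} (hij : i < j) :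
    IndepFun (fun ω (a b : Fin d) => Y ω (i, a) (j, b))
      (fun ω (p q : Fin n × Fin d) => removeBlock (Y ω) i j p q) μ := by
  classical
  set k : {p : Fin n × Fin n // p.1 < p.2} := ⟨(i, j), hij⟩ with hk
  have h := hindep.indepFun_finset {k} {k}ᶜ disjoint_compl_right
    (fun p => measurable_pi_lambda _ fun a => measurable_pi_lambda _ fun b => hmeas _ _)
  set T := (({k} : Finset {p : Fin n × Fin n // p.1 < p.2})ᶜ : Finset _) with hT
  set Φ : (T → Fin d → Fin d → ℝ) → (Fin n × Fin d) → (Fin n × Fin d) → ℝ := fun v p q =>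
    if h : ∃ h : p.1 < q.1, (⟨(p.1, q.1), h⟩ : {p : Fin n × Fin n // p.1 < p.2}) ∈ T then
      v ⟨⟨(p.1, q.1), h.1⟩, h.2⟩ p.2 q.2
    else if h : ∃ h : q.1 < p.1, (⟨(q.1, p.1), h⟩ : {p : Fin n × Fin n // p.1 < p.2}) ∈ T then
      v ⟨⟨(q.1, p.1), h.1⟩, h.2⟩ q.2 p.2
    else 0 with hΦ
  have hΦm : Measurable Φ := by
    refine measurable_pi_lambda _ fun p => measurable_pi_lambda _ fun q => ?_
    simp only [hΦ]
    split_ifs <;> fun_prop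
  have hφm : Measurable (fun v : (({k} : Finset {p : Fin n × Fin n // p.1 < p.2}) →
    Fin d → Fin d → ℝ) => v ⟨k, Finset.mem_singleton_self k⟩) := measurable_pi_apply _
  have h2 := h.comp hφm hΦm
  suffices hΦY : ∀ ω p q, removeBlock (Y ω) i j p q =
      Φ (fun (t : T) a b => Y ω (t.1.1.1, a) (t.1.1.2, b)) p q by
    have h3 : (fun ω (p q : Fin n × Fin d) => removeBlock (Y ω) i j p q) =
        fun ω => Φ (fun (t : T) a b => Y ω (t.1.1.1, a) (t.1.1.2, b)) :=
      funext fun ω => funext fun p => funext fun q => hΦY ω p q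
    rw [h3]
    exact h2
  intro ω p q
  simp only [hΦ, removeBlock, Matrix.of_apply, hT, hk, Finset.mem_compl,
    Finset.mem_singleton, Subtype.mk.injEq, Prod.mk.injEq, Prod.mk.eta]
  rcases lt_trichotomy p.1 q.1 with hpq | hpq | hpq
  · have hn : ¬ (p.1 = j ∧ q.1 = i) := fun h => by
      rw [h.1, h.2] at hpq
      exact lt_asymm hij hpq
    by_cases hc : p.1 = i ∧ q.1 = j
    · simp [hc, hij, hij.not_gt]
    · rw [if_neg (by tauto), dif_pos ⟨hpq, hc⟩]
  · have hn1 : ¬ (p.1 < q.1) := by rw [hpq]; exact lt_irrefl _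
    have hn2 : ¬ (q.1 < p.1) := by rw [hpq]; exact lt_irrefl _
    simp [hn1, hn2, hdiag ω p q hpq]
  · have hn : ¬ (p.1 = i ∧ q.1 = j) := fun h => by
      rw [h.1, h.2] at hpq
      exact lt_asymm hij hpq
    have hn1 : ¬ (p.1 < q.1) := hpq.not_gt
    by_cases hc : q.1 = i ∧ p.1 = j
    · simp [hc, hij, hij.not_gt]
    · rw [if_neg (by tauto), dif_neg (fun h => hn1 h.1), dif_pos ⟨hpq, hc⟩,
        isHermitian_apply_comm (hY ω)]

end RemoveBlock

/-! ### The loop equation -/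

section LoopEquation

/-- A random symmetric block matrix with vanishing block diagonal whose blocks above the block
diagonal are independent and centered, have moments of order `2 + δ` bounded by `K`, and have the
covariance structure of `σ`-simple blocks with `σ = 1`: the entries of a row are orthonormal, and
the covariance of two different rows is antisymmetric. -/
structure IsCenteredBlockWigner {Ω : Type*} [MeasurableSpace Ω] (μ : Measure Ω) {n d : ℕ}
    (δ K : ℝ) (Y : Ω → Matrix (Fin n × Fin d) (Fin n × Fin d) ℝ) : Prop where
  isHermitian : ∀ ω, (Y ω).IsHermitian
  measurable : ∀ p q, Measurable fun ω => Y ω p q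
  diag : ∀ ω p q, p.1 = q.1 → Y ω p q = 0
  indep : iIndepFun (fun (p : {p : Fin n × Fin n // p.1 < p.2}) (ω : Ω) (a b : Fin d) =>
    Y ω (p.1.1, a) (p.1.2, b)) μ
  memLp : ∀ i j, i < j → ∀ a b, MemLp (fun ω => Y ω (i, a) (j, b)) (ENNReal.ofReal (2 + δ)) μ
  moment : ∀ i j, i < j → ∀ a b, ∫ ω, |Y ω (i, a) (j, b)| ^ (2 + δ) ∂μ ≤ K
  mean : ∀ i j, i < j → ∀ a b, ∫ ω, Y ω (i, a) (j, b) ∂μ = 0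
  isotropic : ∀ i j, i < j → ∀ a b b', ∫ ω, Y ω (i, a) (j, b) * Y ω (i, a) (j, b') ∂μ =
    if b = b' then 1 else 0
  antisymm : ∀ i j, i < j → ∀ a a', a ≠ a' → ∀ b b',
    ∫ ω, Y ω (i, a) (j, b) * Y ω (i, a') (j, b') ∂μ =
      -∫ ω, Y ω (i, a) (j, b') * Y ω (i, a') (j, b) ∂μ

namespace IsCenteredBlockWigner

variable {Ω : Type*} [MeasurableSpace Ω] {μ : Measure Ω} [IsProbabilityMeasure μ] {n d : ℕ}
  {δ K : ℝ} {Y : Ω → Matrix (Fin n × Fin d) (Fin n × Fin d) ℝ}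

set_option linter.unusedSectionVars false

theorem memLp_two (h : IsCenteredBlockWigner μ δ K Y) (hδ : 0 < δ) {i j : Fin n} (hij : i < j)
    (a b : Fin d) : MemLp (fun ω => Y ω (i, a) (j, b)) 2 μ :=
  (h.memLp i j hij a b).mono_exponent (by
    rw [← ENNReal.ofReal_ofNat]
    exact ENNReal.ofReal_le_ofReal (by linarith))

theorem integrable_entry (h : IsCenteredBlockWigner μ δ K Y) (hδ : 0 < δ) {i j : Fin n}
    (hij : i < j) (a b : Fin d) : Integrable (fun ω => Y ω (i, a) (j, b)) μ :=
  (h.memLp_two hδ hij a b).integrable (by norm_num)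

theorem integrable_mul (h : IsCenteredBlockWigner μ δ K Y) (hδ : 0 < δ) {i j : Fin n}
    (hij : i < j) (a b c e : Fin d) :
    Integrable (fun ω => Y ω (i, a) (j, b) * Y ω (i, c) (j, e)) μ :=
  (h.memLp_two hδ hij a b).integrable_mul (h.memLp_two hδ hij c e)

theorem integral_sq (h : IsCenteredBlockWigner μ δ K Y) {i j : Fin n} (hij : i < j)
    (a b : Fin d) : ∫ ω, Y ω (i, a) (j, b) * Y ω (i, a) (j, b) ∂μ = 1 := by
  rw [h.isotropic i j hij, if_pos rfl]

theorem abs_integral_mul_le_one (h : IsCenteredBlockWigner μ δ K Y) (hδ : 0 < δ) {i j : Fin n}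
    (hij : i < j) (a b c e : Fin d) :
    |∫ ω, Y ω (i, a) (j, b) * Y ω (i, c) (j, e) ∂μ| ≤ 1 := by
  have hint := ((h.integrable_mul hδ hij a b a b).add (h.integrable_mul hδ hij c e c e)).div_const 2
  have h1 := norm_integral_le_of_norm_le hint
    (f := fun ω => Y ω (i, a) (j, b) * Y ω (i, c) (j, e)) (Eventually.of_forall fun ω => by
      rw [Real.norm_eq_abs, abs_le]
      simp only [Pi.add_apply]
      constructor
      · nlinarith [sq_nonneg (Y ω (i, a) (j, b) + Y ω (i, c) (j, e))]
      · nlinarith [sq_nonneg (Y ω (i, a) (j, b) - Y ω (i, c) (j, e))])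
  rw [integral_div] at h1
  simp only [Pi.add_apply] at h1
  rw [integral_add (h.integrable_mul hδ hij a b a b) (h.integrable_mul hδ hij c e c e),
    h.integral_sq hij, h.integral_sq hij] at h1
  norm_num at h1
  exact h1

theorem integral_abs_le_one (h : IsCenteredBlockWigner μ δ K Y) (hδ : 0 < δ) {i j : Fin n}
    (hij : i < j) (a b : Fin d) : ∫ ω, |Y ω (i, a) (j, b)| ∂μ ≤ 1 := by
  have h1 : ∫ ω, |Y ω (i, a) (j, b)| ∂μ ≤
      ∫ ω, (1 + Y ω (i, a) (j, b) * Y ω (i, a) (j, b)) / 2 ∂μ := by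
    refine integral_mono (h.integrable_entry hδ hij a b).abs
      (((integrable_const 1).add (h.integrable_mul hδ hij a b a b)).div_const 2) fun ω => ?_
    simp only
    nlinarith [sq_nonneg (|Y ω (i, a) (j, b)| - 1), sq_abs (Y ω (i, a) (j, b))]
  rw [integral_div, integral_add (integrable_const 1) (h.integrable_mul hδ hij a b a b),
    h.integral_sq hij] at h1
  simpa using h1

/-- The `ℓ¹` size of the `(i, j)` block together with its transpose, after rescaling by `u`. -/
def blockSize (Y : Ω → Matrix (Fin n × Fin d) (Fin n × Fin d) ℝ) (u : ℝ) (i j : Fin n) (ω : Ω) :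
    ℝ := 2 * u * ∑ a, ∑ b, |Y ω (i, a) (j, b)|

theorem integrable_blockSize (h : IsCenteredBlockWigner μ δ K Y) (hδ : 0 < δ) (u : ℝ) {i j : Fin n}
    (hij : i < j) : Integrable (blockSize Y u i j) μ :=
  (integrable_finsetSum _ fun a _ => integrable_finsetSum _ fun b _ =>
    (h.integrable_entry hδ hij a b).abs).const_mul _

theorem integral_blockSize_le (h : IsCenteredBlockWigner μ δ K Y) (hδ : 0 < δ) {u : ℝ} (hu : 0 ≤ u)
    {i j : Fin n} (hij : i < j) : ∫ ω, blockSize Y u i j ω ∂μ ≤ 2 * u * d ^ 2 := by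
  simp only [blockSize]
  rw [integral_const_mul]
  refine mul_le_mul_of_nonneg_left ?_ (by positivity)
  rw [integral_finsetSum _ fun a _ => integrable_finsetSum _ fun b _ =>
    (h.integrable_entry hδ hij a b).abs]
  calc _ ≤ ∑ a : Fin d, ∑ b : Fin d, (1 : ℝ) := by
        refine Finset.sum_le_sum fun a _ => ?_
        rw [integral_finsetSum _ fun b _ => (h.integrable_entry hδ hij a b).abs]
        exact Finset.sum_le_sum fun b _ => h.integral_abs_le_one hδ hij a b
    _ = _ := by simp [sq]

theorem blockSize_rpow_le {δ : ℝ} (hδ : 0 < δ) {u : ℝ} (hu : 0 ≤ u) (i j : Fin n) (ω : Ω) :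
    blockSize Y u i j ω ^ (2 + δ) ≤
      (2 * u) ^ (2 + δ) *
        (((d * d : ℕ) : ℝ) ^ (1 + δ) * ∑ a, ∑ b, |Y ω (i, a) (j, b)| ^ (2 + δ)) := by
  rw [blockSize, Real.mul_rpow (by positivity)
    (Finset.sum_nonneg fun a _ => Finset.sum_nonneg fun b _ => abs_nonneg _)]
  refine mul_le_mul_of_nonneg_left ?_ (by positivity)
  have h := Real.rpow_sum_le_const_mul_sum_rpow (Finset.univ : Finset (Fin d × Fin d))
    (fun x => Y ω (i, x.1) (j, x.2)) (p := 2 + δ) (by linarith)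
  rw [Fintype.sum_prod_type, Fintype.sum_prod_type] at h
  rw [Finset.card_univ, Fintype.card_prod, Fintype.card_fin,
    show 2 + δ - 1 = 1 + δ by ring] at h
  exact h

theorem integrable_rpow (h : IsCenteredBlockWigner μ δ K Y) (hδ : 0 < δ) {i j : Fin n}
    (hij : i < j) (a b : Fin d) : Integrable (fun ω => |Y ω (i, a) (j, b)| ^ (2 + δ)) μ := by
  have := (h.memLp i j hij a b).integrable_norm_rpow (by simp; linarith) (by simp)
  simpa [ENNReal.toReal_ofReal (by linarith : 0 ≤ 2 + δ)] using this

theorem integrable_blockSize_rpow (h : IsCenteredBlockWigner μ δ K Y) (hδ : 0 < δ) {u : ℝ}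
    (hu : 0 ≤ u) {i j : Fin n} (hij : i < j) :
    Integrable (fun ω => blockSize Y u i j ω ^ (2 + δ)) μ := by
  refine Integrable.mono' ((Integrable.const_mul (integrable_finsetSum _ fun a _ =>
    integrable_finsetSum _ fun b _ => h.integrable_rpow hδ hij a b) _).const_mul _)
    (Measurable.aestronglyMeasurable ?_)
    (Eventually.of_forall fun ω => ?_) (g := fun ω => (2 * u) ^ (2 + δ) *
      (((d * d : ℕ) : ℝ) ^ (1 + δ) * ∑ a, ∑ b, |Y ω (i, a) (j, b)| ^ (2 + δ)))
  · have hm : Measurable (blockSize Y u i j) := by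
      unfold blockSize
      exact (Finset.measurable_sum _ fun a _ => Finset.measurable_sum _ fun b _ =>
        (h.measurable _ _).abs).const_mul _
    exact hm.pow_const _
  · have h0 : 0 ≤ blockSize Y u i j ω :=
      mul_nonneg (by positivity)
        (Finset.sum_nonneg fun a _ => Finset.sum_nonneg fun b _ => abs_nonneg _)
    rw [Real.norm_of_nonneg (Real.rpow_nonneg h0 _)]
    exact blockSize_rpow_le hδ hu i j ω

theorem integral_blockSize_rpow_le (h : IsCenteredBlockWigner μ δ K Y) (hδ : 0 < δ) {u : ℝ}
    (hu : 0 ≤ u) {i j : Fin n} (hij : i < j) :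
    ∫ ω, blockSize Y u i j ω ^ (2 + δ) ∂μ ≤
      u ^ (2 + δ) * (2 ^ (2 + δ) * (((d * d : ℕ) : ℝ) ^ (1 + δ) * (d * d * K))) := by
  have hint : Integrable (fun ω => ∑ a, ∑ b, |Y ω (i, a) (j, b)| ^ (2 + δ)) μ :=
    integrable_finsetSum _ fun a _ => integrable_finsetSum _ fun b _ =>
      h.integrable_rpow hδ hij a b
  refine (integral_mono (h.integrable_blockSize_rpow hδ hu hij) ((hint.const_mul _).const_mul _)
    fun ω => blockSize_rpow_le hδ hu i j ω).trans ?_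
  rw [integral_const_mul, integral_const_mul, Real.mul_rpow (by norm_num) hu,
    mul_comm ((2 : ℝ) ^ (2 + δ)), mul_assoc]
  refine mul_le_mul_of_nonneg_left (mul_le_mul_of_nonneg_left (mul_le_mul_of_nonneg_left ?_
    (by positivity)) (by positivity)) (by positivity)
  rw [integral_finsetSum _ fun a _ => integrable_finsetSum _ fun b _ =>
    h.integrable_rpow hδ hij a b]
  calc _ ≤ ∑ a : Fin d, ∑ b : Fin d, K := by
        refine Finset.sum_le_sum fun a _ => ?_
        rw [integral_finsetSum _ fun b _ => h.integrable_rpow hδ hij a b]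
        exact Finset.sum_le_sum fun b _ => h.moment i j hij a b
    _ = _ := by simp; ring

/-- A function of the block `(i, j)` and a function of the resolvent of the matrix with that block
removed are uncorrelated. -/
theorem integral_mul_resolventMatrix_removeBlock (h : IsCenteredBlockWigner μ δ K Y) (u : ℝ)
    {i j : Fin n} (hij : i < j) (z : ℂ) {f : (Fin d → Fin d → ℝ) → ℂ} (hf : Measurable f)
    {g : ((Fin n × Fin d) → (Fin n × Fin d) → ℂ) → ℂ} (hg : Measurable g) :
    ∫ ω, f (fun a b => Y ω (i, a) (j, b)) *
        g (fun p q => resolventMatrix (u • removeBlock (Y ω) i j) z p q) ∂μ =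
      (∫ ω, f (fun a b => Y ω (i, a) (j, b)) ∂μ) *
        ∫ ω, g (fun p q => resolventMatrix (u • removeBlock (Y ω) i j) z p q) ∂μ := by
  have hind := indepFun_block_removeBlock h.isHermitian h.measurable h.diag h.indep hij
  have hψ : Measurable fun W : (Fin n × Fin d) → (Fin n × Fin d) → ℝ =>
      g (fun p q => resolventMatrix (u • (Matrix.of W)) z p q) := by
    refine hg.comp (measurable_pi_lambda _ fun p => measurable_pi_lambda _ fun q =>
      measurable_resolventMatrix_apply (fun p q => ?_) z p q)
    simp only [Matrix.smul_apply, Matrix.of_apply, smul_eq_mul]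
    fun_prop
  have h2 := hind.comp hf hψ
  have hb : Measurable fun ω (a b : Fin d) => Y ω (i, a) (j, b) :=
    measurable_pi_lambda _ fun a => measurable_pi_lambda _ fun b => h.measurable _ _
  have hr : Measurable fun ω (p q : Fin n × Fin d) => removeBlock (Y ω) i j p q := by
    refine measurable_pi_lambda _ fun p => measurable_pi_lambda _ fun q => ?_
    simp only [removeBlock, Matrix.of_apply]
    split_ifs
    · exact measurable_const
    · exact h.measurable _ _
  exact h2.integral_fun_mul_eq_mul_integral (hf.comp hb).aestronglyMeasurable
    (hψ.comp hr).aestronglyMeasurable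

end IsCenteredBlockWigner

theorem integrable_ofReal_mul_of_bound {Ω : Type*} [MeasurableSpace Ω] {μ : Measure Ω} {f : Ω → ℝ}
    (hf : Integrable f μ) {g : Ω → ℂ} (hg : Measurable g) {C : ℝ} (hC : ∀ ω, ‖g ω‖ ≤ C) :
    Integrable (fun ω => (f ω : ℂ) * g ω) μ :=
  hf.ofReal.mul_bdd (c := C) hg.aestronglyMeasurable (Eventually.of_forall hC)

namespace IsCenteredBlockWigner

variable {Ω : Type*} [MeasurableSpace Ω] {μ : Measure Ω} [IsProbabilityMeasure μ] {n d : ℕ}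
  {δ K : ℝ} {Y : Ω → Matrix (Fin n × Fin d) (Fin n × Fin d) ℝ}

/-- The first two terms of the expansion of `E[Y p q * G q p]`, `G` the resolvent of `u • Y`, in the
block that contains the entry `Y p q`. The expansion is around the resolvent of the matrix with this
block removed, which is independent of the block. -/
theorem norm_integral_entry_mul_resolventMatrix_le (h : IsCenteredBlockWigner μ δ K Y) (hδ : 0 < δ)
    (hδ1 : δ ≤ 1) {u : ℝ} (hu : 0 ≤ u) {z : ℂ} (hz : 0 < z.im) {i j : Fin n} (hij : i < j)
    (a b : Fin d) :
    ‖(∫ ω, ((u * Y ω (i, a) (j, b) : ℝ) : ℂ) * resolventMatrix (u • Y ω) z (j, b) (i, a) ∂μ) +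
        ∑ c, ∑ e, ((u ^ 2 * ∫ ω, Y ω (i, a) (j, b) * Y ω (i, c) (j, e) ∂μ : ℝ) : ℂ) *
          ∫ ω, (resolventMatrix (u • Y ω) z (j, b) (i, c) *
              resolventMatrix (u • Y ω) z (j, e) (i, a) +
            resolventMatrix (u • Y ω) z (j, b) (j, e) *
              resolventMatrix (u • Y ω) z (i, c) (i, a)) ∂μ‖ ≤
      2 * z.im⁻¹ ^ (2 + δ) * (∫ ω, blockSize Y u i j ω ^ (2 + δ) ∂μ) +
        d ^ 2 * u ^ 2 * (4 * z.im⁻¹ ^ 3) * ∫ ω, blockSize Y u i j ω ∂μ := by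
  set η := z.im⁻¹ with hη
  have hη0 : 0 < η := inv_pos.2 hz
  set G : Ω → Matrix (Fin n × Fin d) (Fin n × Fin d) ℂ :=
    fun ω => resolventMatrix (u • Y ω) z with hG
  -- the resolvent of the matrix without the block, independent of the block
  set G' : Ω → Matrix (Fin n × Fin d) (Fin n × Fin d) ℂ :=
    fun ω => resolventMatrix (u • removeBlock (Y ω) i j) z with hG'
  set S := blockSize Y u i j with hS
  have hS0 : ∀ ω, 0 ≤ S ω := fun ω => mul_nonneg (by positivity)
    (Finset.sum_nonneg fun a _ => Finset.sum_nonneg fun b _ => abs_nonneg _)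
  have hH : ∀ ω, (u • Y ω).IsHermitian := fun ω => isHermitian_real_smul (h.isHermitian ω) u
  have hH' : ∀ ω, (u • removeBlock (Y ω) i j).IsHermitian := fun ω =>
    isHermitian_real_smul (isHermitian_removeBlock (h.isHermitian ω) i j) u
  have hGb : ∀ ω p q, ‖G ω p q‖ ≤ η := fun ω p q => norm_resolventMatrix_apply_le (hH ω) hz p q
  have hGb' : ∀ ω p q, ‖G' ω p q‖ ≤ η := fun ω p q => norm_resolventMatrix_apply_le (hH' ω) hz p q
  have hGm : ∀ p q, Measurable fun ω => G ω p q := fun p q =>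
    measurable_resolventMatrix_apply (fun p q => by
      simpa using (h.measurable p q).const_mul u) z p q
  have hGm' : ∀ p q, Measurable fun ω => G' ω p q := fun p q =>
    measurable_resolventMatrix_apply (fun p q => by
      simp only [removeBlock, Matrix.smul_apply, Matrix.of_apply, smul_eq_mul]
      refine Measurable.const_mul ?_ u
      split_ifs
      · exact measurable_const
      · exact h.measurable _ _) z p q
  have hsize : ∀ ω, ∑ p, ∑ q, |(u • Y ω - u • removeBlock (Y ω) i j) p q| = S ω := fun ω =>
    sum_abs_sub_removeBlock (h.isHermitian ω) hu hij.ne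
  have hdiff : ∀ ω p q, ‖G ω p q - G' ω p q‖ ≤ S ω * (η * η) := fun ω p q => by
    rw [← hsize]
    exact norm_resolventMatrix_apply_sub_le (hH ω) (hH' ω) hz p q
  set P : Fin d → Fin d → Ω → ℂ := fun c e ω => G ω (j, b) (i, c) * G ω (j, e) (i, a) +
    G ω (j, b) (j, e) * G ω (i, c) (i, a) with hP
  set P' : Fin d → Fin d → Ω → ℂ := fun c e ω => G' ω (j, b) (i, c) * G' ω (j, e) (i, a) +
    G' ω (j, b) (j, e) * G' ω (i, c) (i, a) with hP'
  have hPm : ∀ c e, Measurable (P c e) := fun c e =>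
    ((hGm _ _).mul (hGm _ _)).add ((hGm _ _).mul (hGm _ _))
  have hPm' : ∀ c e, Measurable (P' c e) := fun c e =>
    ((hGm' _ _).mul (hGm' _ _)).add ((hGm' _ _).mul (hGm' _ _))
  have hprod : ∀ {x y : ℂ}, ‖x‖ ≤ η → ‖y‖ ≤ η → ‖x * y‖ ≤ η * η := fun hx hy => by
    rw [norm_mul]
    gcongr
  have hPb : ∀ c e ω, ‖P c e ω‖ ≤ η * η + η * η := fun c e ω =>
    norm_add_le_of_le (hprod (hGb _ _ _) (hGb _ _ _)) (hprod (hGb _ _ _) (hGb _ _ _))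
  have hPb' : ∀ c e ω, ‖P' c e ω‖ ≤ η * η + η * η := fun c e ω =>
    norm_add_le_of_le (hprod (hGb' _ _ _) (hGb' _ _ _)) (hprod (hGb' _ _ _) (hGb' _ _ _))
  have hPint : ∀ c e, Integrable (P c e) μ := fun c e =>
    Integrable.of_bound (hPm c e).aestronglyMeasurable _ (Eventually.of_forall (hPb c e))
  have hPint' : ∀ c e, Integrable (P' c e) μ := fun c e =>
    Integrable.of_bound (hPm' c e).aestronglyMeasurable _ (Eventually.of_forall (hPb' c e))
  have hPP : ∀ c e ω, ‖P c e ω - P' c e ω‖ ≤ 4 * η ^ 3 * S ω := by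
    intro c e ω
    have hp : ∀ p q r s, ‖G ω p q * G ω r s - G' ω p q * G' ω r s‖ ≤ 2 * η ^ 3 * S ω := by
      intro p q r s
      have : G ω p q * G ω r s - G' ω p q * G' ω r s =
          (G ω p q - G' ω p q) * G ω r s + G' ω p q * (G ω r s - G' ω r s) := by ring
      rw [this]
      refine (norm_add_le _ _).trans ?_
      rw [norm_mul, norm_mul]
      have hSη : 0 ≤ S ω * (η * η) := mul_nonneg (hS0 ω) (by positivity)
      calc _ ≤ S ω * (η * η) * η + η * (S ω * (η * η)) := by
            gcongr
            · exact hdiff _ _ _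
            · exact hGb _ _ _
            · exact hGb' _ _ _
            · exact hdiff _ _ _
        _ = _ := by ring
    have : P c e ω - P' c e ω =
        (G ω (j, b) (i, c) * G ω (j, e) (i, a) - G' ω (j, b) (i, c) * G' ω (j, e) (i, a)) +
        (G ω (j, b) (j, e) * G ω (i, c) (i, a) - G' ω (j, b) (j, e) * G' ω (i, c) (i, a)) := by
      simp only [hP, hP']
      ring
    rw [this]
    refine (norm_add_le_of_le (hp _ _ _ _) (hp _ _ _ _)).trans (le_of_eq (by ring))
  set β : Fin d → Fin d → Ω → ℝ := fun c e ω => u * Y ω (i, c) (j, e) with hβ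
  have hβint : ∀ c e, Integrable (β c e) μ := fun c e =>
    (h.integrable_entry hδ hij c e).const_mul u
  have hββint : ∀ c e, Integrable (fun ω => β a b ω * β c e ω) μ := fun c e => by
    have := (h.integrable_mul hδ hij a b c e).const_mul (u * u)
    refine this.congr (Eventually.of_forall fun ω => ?_)
    simp only [hβ]
    ring
  -- the remainder of the second-order expansion
  set R : Ω → ℂ := fun ω => G ω (j, b) (i, a) - G' ω (j, b) (i, a) +
    ∑ c, ∑ e, (β c e ω : ℂ) * P' c e ω with hR
  have hRb : ∀ ω, ‖R ω‖ ≤ 2 * η ^ (2 + δ) * S ω ^ (1 + δ) := by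
    intro ω
    have := norm_resolventMatrix_expansion_le (hH ω) (hH' ω) hz hδ hδ1 (j, b) (i, a)
    rw [sum_mul_sub_removeBlock_mul (h.isHermitian ω) u hij.ne, hsize] at this
    exact this
  have hβS : ∀ ω, |β a b ω| ≤ S ω := by
    intro ω
    have h1 : |Y ω (i, a) (j, b)| ≤ ∑ c, ∑ e, |Y ω (i, c) (j, e)| :=
      (Finset.single_le_sum (f := fun e => |Y ω (i, a) (j, e)|) (fun _ _ => abs_nonneg _)
        (Finset.mem_univ b)).trans (Finset.single_le_sum
          (f := fun c => ∑ e, |Y ω (i, c) (j, e)|)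
          (fun _ _ => Finset.sum_nonneg fun _ _ => abs_nonneg _) (Finset.mem_univ a))
    have h2 : 0 ≤ u * ∑ c, ∑ e, |Y ω (i, c) (j, e)| :=
      mul_nonneg hu ((abs_nonneg _).trans h1)
    simp only [hβ, hS, blockSize]
    rw [abs_mul, abs_of_nonneg hu]
    nlinarith [mul_le_mul_of_nonneg_left h1 hu]
  have hrem : ‖∫ ω, (β a b ω : ℂ) * R ω ∂μ‖ ≤ 2 * η ^ (2 + δ) * ∫ ω, S ω ^ (2 + δ) ∂μ := by
    rw [← integral_const_mul]
    refine norm_integral_le_of_norm_le ((h.integrable_blockSize_rpow hδ hu hij).const_mul _)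
      (Eventually.of_forall fun ω => ?_)
    rw [norm_mul, Complex.norm_real, Real.norm_eq_abs]
    have h1 := hS0 ω
    calc |β a b ω| * ‖R ω‖ ≤ S ω * (2 * η ^ (2 + δ) * S ω ^ (1 + δ)) := by
          gcongr
          · exact hβS ω
          · exact hRb ω
      _ = 2 * η ^ (2 + δ) * S ω ^ (2 + δ) := by
          have h2 : S ω ^ (1 + (1 + δ)) = S ω * S ω ^ (1 + δ) :=
            Real.rpow_one_add' h1 (by positivity)
          rw [show 1 + (1 + δ) = 2 + δ by ring] at h2
          rw [h2]
          ring
  -- the first-order term vanishes since the block is centered and independent of `G'`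
  have hfirst : ∫ ω, (β a b ω : ℂ) * G' ω (j, b) (i, a) ∂μ = 0 := by
    have h1 := h.integral_mul_resolventMatrix_removeBlock u hij z
      (f := fun B => ((u * B a b : ℝ) : ℂ)) (by fun_prop)
      (g := fun W => W (j, b) (i, a)) (by fun_prop)
    refine h1.trans ?_
    rw [integral_complex_ofReal, integral_const_mul, h.mean i j hij, mul_zero, Complex.ofReal_zero,
      zero_mul]
  -- in the second-order term the covariance of the block separates from `G'`
  have hsecond : ∀ c e, ∫ ω, (β a b ω : ℂ) * ((β c e ω : ℂ) * P' c e ω) ∂μ =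
      ((u ^ 2 * ∫ ω, Y ω (i, a) (j, b) * Y ω (i, c) (j, e) ∂μ : ℝ) : ℂ) * ∫ ω, P' c e ω ∂μ := by
    intro c e
    have h1 := h.integral_mul_resolventMatrix_removeBlock u hij z
      (f := fun B => ((u ^ 2 * (B a b * B c e) : ℝ) : ℂ)) (by fun_prop)
      (g := fun W => W (j, b) (i, c) * W (j, e) (i, a) + W (j, b) (j, e) * W (i, c) (i, a))
      (by fun_prop)
    rw [integral_complex_ofReal, integral_const_mul] at h1
    rw [← h1]
    refine integral_congr_ae (Eventually.of_forall fun ω => ?_)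
    simp only [hβ, hP', hG']
    push_cast
    ring
  have hint1 : Integrable (fun ω => (β a b ω : ℂ) * G ω (j, b) (i, a)) μ :=
    integrable_ofReal_mul_of_bound (hβint a b) (hGm _ _) fun ω => hGb ω _ _
  have hint2 : Integrable (fun ω => (β a b ω : ℂ) * G' ω (j, b) (i, a)) μ :=
    integrable_ofReal_mul_of_bound (hβint a b) (hGm' _ _) fun ω => hGb' ω _ _
  have hint3 : ∀ c e, Integrable (fun ω => (β a b ω : ℂ) * ((β c e ω : ℂ) * P' c e ω)) μ := by
    intro c e
    refine (integrable_ofReal_mul_of_bound (hββint c e) (hPm' c e) (hPb' c e)).congr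
      (Eventually.of_forall fun ω => ?_)
    simp only
    push_cast
    ring
  have hexp : ∫ ω, (β a b ω : ℂ) * R ω ∂μ = (∫ ω, (β a b ω : ℂ) * G ω (j, b) (i, a) ∂μ) +
      ∑ c, ∑ e, ((u ^ 2 * ∫ ω, Y ω (i, a) (j, b) * Y ω (i, c) (j, e) ∂μ : ℝ) : ℂ) *
        ∫ ω, P' c e ω ∂μ := by
    have h1 : ∀ ω, (β a b ω : ℂ) * R ω = (β a b ω : ℂ) * G ω (j, b) (i, a) -
        (β a b ω : ℂ) * G' ω (j, b) (i, a) +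
        ∑ c, ∑ e, (β a b ω : ℂ) * ((β c e ω : ℂ) * P' c e ω) := by
      intro ω
      simp only [hR, mul_add, mul_sub, Finset.mul_sum]
    have hint12 : Integrable (fun ω => (β a b ω : ℂ) * G ω (j, b) (i, a) -
        (β a b ω : ℂ) * G' ω (j, b) (i, a)) μ := hint1.sub hint2
    simp only [h1]
    rw [integral_add hint12 (integrable_finsetSum _ fun c _ =>
      integrable_finsetSum _ fun e _ => hint3 c e), integral_sub hint1 hint2, hfirst, sub_zero,
      integral_finsetSum _ fun c _ => integrable_finsetSum _ fun e _ => hint3 c e]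
    congr 1
    refine Finset.sum_congr rfl fun c _ => ?_
    rw [integral_finsetSum _ fun e _ => hint3 c e]
    exact Finset.sum_congr rfl fun e _ => hsecond c e
  -- the product `P` of entries of `G` is put back in place of its counterpart `P'` for `G'`
  have hfinal : (∫ ω, (β a b ω : ℂ) * G ω (j, b) (i, a) ∂μ) +
      ∑ c, ∑ e, ((u ^ 2 * ∫ ω, Y ω (i, a) (j, b) * Y ω (i, c) (j, e) ∂μ : ℝ) : ℂ) *
        ∫ ω, P c e ω ∂μ = (∫ ω, (β a b ω : ℂ) * R ω ∂μ) +
      ∑ c, ∑ e, ((u ^ 2 * ∫ ω, Y ω (i, a) (j, b) * Y ω (i, c) (j, e) ∂μ : ℝ) : ℂ) *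
        ∫ ω, (P c e ω - P' c e ω) ∂μ := by
    rw [hexp, add_assoc, ← Finset.sum_add_distrib]
    congr 1
    refine Finset.sum_congr rfl fun c _ => ?_
    rw [← Finset.sum_add_distrib]
    refine Finset.sum_congr rfl fun e _ => ?_
    rw [integral_sub (hPint c e) (hPint' c e)]
    ring
  refine (congrArg norm hfinal).le.trans ?_
  refine norm_add_le_of_le hrem ?_
  have hterm : ∀ c e, ‖((u ^ 2 * ∫ ω, Y ω (i, a) (j, b) * Y ω (i, c) (j, e) ∂μ : ℝ) : ℂ) *
      ∫ ω, (P c e ω - P' c e ω) ∂μ‖ ≤ u ^ 2 * (4 * η ^ 3 * ∫ ω, S ω ∂μ) := by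
    intro c e
    rw [norm_mul, Complex.norm_real, Real.norm_eq_abs, abs_mul, abs_of_nonneg (sq_nonneg u)]
    have h1 : ‖∫ ω, (P c e ω - P' c e ω) ∂μ‖ ≤ 4 * η ^ 3 * ∫ ω, S ω ∂μ := by
      rw [← integral_const_mul]
      exact norm_integral_le_of_norm_le ((h.integrable_blockSize hδ u hij).const_mul _)
        (Eventually.of_forall (hPP c e))
    have h2 := h.abs_integral_mul_le_one hδ hij a b c e
    calc _ ≤ u ^ 2 * 1 * (4 * η ^ 3 * ∫ ω, S ω ∂μ) := by gcongr
      _ = _ := by ring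
  calc _ ≤ ∑ c : Fin d, ∑ e : Fin d, u ^ 2 * (4 * η ^ 3 * ∫ ω, S ω ∂μ) :=
        norm_sum_le_of_le _ fun c _ => norm_sum_le_of_le _ fun e _ => hterm c e
    _ = _ := by
      simp
      ring

end IsCenteredBlockWigner

theorem sum_sum_eq_two_mul_sum_lt_add {n : ℕ} (f : Fin n → Fin n → ℂ)
    (hf : ∀ i j, f i j = f j i) :
    ∑ i, ∑ j, f i j = 2 * ∑ i, ∑ j, (if i < j then f i j else 0) + ∑ i, f i i := by
  have h1 : ∀ i j, f i j = (if i < j then f i j else 0) + (if j < i then f j i else 0) +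
      (if i = j then f i i else 0) := by
    intro i j
    rcases lt_trichotomy i j with h | h | h
    · simp [h, h.not_gt, h.ne]
    · subst h
      simp
    · simp [h, h.not_gt, h.ne', hf i j]
  conv_lhs => enter [2, i, 2, j]; rw [h1]
  simp only [Finset.sum_add_distrib, Finset.sum_ite_eq, Finset.mem_univ, if_true]
  congr 1
  rw [two_mul]
  congr 1
  exact Finset.sum_comm

/-- Against symmetric matrices `g` and `g'`, the covariance of a block acts as the product of the
two traces: the antisymmetric covariances of different rows do not contribute. -/
theorem sum_covariance_mul {d : ℕ} (t : Fin d → Fin d → Fin d → Fin d → ℝ)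
    (hiso : ∀ a b b', t a b a b' = if b = b' then 1 else 0)
    (hanti : ∀ a a', a ≠ a' → ∀ b b', t a b a' b' = -t a b' a' b)
    (g g' : Fin d → Fin d → ℂ) (hg : ∀ b e, g b e = g e b) :
    ∑ a, ∑ b, ∑ c, ∑ e, (t a b c e : ℂ) * (g b e * g' c a) =
      (∑ a, g' a a) * ∑ b, g b b := by
  have hrow : ∀ a c, ∑ b, ∑ e, (t a b c e : ℂ) * g b e = if a = c then ∑ b, g b b else 0 := by
    intro a c
    by_cases hac : a = c
    · subst hac
      simp [hiso, apply_ite]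
    · rw [if_neg hac]
      have h0 : ∑ b, ∑ e, (t a b c e : ℂ) * g b e = -∑ b, ∑ e, (t a b c e : ℂ) * g b e := by
        conv_lhs => rw [Finset.sum_comm]
        simp only [← Finset.sum_neg_distrib]
        refine Finset.sum_congr rfl fun b _ => Finset.sum_congr rfl fun e _ => ?_
        rw [hanti a c hac e b, hg e b, Complex.ofReal_neg, neg_mul]
      exact self_eq_neg.1 h0
  have h1 : ∀ a, ∑ b, ∑ c, ∑ e, (t a b c e : ℂ) * (g b e * g' c a) =
      ∑ c, g' c a * ∑ b, ∑ e, (t a b c e : ℂ) * g b e := by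
    intro a
    rw [Finset.sum_comm]
    refine Finset.sum_congr rfl fun c _ => ?_
    simp only [Finset.mul_sum]
    exact Finset.sum_congr rfl fun b _ => Finset.sum_congr rfl fun e _ => by ring
  simp only [h1, hrow]
  simp [Finset.sum_mul]

theorem sum_norm_mul_norm_le {d : ℕ} (x : Fin d → Fin d → ℂ) :
    ∑ a, ∑ b, ∑ c, ∑ e, ‖x b c‖ * ‖x e a‖ ≤ d ^ 2 * ∑ a, ∑ b, ‖x a b‖ ^ 2 := by
  have h1 : ∑ a, ∑ b, ∑ c, ∑ e, ‖x b c‖ * ‖x e a‖ = (∑ a, ∑ b, ‖x a b‖) ^ 2 := by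
    have h2 : ∀ a b, ∑ c, ∑ e, ‖x b c‖ * ‖x e a‖ = (∑ c, ‖x b c‖) * ∑ e, ‖x e a‖ := fun a b =>
      (Finset.sum_mul_sum _ _ _ _).symm
    simp_rw [h2, ← Finset.sum_mul, ← Finset.mul_sum]
    rw [sq]
    congr 1
    exact Finset.sum_comm
  rw [h1, ← Finset.sum_product', ← Finset.sum_product', Finset.univ_product_univ]
  have h2 := sq_sum_le_card_mul_sum_sq (s := (Finset.univ : Finset (Fin d × Fin d)))
    (f := fun p => ‖x p.1 p.2‖)
  simpa [sq] using h2

namespace IsCenteredBlockWigner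

variable {Ω : Type*} [MeasurableSpace Ω] {μ : Measure Ω} [IsProbabilityMeasure μ] {n d : ℕ}
  {δ K : ℝ} {Y : Ω → Matrix (Fin n × Fin d) (Fin n × Fin d) ℝ}

set_option linter.unusedSectionVars false

/-- The contribution of one block to the loop equation: up to the error of the second-order
expansion it is the product of the traces of two diagonal blocks of the resolvent, plus a term in
the off-diagonal blocks. -/
theorem norm_integral_block_add_le (h : IsCenteredBlockWigner μ δ K Y) (hδ : 0 < δ)
    (hδ1 : δ ≤ 1) {u : ℝ} (hu : 0 ≤ u) {z : ℂ} (hz : 0 < z.im) {i j : Fin n} (hij : i < j) :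
    ‖(∫ ω, ∑ a, ∑ b, ((u * Y ω (i, a) (j, b) : ℝ) : ℂ) *
          resolventMatrix (u • Y ω) z (j, b) (i, a) ∂μ) +
        (u : ℂ) ^ 2 * ∫ ω, (∑ a, resolventMatrix (u • Y ω) z (i, a) (i, a)) *
          ∑ b, resolventMatrix (u • Y ω) z (j, b) (j, b) ∂μ‖ ≤
      d ^ 2 * (2 * z.im⁻¹ ^ (2 + δ) * (∫ ω, blockSize Y u i j ω ^ (2 + δ) ∂μ) +
        d ^ 2 * u ^ 2 * (4 * z.im⁻¹ ^ 3) * ∫ ω, blockSize Y u i j ω ∂μ) +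
      u ^ 2 * (d ^ 2 * ∫ ω, ∑ a, ∑ b, ‖resolventMatrix (u • Y ω) z (j, a) (i, b)‖ ^ 2 ∂μ) := by
  set G : Ω → Matrix (Fin n × Fin d) (Fin n × Fin d) ℂ :=
    fun ω => resolventMatrix (u • Y ω) z with hG
  have hH : ∀ ω, (u • Y ω).IsHermitian := fun ω => isHermitian_real_smul (h.isHermitian ω) u
  have hGb : ∀ ω p q, ‖G ω p q‖ ≤ z.im⁻¹ := fun ω p q =>
    norm_resolventMatrix_apply_le (hH ω) hz p q
  have hGm : ∀ p q, Measurable fun ω => G ω p q := fun p q =>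
    measurable_resolventMatrix_apply (fun p q => by
      simpa using (h.measurable p q).const_mul u) z p q
  set t : Fin d → Fin d → Fin d → Fin d → ℝ := fun a b c e =>
    ∫ ω, Y ω (i, a) (j, b) * Y ω (i, c) (j, e) ∂μ with ht
  have hGG : ∀ p q r s, Integrable (fun ω => G ω p q * G ω r s) μ := fun p q r s =>
    Integrable.of_bound ((hGm p q).mul (hGm r s)).aestronglyMeasurable (z.im⁻¹ * z.im⁻¹)
      (Eventually.of_forall fun ω => by
        rw [norm_mul]
        have := hGb ω p q
        gcongr
        exact hGb ω r s)
  have hβG : ∀ a b, Integrable (fun ω => ((u * Y ω (i, a) (j, b) : ℝ) : ℂ) * G ω (j, b) (i, a)) μ :=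
    fun a b => integrable_ofReal_mul_of_bound ((h.integrable_entry hδ hij a b).const_mul u)
      (hGm _ _) fun ω => hGb ω _ _
  -- the term in the off-diagonal blocks of the resolvent
  set X : Ω → ℂ := fun ω => ∑ a, ∑ b, ∑ c, ∑ e, (t a b c e : ℂ) *
    (G ω (j, b) (i, c) * G ω (j, e) (i, a)) with hX
  have hXint : Integrable X μ := integrable_finsetSum _ fun a _ => integrable_finsetSum _ fun b _ =>
    integrable_finsetSum _ fun c _ => integrable_finsetSum _ fun e _ => (hGG _ _ _ _).const_mul _
  set T : Ω → ℂ := fun ω => (∑ a, G ω (i, a) (i, a)) * ∑ b, G ω (j, b) (j, b) with hT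
  have hTint : Integrable T μ := by
    simp only [hT, Finset.sum_mul_sum]
    exact integrable_finsetSum _ fun a _ => integrable_finsetSum _ fun b _ => hGG _ _ _ _
  have hXT : ∑ a, ∑ b, ∑ c, ∑ e, ((u ^ 2 * t a b c e : ℝ) : ℂ) *
      ∫ ω, (G ω (j, b) (i, c) * G ω (j, e) (i, a) + G ω (j, b) (j, e) * G ω (i, c) (i, a)) ∂μ =
      (u : ℂ) ^ 2 * (∫ ω, T ω ∂μ) + (u : ℂ) ^ 2 * ∫ ω, X ω ∂μ := by
    have h1 : ∀ ω, T ω = ∑ a, ∑ b, ∑ c, ∑ e, (t a b c e : ℂ) *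
        (G ω (j, b) (j, e) * G ω (i, c) (i, a)) := fun ω =>
      (sum_covariance_mul t (h.isotropic i j hij) (h.antisymm i j hij)
        (fun b e => G ω (j, b) (j, e)) (fun c a => G ω (i, c) (i, a))
        fun b e => resolventMatrix_apply_comm (hH ω) z _ _).symm
    have hsum : ∀ F : Fin d → Fin d → Fin d → Fin d → Ω → ℂ, (∀ a b c e, Integrable (F a b c e) μ) →
        ∫ ω, ∑ a, ∑ b, ∑ c, ∑ e, F a b c e ω ∂μ = ∑ a, ∑ b, ∑ c, ∑ e, ∫ ω, F a b c e ω ∂μ := by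
      intro F hF
      rw [integral_finsetSum _ fun a _ => integrable_finsetSum _ fun b _ =>
        integrable_finsetSum _ fun c _ => integrable_finsetSum _ fun e _ => hF a b c e]
      refine Finset.sum_congr rfl fun a _ => ?_
      rw [integral_finsetSum _ fun b _ =>
        integrable_finsetSum _ fun c _ => integrable_finsetSum _ fun e _ => hF a b c e]
      refine Finset.sum_congr rfl fun b _ => ?_
      rw [integral_finsetSum _ fun c _ => integrable_finsetSum _ fun e _ => hF a b c e]
      refine Finset.sum_congr rfl fun c _ => ?_
      rw [integral_finsetSum _ fun e _ => hF a b c e]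
    simp only [h1, hX]
    rw [hsum _ fun a b c e => (hGG _ _ _ _).const_mul _,
      hsum _ fun a b c e => (hGG _ _ _ _).const_mul _]
    simp only [Finset.mul_sum, ← Finset.sum_add_distrib]
    refine Finset.sum_congr rfl fun a _ => Finset.sum_congr rfl fun b _ =>
      Finset.sum_congr rfl fun c _ => Finset.sum_congr rfl fun e _ => ?_
    rw [integral_add (hGG _ _ _ _) (hGG _ _ _ _), integral_const_mul, integral_const_mul]
    push_cast
    ring
  have hF : ∫ ω, ∑ a, ∑ b, ((u * Y ω (i, a) (j, b) : ℝ) : ℂ) * G ω (j, b) (i, a) ∂μ =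
      ∑ a, ∑ b, ∫ ω, ((u * Y ω (i, a) (j, b) : ℝ) : ℂ) * G ω (j, b) (i, a) ∂μ := by
    rw [integral_finsetSum _ fun a _ => integrable_finsetSum _ fun b _ => hβG a b]
    exact Finset.sum_congr rfl fun a _ => integral_finsetSum _ fun b _ => hβG a b
  have hXb : ‖∫ ω, X ω ∂μ‖ ≤ d ^ 2 * ∫ ω, ∑ a, ∑ b, ‖G ω (j, a) (i, b)‖ ^ 2 ∂μ := by
    rw [← integral_const_mul]
    refine norm_integral_le_of_norm_le (Integrable.const_mul (integrable_finsetSum _ fun a _ =>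
      integrable_finsetSum _ fun b _ => Integrable.of_bound
        ((hGm _ _).norm.pow_const 2).aestronglyMeasurable (z.im⁻¹ ^ 2)
        (Eventually.of_forall fun ω => ?_)) _) (Eventually.of_forall fun ω => ?_)
    · rw [norm_pow, norm_norm]
      exact pow_le_pow_left₀ (norm_nonneg _) (hGb _ _ _) 2
    · refine le_trans ?_ (sum_norm_mul_norm_le fun b c => G ω (j, b) (i, c))
      refine norm_sum_le_of_le _ fun a _ => norm_sum_le_of_le _ fun b _ =>
        norm_sum_le_of_le _ fun c _ => norm_sum_le_of_le _ fun e _ => ?_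
      rw [norm_mul, norm_mul, Complex.norm_real, Real.norm_eq_abs]
      exact mul_le_of_le_one_left (by positivity) (h.abs_integral_mul_le_one hδ hij a b c e)
  have hsplit : (∫ ω, ∑ a, ∑ b, ((u * Y ω (i, a) (j, b) : ℝ) : ℂ) * G ω (j, b) (i, a) ∂μ) +
      (u : ℂ) ^ 2 * ∫ ω, T ω ∂μ = (∑ a, ∑ b,
        ((∫ ω, ((u * Y ω (i, a) (j, b) : ℝ) : ℂ) * G ω (j, b) (i, a) ∂μ) +
        ∑ c, ∑ e, ((u ^ 2 * t a b c e : ℝ) : ℂ) *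
          ∫ ω, (G ω (j, b) (i, c) * G ω (j, e) (i, a) +
            G ω (j, b) (j, e) * G ω (i, c) (i, a)) ∂μ)) - (u : ℂ) ^ 2 * ∫ ω, X ω ∂μ := by
    simp only [Finset.sum_add_distrib]
    rw [hXT, hF]
    ring
  refine (congrArg norm hsplit).le.trans ((norm_sub_le _ _).trans (add_le_add ?_ ?_))
  · refine (norm_sum_le_of_le _ fun a _ => norm_sum_le_of_le _ fun b _ =>
      h.norm_integral_entry_mul_resolventMatrix_le hδ hδ1 hu hz hij a b).trans (le_of_eq ?_)
    simp only [Finset.sum_const, Finset.card_univ, Fintype.card_fin, nsmul_eq_mul]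
    ring
  · rw [norm_mul, norm_pow, Complex.norm_real, Real.norm_eq_abs, sq_abs]
    gcongr

end IsCenteredBlockWigner

theorem sum_mul_resolventMatrix {ι : Type*} [Fintype ι] [DecidableEq ι] {A : Matrix ι ι ℝ}
    (hA : A.IsHermitian) {z : ℂ} (hz : 0 < z.im) :
    ∑ p, ∑ q, (A p q : ℂ) * resolventMatrix A z q p =
      Fintype.card ι + z * (resolventMatrix A z).trace := by
  have h := congrArg Matrix.trace (sub_mul_resolventMatrix hA hz)
  rw [sub_mul, Matrix.trace_sub, Matrix.smul_mul, one_mul, Matrix.trace_smul, Matrix.trace_one,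
    smul_eq_mul, sub_eq_iff_eq_add] at h
  rw [← h]
  simp [Matrix.trace, Matrix.mul_apply]

namespace IsCenteredBlockWigner

variable {Ω : Type*} [MeasurableSpace Ω] {μ : Measure Ω} [IsProbabilityMeasure μ] {n d : ℕ}
  {δ K : ℝ} {Y : Ω → Matrix (Fin n × Fin d) (Fin n × Fin d) ℝ}

/-- The loop equation `1 + z E[s] + E[s²] ≈ 0` for the Stieltjes transform `s`, with an explicit
error that vanishes as `n` grows. -/
theorem norm_loop_equation_le (h : IsCenteredBlockWigner μ δ K Y) (hδ : 0 < δ)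
    (hδ1 : δ ≤ 1) (hK : 0 ≤ K) {u : ℝ} (hu : 0 < u) (hun : u ^ 2 * (n * d) = 1) {z : ℂ}
    (hz : 0 < z.im) :
    ‖1 + z * (∫ ω, resolventMean (u • Y ω) z ∂μ) + ∫ ω, resolventMean (u • Y ω) z ^ 2 ∂μ‖ ≤
      2 * (2 * z.im⁻¹ ^ (2 + δ) *
          (2 ^ (2 + δ) * (((d * d : ℕ) : ℝ) ^ (1 + δ) * (d * d * K))) * u ^ δ +
        8 * d ^ 4 * z.im⁻¹ ^ 3 * u) + u ^ 2 * (2 * d ^ 2 * z.im⁻¹ ^ 2 + d * z.im⁻¹ ^ 2) := by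
  set η := z.im⁻¹ with hη
  have hη0 : 0 < η := inv_pos.2 hz
  set A : ℝ := 2 ^ (2 + δ) * (((d * d : ℕ) : ℝ) ^ (1 + δ) * (d * d * K)) with hA
  set G : Ω → Matrix (Fin n × Fin d) (Fin n × Fin d) ℂ :=
    fun ω => resolventMatrix (u • Y ω) z with hG
  have hH : ∀ ω, (u • Y ω).IsHermitian := fun ω => isHermitian_real_smul (h.isHermitian ω) u
  have hGb : ∀ ω p q, ‖G ω p q‖ ≤ η := fun ω p q => norm_resolventMatrix_apply_le (hH ω) hz p q
  have hHm : ∀ p q, Measurable fun ω => (u • Y ω) p q := fun p q => by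
    simpa using (h.measurable p q).const_mul u
  have hGm : ∀ p q, Measurable fun ω => G ω p q := fun p q =>
    measurable_resolventMatrix_apply hHm z p q
  have hu2 : (u : ℂ) ^ 2 = ((Fintype.card (Fin n × Fin d) : ℕ) : ℂ)⁻¹ := by
    have h1 : (u : ℂ) ^ 2 * (n * d) = 1 := by exact_mod_cast hun
    simp only [Fintype.card_prod, Fintype.card_fin, Nat.cast_mul]
    exact eq_inv_of_mul_eq_one_left h1
  have hcard : ((Fintype.card (Fin n × Fin d) : ℕ) : ℂ) ≠ 0 := by
    intro h0
    rw [h0, inv_zero] at hu2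
    exact hu.ne' (by exact_mod_cast pow_eq_zero_iff (two_ne_zero) |>.1 hu2)
  set τ : Fin n → Ω → ℂ := fun i ω => ∑ a, G ω (i, a) (i, a) with hτ
  set f : Fin n → Fin n → Ω → ℂ := fun i j ω => ∑ a, ∑ b, ((u * Y ω (i, a) (j, b) : ℝ) : ℂ) *
    G ω (j, b) (i, a) with hf
  have hs : ∀ ω, resolventMean (u • Y ω) z = (u : ℂ) ^ 2 * ∑ i, τ i ω := by
    intro ω
    rw [hu2, resolventMean, Matrix.trace, Fintype.sum_prod_type]
    rfl
  have hfcomm : ∀ ω i j, f i j ω = f j i ω := by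
    intro ω i j
    simp only [hf]
    rw [Finset.sum_comm]
    refine Finset.sum_congr rfl fun b _ => Finset.sum_congr rfl fun a _ => ?_
    rw [isHermitian_apply_comm (h.isHermitian ω) (i, a), hG]
    simp only
    rw [resolventMatrix_apply_comm (hH ω) z (j, b)]
  have hfdiag : ∀ ω i, f i i ω = 0 := by
    intro ω i
    have h0 : ∀ a b, Y ω (i, a) (i, b) = 0 := fun a b => h.diag ω _ _ rfl
    simp [hf, h0]
  have h1 : ∀ ω, 1 + z * resolventMean (u • Y ω) z =
      2 * (u : ℂ) ^ 2 * ∑ i, ∑ j, (if i < j then f i j ω else 0) := by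
    intro ω
    have h2 := sum_mul_resolventMatrix (hH ω) hz
    have h3 : ∑ p, ∑ q, ((u • Y ω) p q : ℂ) * resolventMatrix (u • Y ω) z q p =
        ∑ i, ∑ j, f i j ω := by
      rw [Fintype.sum_prod_type]
      refine Finset.sum_congr rfl fun i _ => ?_
      simp only [Fintype.sum_prod_type]
      rw [Finset.sum_comm]
      rfl
    rw [h3, sum_sum_eq_two_mul_sum_lt_add _ (hfcomm ω)] at h2
    simp only [hfdiag, Finset.sum_const_zero, add_zero] at h2
    rw [mul_right_comm, h2, resolventMean, hu2, add_mul, mul_inv_cancel₀ hcard]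
    ring
  have h2 : ∀ ω, resolventMean (u • Y ω) z ^ 2 = 2 * (u : ℂ) ^ 4 * (∑ i, ∑ j,
      (if i < j then τ i ω * τ j ω else 0)) + (u : ℂ) ^ 4 * ∑ i, τ i ω * τ i ω := by
    intro ω
    have h3 := sum_sum_eq_two_mul_sum_lt_add (fun i j => τ i ω * τ j ω) fun i j => mul_comm _ _
    rw [← Finset.sum_mul_sum] at h3
    rw [hs, mul_pow, sq (∑ i, τ i ω), h3]
    ring
  have hτb : ∀ i ω, ‖τ i ω‖ ≤ d * η := fun i ω => by
    refine (norm_sum_le_of_le _ fun a _ => hGb ω _ _).trans ?_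
    simp
  have hτm : ∀ i, Measurable (τ i) := fun i => Finset.measurable_sum _ fun a _ => hGm _ _
  have hττ : ∀ i j, Integrable (fun ω => τ i ω * τ j ω) μ := fun i j =>
    Integrable.of_bound ((hτm i).mul (hτm j)).aestronglyMeasurable ((d * η) * (d * η))
      (Eventually.of_forall fun ω => by
        rw [norm_mul]
        have := hτb i ω
        gcongr
        exact hτb j ω)
  have hfint : ∀ i j, i < j → Integrable (f i j) μ := fun i j hij =>
    integrable_finsetSum _ fun a _ => integrable_finsetSum _ fun b _ =>
      integrable_ofReal_mul_of_bound ((h.integrable_entry hδ hij a b).const_mul u)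
        (hGm _ _) fun ω => hGb ω _ _
  have hg1 : ∀ i j, Integrable (fun ω => if i < j then f i j ω else 0) μ := fun i j => by
    by_cases hij : i < j
    · simpa [hij] using hfint i j hij
    · simp [hij]
  have hg2 : ∀ i j, Integrable (fun ω => if i < j then τ i ω * τ j ω else 0) μ := fun i j => by
    by_cases hij : i < j
    · simpa [hij] using hττ i j
    · simp [hij]
  have hsint : Integrable (fun ω => resolventMean (u • Y ω) z) μ :=
    Integrable.of_bound (measurable_resolventMean hHm z).aestronglyMeasurable η
      (Eventually.of_forall fun ω => norm_resolventMean_le (hH ω) hz)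
  have hsum : ∀ F : Fin n → Fin n → Ω → ℂ, (∀ i j, Integrable (F i j) μ) →
      ∫ ω, ∑ i, ∑ j, F i j ω ∂μ = ∑ i, ∑ j, ∫ ω, F i j ω ∂μ := by
    intro F hF
    rw [integral_finsetSum _ fun i _ => integrable_finsetSum _ fun j _ => hF i j]
    exact Finset.sum_congr rfl fun i _ => integral_finsetSum _ fun j _ => hF i j
  have hE1 : 1 + z * (∫ ω, resolventMean (u • Y ω) z ∂μ) =
      2 * (u : ℂ) ^ 2 * ∑ i, ∑ j, ∫ ω, (if i < j then f i j ω else 0) ∂μ := by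
    rw [← hsum _ hg1, ← integral_const_mul, ← integral_const_mul]
    simp only [← h1]
    rw [integral_add (integrable_const 1) (hsint.const_mul z)]
    simp
  have hE2 : ∫ ω, resolventMean (u • Y ω) z ^ 2 ∂μ = 2 * (u : ℂ) ^ 4 * (∑ i, ∑ j,
      ∫ ω, (if i < j then τ i ω * τ j ω else 0) ∂μ) +
      (u : ℂ) ^ 4 * ∑ i, ∫ ω, τ i ω * τ i ω ∂μ := by
    simp only [h2]
    rw [integral_add ((integrable_finsetSum _ fun i _ => integrable_finsetSum _ fun j _ =>
      hg2 i j).const_mul _) ((integrable_finsetSum _ fun i _ => hττ i i).const_mul _),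
      integral_const_mul, integral_const_mul, hsum _ hg2, integral_finsetSum _ fun i _ => hττ i i]
  -- the pairs `i < j` are matched term by term; the diagonal terms of `s²` are of order `1 / n`
  have hcomb : 1 + z * (∫ ω, resolventMean (u • Y ω) z ∂μ) +
      ∫ ω, resolventMean (u • Y ω) z ^ 2 ∂μ = 2 * (u : ℂ) ^ 2 * (∑ i, ∑ j,
        ((∫ ω, (if i < j then f i j ω else 0) ∂μ) +
          (u : ℂ) ^ 2 * ∫ ω, (if i < j then τ i ω * τ j ω else 0) ∂μ)) +
      (u : ℂ) ^ 4 * ∑ i, ∫ ω, τ i ω * τ i ω ∂μ := by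
    rw [hE1, hE2]
    simp only [Finset.sum_add_distrib, ← Finset.mul_sum]
    ring
  set B : ℝ := d ^ 2 * (u ^ 2 * (2 * η ^ (2 + δ) * A * u ^ δ + 8 * d ^ 4 * η ^ 3 * u)) with hB
  have hA0 : 0 ≤ A := by positivity
  have hB0 : 0 ≤ B := by positivity
  have hGsq : ∀ p q, Integrable (fun ω => ‖G ω p q‖ ^ 2) μ := fun p q => Integrable.of_bound
    ((hGm p q).norm.pow_const 2).aestronglyMeasurable (η ^ 2)
    (Eventually.of_forall fun ω => by
      rw [norm_pow, norm_norm]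
      exact pow_le_pow_left₀ (norm_nonneg _) (hGb _ _ _) 2)
  have hterm : ∀ i j, ‖(∫ ω, (if i < j then f i j ω else 0) ∂μ) +
      (u : ℂ) ^ 2 * ∫ ω, (if i < j then τ i ω * τ j ω else 0) ∂μ‖ ≤
      B + u ^ 2 * (d ^ 2 * ∫ ω, ∑ a, ∑ b, ‖G ω (j, a) (i, b)‖ ^ 2 ∂μ) := by
    intro i j
    have hpos : 0 ≤ ∫ ω, ∑ a, ∑ b, ‖G ω (j, a) (i, b)‖ ^ 2 ∂μ :=
      integral_nonneg fun ω => Finset.sum_nonneg fun a _ => Finset.sum_nonneg fun b _ => by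
        positivity
    by_cases hij : i < j
    · simp only [hij, if_true]
      refine (h.norm_integral_block_add_le hδ hδ1 hu.le hz hij).trans ?_
      refine add_le_add ?_ le_rfl
      have hS1 := h.integral_blockSize_rpow_le hδ hu.le hij
      have hS2 := h.integral_blockSize_le hδ hu.le hij
      rw [hB]
      refine mul_le_mul_of_nonneg_left ?_ (by positivity)
      calc _ ≤ 2 * η ^ (2 + δ) * (u ^ (2 + δ) * A) +
            d ^ 2 * u ^ 2 * (4 * η ^ 3) * (2 * u * d ^ 2) := by gcongr
        _ = _ := by
          rw [Real.rpow_add hu, Real.rpow_two]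
          ring
    · simp only [hij, if_false, integral_zero, mul_zero, add_zero, norm_zero]
      positivity
  -- the squares of all entries of the resolvent add up to `O(N)`: each row has norm at most `η`
  have hsumG : ∑ i, ∑ j, ∫ ω, ∑ a, ∑ b, ‖G ω (j, a) (i, b)‖ ^ 2 ∂μ ≤ n * d * η ^ 2 := by
    have h3 : ∑ i, ∑ j, ∫ ω, ∑ a, ∑ b, ‖G ω (j, a) (i, b)‖ ^ 2 ∂μ =
        ∫ ω, ∑ p, ∑ q, ‖G ω p q‖ ^ 2 ∂μ := by
      have h4 : ∀ ω, ∑ p, ∑ q, ‖G ω p q‖ ^ 2 =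
          ∑ i, ∑ j, ∑ a, ∑ b, ‖G ω (j, a) (i, b)‖ ^ 2 := by
        intro ω
        rw [Finset.sum_comm' (t' := Finset.univ) (s' := fun _ => Finset.univ) (by simp),
          Fintype.sum_prod_type]
        refine Finset.sum_congr rfl fun i _ => ?_
        simp only [Fintype.sum_prod_type]
        rw [Finset.sum_comm]
        exact Finset.sum_congr rfl fun j _ => Finset.sum_comm
      simp only [h4]
      have hint : ∀ i j, Integrable (fun ω => ∑ a, ∑ b, ‖G ω (j, a) (i, b)‖ ^ 2) μ := fun i j =>
        integrable_finsetSum _ fun a _ => integrable_finsetSum _ fun b _ => hGsq _ _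
      rw [integral_finsetSum _ fun i _ => integrable_finsetSum _ fun j _ => hint i j]
      exact Finset.sum_congr rfl fun i _ => (integral_finsetSum _ fun j _ => hint i j).symm
    rw [h3]
    have h5 : ∀ ω, ∑ p, ∑ q, ‖G ω p q‖ ^ 2 ≤ n * d * η ^ 2 := by
      intro ω
      refine (Finset.sum_le_sum fun p _ => sum_norm_sq_resolventMatrix_le (hH ω) hz p).trans ?_
      simp only [Finset.sum_const, Finset.card_univ, Fintype.card_prod, Fintype.card_fin,
        nsmul_eq_mul, Nat.cast_mul]
      exact le_rfl
    calc _ ≤ ∫ _, (n * d * η ^ 2 : ℝ) ∂μ := integral_mono (integrable_finsetSum _ fun p _ =>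
          integrable_finsetSum _ fun q _ => hGsq p q) (integrable_const _) h5
      _ = _ := by simp
  have hττb : ∀ i, ‖∫ ω, τ i ω * τ i ω ∂μ‖ ≤ (d * η) * (d * η) := by
    intro i
    have := norm_integral_le_of_norm_le_const (μ := μ) (f := fun ω => τ i ω * τ i ω)
      (C := (d * η) * (d * η)) (Eventually.of_forall fun ω => by
        rw [norm_mul]
        have := hτb i ω
        gcongr)
    simpa using this
  have hnorm_u : ‖(u : ℂ)‖ = u := by rw [Complex.norm_real, Real.norm_of_nonneg hu.le]
  rw [hcomb]
  calc _ ≤ 2 * u ^ 2 * (∑ i : Fin n, ∑ j : Fin n,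
          (B + u ^ 2 * (d ^ 2 * ∫ ω, ∑ a, ∑ b, ‖G ω (j, a) (i, b)‖ ^ 2 ∂μ))) +
        u ^ 4 * ∑ i : Fin n, (d * η) * (d * η) := by
        refine norm_add_le_of_le ?_ ?_
        · rw [norm_mul, norm_mul, norm_pow, hnorm_u, Complex.norm_ofNat]
          exact mul_le_mul_of_nonneg_left (norm_sum_le_of_le _ fun i _ =>
            norm_sum_le_of_le _ fun j _ => hterm i j) (by positivity)
        · rw [norm_mul, norm_pow, hnorm_u]
          exact mul_le_mul_of_nonneg_left (norm_sum_le_of_le _ fun i _ => hττb i) (by positivity)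
    _ = 2 * u ^ 2 * (n * n * B + u ^ 2 * (d ^ 2 *
          ∑ i, ∑ j, ∫ ω, ∑ a, ∑ b, ‖G ω (j, a) (i, b)‖ ^ 2 ∂μ)) +
        u ^ 4 * (n * ((d * η) * (d * η))) := by
        simp only [Finset.sum_add_distrib, ← Finset.mul_sum]
        simp only [Finset.sum_const, Finset.card_univ, Fintype.card_fin, nsmul_eq_mul]
        ring
    _ ≤ 2 * u ^ 2 * (n * n * B + u ^ 2 * (d ^ 2 * (n * d * η ^ 2))) +
        u ^ 4 * (n * ((d * η) * (d * η))) := by gcongr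
    _ = 2 * ((u ^ 2 * (n * d)) ^ 2 * (2 * η ^ (2 + δ) * A * u ^ δ + 8 * d ^ 4 * η ^ 3 * u)) +
        u ^ 2 * (u ^ 2 * (n * d)) * (2 * d ^ 2 * η ^ 2 + d * η ^ 2) := by
        rw [hB]
        ring
    _ = _ := by rw [hun, one_pow, one_mul, mul_one]

end IsCenteredBlockWigner

end LoopEquation

/-! ### The Stieltjes transform of the semicircle law -/

section Semicircle

theorem continuous_inv_ofReal_sub {z : ℂ} (hz : 0 < z.im) :
    Continuous fun x : ℝ => ((x : ℂ) - z)⁻¹ :=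
  (Complex.continuous_ofReal.sub continuous_const).inv₀ (ofReal_sub_ne_zero hz)

theorem integrable_inv_ofReal_sub {z : ℂ} (hz : 0 < z.im) (ν : Measure ℝ) [IsFiniteMeasure ν] :
    Integrable (fun x : ℝ => ((x : ℂ) - z)⁻¹) ν :=
  Integrable.of_bound (continuous_inv_ofReal_sub hz).aestronglyMeasurable z.im⁻¹
    (Eventually.of_forall (norm_inv_ofReal_sub_le hz))

theorem inv_ofReal_sub_im (z : ℂ) (x : ℝ) :
    (((x : ℂ) - z)⁻¹).im = z.im / ((x - z.re) ^ 2 + z.im ^ 2) := by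
  rw [Complex.inv_im, Complex.normSq_apply]
  simp
  ring

theorem integral_inv_ofReal_sub_im_nonneg {z : ℂ} (hz : 0 < z.im) (ν : Measure ℝ)
    [IsFiniteMeasure ν] : 0 ≤ (∫ x : ℝ, ((x : ℂ) - z)⁻¹ ∂ν).im := by
  have h := Complex.imCLM.integral_comp_comm (integrable_inv_ofReal_sub hz ν)
  simp only [Complex.imCLM_apply] at h
  rw [← h]
  refine integral_nonneg fun x => ?_
  simp only [inv_ofReal_sub_im]
  positivity

/-- The equation `a² + z a + 1 = 0` has a root in the open unit disc if `Im z > 0`. -/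
theorem exists_norm_lt_one_root {z : ℂ} (hz : 0 < z.im) :
    ∃ a : ℂ, ‖a‖ < 1 ∧ a ≠ 0 ∧ a ^ 2 + z * a + 1 = 0 := by
  obtain ⟨s, hs⟩ := IsAlgClosed.exists_pow_nat_eq (z ^ 2 - 4) (n := 2) (by norm_num)
  set a := (-z + s) / 2 with ha
  set b := (-z - s) / 2 with hb
  have hab : a * b = 1 := by
    rw [ha, hb]
    linear_combination (-1 / 4 : ℂ) * hs
  have hsum : a + b = -z := by
    rw [ha, hb]
    ring
  have hroot : a ^ 2 + z * a + 1 = 0 := by linear_combination a * hsum - hab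
  have hroot' : b ^ 2 + z * b + 1 = 0 := by linear_combination b * hsum - hab
  have ha0 : a ≠ 0 := left_ne_zero_of_mul_eq_one hab
  have hb0 : b ≠ 0 := right_ne_zero_of_mul_eq_one hab
  have hnorm : ‖a‖ * ‖b‖ = 1 := by rw [← norm_mul, hab, norm_one]
  rcases lt_trichotomy ‖a‖ 1 with h | h | h
  · exact ⟨a, h, ha0, hroot⟩
  · exfalso
    have hbc : b = (starRingEnd ℂ) a := by
      rw [eq_inv_of_mul_eq_one_right hab, Complex.inv_def, Complex.normSq_eq_norm_sq, h]
      simp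
    have := congrArg Complex.im hsum
    rw [hbc] at this
    simp at this
    exact hz.ne' this
  · refine ⟨b, ?_, hb0, hroot'⟩
    have := norm_nonneg b
    nlinarith

/-- Cauchy's integral formula evaluates the Stieltjes transform of the semicircle law after the
substitution `x = 2 cos θ`. -/
theorem integral_sin_sq_div {z a : ℂ} (hz : 0 < z.im) (ha : ‖a‖ < 1) (ha0 : a ≠ 0)
    (hroot : a ^ 2 + z * a + 1 = 0) :
    ∫ θ in (0 : ℝ)..2 * Real.pi, ((Real.sin θ ^ 2 : ℝ) : ℂ) * (((2 * Real.cos θ : ℝ) : ℂ) - z)⁻¹ =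
      Real.pi * a := by
  have hne : ∀ w : ℂ, ‖w‖ ≤ 1 → 1 + a * w ≠ 0 := by
    intro w hw h
    have h1 : ‖a * w‖ = 1 := by
      rw [show a * w = -1 by linear_combination h]
      simp
    rw [norm_mul] at h1
    nlinarith [norm_nonneg a, norm_nonneg w]
  -- on the unit circle `w = exp (i θ)` one has `a w (2 cos θ - z) = (1 + a w) (w + a)`, so that
  -- up to an odd function of `θ` the integrand is a multiple of `w F(w) / (w + a)`, and Cauchy's
  -- formula applies to the point `-a` of the disc
  set F : ℂ → ℂ := fun w => a / 2 * (1 - w ^ 2) / (1 + a * w) with hF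
  have hdiff : DiffContOnCl ℂ F (Metric.ball 0 1) := by
    refine DifferentiableOn.diffContOnCl ?_
    intro w hw
    have hw' : ‖w‖ ≤ 1 := by
      have := Metric.closure_ball_subset_closedBall hw
      simpa using this
    refine DifferentiableAt.differentiableWithinAt ?_
    exact DifferentiableAt.div (by fun_prop) (by fun_prop) (hne w hw')
  have hC := hdiff.circleIntegral_sub_inv_smul (w := -a) (by simpa using ha)
  have hFa : F (-a) = a / 2 := by
    have h1 : 1 + a * -a ≠ 0 := hne (-a) (by simpa using ha.le)
    simp only [hF]
    rw [show 1 + a * -a = 1 - (-a) ^ 2 by ring] at h1 ⊢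
    rw [mul_div_assoc, div_self h1, mul_one]
  rw [hFa, circleIntegral] at hC
  -- the odd part of the integrand on the circle
  set O : ℝ → ℂ :=
    fun θ => ((Real.sin (2 * θ) : ℝ) : ℂ) * (((2 * Real.cos θ : ℝ) : ℂ) - z)⁻¹ with hO
  have hOint : ∫ θ in (0 : ℝ)..2 * Real.pi, O θ = 0 := by
    have h1 := intervalIntegral.integral_comp_sub_left (a := 0) (b := 2 * Real.pi) O (2 * Real.pi)
    have h2 : ∀ θ, O (2 * Real.pi - θ) = -O θ := by
      intro θ
      simp only [hO]
      rw [Real.cos_two_pi_sub, show 2 * (2 * Real.pi - θ) = -(2 * θ) + (2 : ℕ) * (2 * Real.pi) by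
        push_cast; ring, Real.sin_add_nat_mul_two_pi, Real.sin_neg]
      push_cast
      ring
    simp only [h2, intervalIntegral.integral_neg, sub_self, sub_zero] at h1
    exact self_eq_neg.1 h1.symm
  have hcosc : Continuous fun θ : ℝ => (((2 * Real.cos θ : ℝ) : ℂ) - z)⁻¹ :=
    (continuous_inv_ofReal_sub hz).comp (by fun_prop)
  have hOc : Continuous O := by
    refine Continuous.mul ?_ hcosc
    exact Complex.continuous_ofReal.comp (by fun_prop)
  have hSc : Continuous fun θ : ℝ => ((Real.sin θ ^ 2 : ℝ) : ℂ) *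
      (((2 * Real.cos θ : ℝ) : ℂ) - z)⁻¹ := by
    refine Continuous.mul ?_ hcosc
    exact Complex.continuous_ofReal.comp (by fun_prop)
  have hpt : ∀ θ : ℝ, deriv (circleMap 0 1) θ • (fun w => (w - -a)⁻¹ • F w) (circleMap 0 1 θ) =
      Complex.I * (((Real.sin θ ^ 2 : ℝ) : ℂ) * (((2 * Real.cos θ : ℝ) : ℂ) - z)⁻¹) +
        1 / 2 * O θ := by
    intro θ
    set w := circleMap 0 1 θ with hw
    have hwe : w = Complex.exp (θ * Complex.I) := by simp [hw, circleMap]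
    have hwn : ‖w‖ = 1 := by rw [hwe, Complex.norm_exp_ofReal_mul_I]
    have hw0 : w ≠ 0 := by
      rw [hwe]
      exact Complex.exp_ne_zero _
    have hwcs : w = Complex.cos θ + Complex.sin θ * Complex.I := by
      rw [hwe, Complex.exp_mul_I]
    have hcs : Complex.sin (θ : ℂ) ^ 2 + Complex.cos (θ : ℂ) ^ 2 = 1 := Complex.sin_sq_add_cos_sq _
    have hden : (((2 * Real.cos θ : ℝ) : ℂ) - z) ≠ 0 := ofReal_sub_ne_zero hz _
    have h1 : 1 + a * w ≠ 0 := hne w hwn.le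
    have hkey : a * w * (((2 * Real.cos θ : ℝ) : ℂ) - z) = (1 + a * w) * (w + a) := by
      have h3 : w ^ 2 + 1 = 2 * Complex.cos θ * w := by
        rw [hwcs]
        linear_combination Complex.sin (θ : ℂ) ^ 2 * Complex.I_sq - hcs
      push_cast
      linear_combination (-w) * hroot - a * h3
    have h2 : w - -a ≠ 0 := by
      intro h
      have : w + a = 0 := by linear_combination h
      rw [this, mul_zero] at hkey
      exact mul_ne_zero (mul_ne_zero ha0 hw0) hden hkey
    rw [deriv_circleMap, ← hw]
    simp only [hO, hF, smul_eq_mul]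
    have h4 : (w - -a)⁻¹ * (a / 2 * (1 - w ^ 2) / (1 + a * w)) * w =
        (1 - w ^ 2) / 2 * (((2 * Real.cos θ : ℝ) : ℂ) - z)⁻¹ := by
      have h5 : w + a ≠ 0 := by simpa using h2
      have hD : (((2 * Real.cos θ : ℝ) : ℂ) - z)⁻¹ = a * w * ((1 + a * w) * (w + a))⁻¹ := by
        rw [← hkey, mul_inv (a * w), mul_inv_cancel_left₀ (mul_ne_zero ha0 hw0)]
      rw [sub_neg_eq_add, hD, mul_inv, div_eq_mul_inv]
      ring
    have h6 : (1 - w ^ 2) / 2 = ((Real.sin θ ^ 2 : ℝ) : ℂ) +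
        1 / 2 * ((Real.sin (2 * θ) : ℝ) : ℂ) * (-Complex.I) := by
      push_cast
      rw [Complex.sin_two_mul, hwcs]
      linear_combination (-1 / 2) * Complex.sin (θ : ℂ) ^ 2 * Complex.I_sq - 1/2 * hcs
    calc _ = Complex.I * ((w - -a)⁻¹ * (a / 2 * (1 - w ^ 2) / (1 + a * w)) * w) := by ring
      _ = _ := by
        rw [h4, h6]
        linear_combination (-1 / 2) * ((Real.sin (2 * θ) : ℝ) : ℂ) *
          (((2 * Real.cos θ : ℝ) : ℂ) - z)⁻¹ * Complex.I_sq
  simp only [hpt] at hC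
  rw [intervalIntegral.integral_add ((hSc.const_mul _).intervalIntegrable _ _)
    ((hOc.const_mul _).intervalIntegrable _ _), intervalIntegral.integral_const_mul,
    intervalIntegral.integral_const_mul, hOint, mul_zero, add_zero, smul_eq_mul] at hC
  refine mul_left_cancel₀ Complex.I_ne_zero (hC.trans ?_)
  ring

/-- The Stieltjes transform `m` of the semicircle law solves `m² + z m + 1 = 0`. -/
theorem stieltjes_semicircle_quadratic {z : ℂ} (hz : 0 < z.im) :
    (∫ x : ℝ, ((x : ℂ) - z)⁻¹ ∂semicircleMeasure) ^ 2 +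
      z * (∫ x : ℝ, ((x : ℂ) - z)⁻¹ ∂semicircleMeasure) + 1 = 0 := by
  obtain ⟨a, ha, ha0, hroot⟩ := exists_norm_lt_one_root hz
  suffices h : ∫ x : ℝ, ((x : ℂ) - z)⁻¹ ∂semicircleMeasure = a by rw [h, hroot]
  have hnn : ∀ x, 0 ≤ semicircleDensity x := by
    intro x
    unfold semicircleDensity
    split_ifs <;> positivity
  have hmeas : Measurable semicircleDensity := by
    unfold semicircleDensity
    refine Measurable.ite (measurableSet_le (by fun_prop) (by fun_prop)) ?_ ?_ <;> fun_prop
  set g : ℝ → ℂ := fun x => (((2 * Real.pi)⁻¹ * √(4 - x ^ 2) : ℝ) : ℂ) * ((x : ℂ) - z)⁻¹ with hg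
  have hgc : Continuous g := by
    refine Continuous.mul ?_ (continuous_inv_ofReal_sub hz)
    exact Complex.continuous_ofReal.comp (by fun_prop)
  have h1 : ∫ x : ℝ, ((x : ℂ) - z)⁻¹ ∂semicircleMeasure = ∫ x in (-2 : ℝ)..2, g x := by
    have hden : semicircleMeasure =
        volume.withDensity fun x => ((Real.toNNReal (semicircleDensity x) : ℝ≥0) : ℝ≥0∞) := rfl
    rw [hden, integral_withDensity_eq_integral_smul hmeas.real_toNNReal,
      intervalIntegral.integral_of_le (by norm_num), ← integral_Icc_eq_integral_Ioc,
      ← integral_indicator measurableSet_Icc]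
    congr 1
    funext x
    rw [NNReal.smul_def, Real.coe_toNNReal _ (hnn x)]
    simp only [semicircleDensity, Set.indicator_apply, Set.mem_Icc, abs_le, hg]
    split_ifs <;> simp
  have h2 : ∫ x in (-2 : ℝ)..2, g x = ∫ θ in (0 : ℝ)..Real.pi, (2 / Real.pi : ℂ) *
      (((Real.sin θ ^ 2 : ℝ) : ℂ) * (((2 * Real.cos θ : ℝ) : ℂ) - z)⁻¹) := by
    have h3 := intervalIntegral.integral_deriv_smul_comp (a := 0) (b := Real.pi)
      (f := fun θ => 2 * Real.cos θ) (f' := fun θ => 2 * -Real.sin θ) (g := g)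
      (fun θ _ => (Real.hasDerivAt_cos θ).const_mul 2) (by fun_prop) hgc
    simp only [Real.cos_zero, Real.cos_pi, mul_one, mul_neg] at h3
    rw [intervalIntegral.integral_symm, ← h3, ← intervalIntegral.integral_neg]
    refine intervalIntegral.integral_congr fun θ hθ => ?_
    rw [Set.uIcc_of_le Real.pi_pos.le] at hθ
    have hsin : √(4 - (2 * Real.cos θ) ^ 2) = 2 * Real.sin θ := by
      rw [show 4 - (2 * Real.cos θ) ^ 2 = (2 * Real.sin θ) ^ 2 by
        nlinarith [Real.sin_sq_add_cos_sq θ]]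
      exact Real.sqrt_sq (mul_nonneg (by norm_num) (Real.sin_nonneg_of_mem_Icc hθ))
    simp only [hg, Function.comp_apply, hsin, Complex.real_smul]
    push_cast
    have hpi : (Real.pi : ℂ) ≠ 0 := by exact_mod_cast Real.pi_ne_zero
    field_simp
  have h4 : ∫ θ in (0 : ℝ)..2 * Real.pi,
      ((Real.sin θ ^ 2 : ℝ) : ℂ) * (((2 * Real.cos θ : ℝ) : ℂ) - z)⁻¹ =
      2 * ∫ θ in (0 : ℝ)..Real.pi,
        ((Real.sin θ ^ 2 : ℝ) : ℂ) * (((2 * Real.cos θ : ℝ) : ℂ) - z)⁻¹ := by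
    set S : ℝ → ℂ :=
      fun θ => ((Real.sin θ ^ 2 : ℝ) : ℂ) * (((2 * Real.cos θ : ℝ) : ℂ) - z)⁻¹ with hS
    have hSc : Continuous S := by
      refine Continuous.mul (Complex.continuous_ofReal.comp (by fun_prop)) ?_
      exact (continuous_inv_ofReal_sub hz).comp (by fun_prop)
    have h5 := intervalIntegral.integral_comp_sub_left (a := 0) (b := Real.pi) S (2 * Real.pi)
    have h6 : ∀ θ, S (2 * Real.pi - θ) = S θ := by
      intro θ
      simp only [hS, Real.cos_two_pi_sub, Real.sin_two_pi_sub, neg_sq]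
    simp only [h6, sub_zero] at h5
    rw [show 2 * Real.pi - Real.pi = Real.pi by ring] at h5
    rw [← intervalIntegral.integral_add_adjacent_intervals (hSc.intervalIntegrable 0 Real.pi)
      (hSc.intervalIntegrable Real.pi (2 * Real.pi)), ← h5, two_mul]
  rw [integral_sin_sq_div hz ha ha0 hroot] at h4
  rw [h1, h2, intervalIntegral.integral_const_mul]
  have hpi : (Real.pi : ℂ) ≠ 0 := by exact_mod_cast Real.pi_ne_zero
  rw [div_mul_eq_mul_div, ← h4, mul_div_cancel_left₀ _ hpi]

end Semicircle

/-! ### Weak convergence from Stieltjes transforms -/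

section StieltjesContinuity

/-- The Cauchy kernel of width `η`, that is `π` times the density of the Cauchy distribution. -/
noncomputable def cauchyKernel (η u : ℝ) : ℝ := η / (u ^ 2 + η ^ 2)

theorem cauchyKernel_nonneg {η : ℝ} (hη : 0 < η) (u : ℝ) : 0 ≤ cauchyKernel η u := by
  unfold cauchyKernel
  positivity

theorem continuous_cauchyKernel {η : ℝ} (hη : 0 < η) : Continuous (cauchyKernel η) := by
  unfold cauchyKernel
  exact continuous_const.div (by fun_prop) fun u => by positivity

theorem cauchyKernel_mul {η : ℝ} (hη : 0 < η) (v : ℝ) :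
    cauchyKernel η (η * v) = η⁻¹ * (1 + v ^ 2)⁻¹ := by
  unfold cauchyKernel
  field_simp
  ring

theorem integrable_cauchyKernel {η : ℝ} (hη : 0 < η) : Integrable (cauchyKernel η) := by
  have h : Integrable fun v => cauchyKernel η (η * v) := by
    simp only [cauchyKernel_mul hη]
    exact integrable_inv_one_add_sq.const_mul _
  exact (integrable_comp_mul_left_iff _ hη.ne').1 h

/-- The Fourier transform of the Cauchy kernel. Only its non-vanishing for small width matters. -/
noncomputable def cauchyKernelFourier (η t : ℝ) : ℂ :=
  ∫ u : ℝ, Complex.exp (t * u * Complex.I) * (cauchyKernel η u : ℂ)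

theorem exists_cauchyKernelFourier_ne_zero (t : ℝ) :
    ∃ η : ℝ, 0 < η ∧ cauchyKernelFourier η t ≠ 0 := by
  set ψ : ℝ → ℂ := fun r => ∫ v : ℝ, Complex.exp (r * v * Complex.I) * (((1 + v ^ 2)⁻¹ : ℝ) : ℂ)
    with hψ
  have hcont : Continuous ψ := by
    refine continuous_of_dominated (bound := fun v : ℝ => (1 + v ^ 2)⁻¹) ?_ ?_
      integrable_inv_one_add_sq ?_
    · intro r
      refine Continuous.aestronglyMeasurable ?_
      have : Continuous fun v : ℝ => (1 + v ^ 2)⁻¹ :=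
        Continuous.inv₀ (by fun_prop) fun v => by positivity
      fun_prop
    · intro r
      refine Eventually.of_forall fun v => ?_
      rw [norm_mul, ← Complex.ofReal_mul, Complex.norm_exp_ofReal_mul_I, one_mul, Complex.norm_real,
        Real.norm_of_nonneg (by positivity)]
    · refine Eventually.of_forall fun v => ?_
      fun_prop
  have h0 : ψ 0 ≠ 0 := by
    have : ψ 0 = ((Real.pi : ℝ) : ℂ) := by
      simp only [hψ, Complex.ofReal_zero, zero_mul, Complex.exp_zero, one_mul]
      rw [integral_complex_ofReal, integral_univ_inv_one_add_sq]
    rw [this]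
    exact_mod_cast Real.pi_ne_zero
  have hev : ∀ᶠ η in 𝓝[>] (0 : ℝ), ψ (η * t) ≠ 0 := by
    have h1 : Tendsto (fun η : ℝ => ψ (η * t)) (𝓝[>] 0) (𝓝 (ψ (0 * t))) :=
      ((hcont.comp (by fun_prop : Continuous fun η : ℝ => η * t)).tendsto 0).mono_left
        nhdsWithin_le_nhds
    rw [zero_mul] at h1
    exact h1.eventually_ne h0
  obtain ⟨η, hη, hη0⟩ := (hev.and self_mem_nhdsWithin).exists
  refine ⟨η, hη0, ?_⟩
  have hη0' : (0 : ℝ) < η := hη0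
  have h2 := Measure.integral_comp_mul_left
    (fun u : ℝ => Complex.exp (t * u * Complex.I) * (cauchyKernel η u : ℂ)) η
  have h3 : ∫ v : ℝ, Complex.exp (t * (η * v : ℝ) * Complex.I) * (cauchyKernel η (η * v) : ℂ) =
      (η⁻¹ : ℂ) * ψ (η * t) := by
    rw [hψ]
    simp only
    rw [← integral_const_mul]
    refine integral_congr_ae (Eventually.of_forall fun v => ?_)
    simp only [cauchyKernel_mul hη0']
    rw [show (t : ℂ) * ((η * v : ℝ) : ℂ) * Complex.I = ((η * t : ℝ) : ℂ) * v * Complex.I by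
      push_cast; ring]
    push_cast
    ring
  rw [h3] at h2
  intro hzero
  rw [cauchyKernelFourier] at hzero
  rw [hzero, smul_zero] at h2
  exact mul_ne_zero (inv_ne_zero (by exact_mod_cast hη0'.ne')) hη h2

/-- The smoothing of a measure by the Cauchy kernel. -/
noncomputable def cauchySmoothing (η : ℝ) (ν : Measure ℝ) (x : ℝ) : ℝ :=
  ∫ y, cauchyKernel η (x - y) ∂ν

theorem cauchySmoothing_nonneg {η : ℝ} (hη : 0 < η) (ν : Measure ℝ) (x : ℝ) :
    0 ≤ cauchySmoothing η ν x :=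
  integral_nonneg fun _ => cauchyKernel_nonneg hη _

/-- The smoothing is the imaginary part of the Stieltjes transform on a horizontal line. -/
theorem cauchySmoothing_eq_im {η : ℝ} (hη : 0 < η) (ν : Measure ℝ) [IsFiniteMeasure ν] (x : ℝ) :
    cauchySmoothing η ν x = (∫ y : ℝ, ((y : ℂ) - ⟨x, η⟩)⁻¹ ∂ν).im := by
  have h := Complex.imCLM.integral_comp_comm (integrable_inv_ofReal_sub (z := ⟨x, η⟩) hη ν)
  simp only [Complex.imCLM_apply, inv_ofReal_sub_im] at h
  rw [← h, cauchySmoothing]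
  refine integral_congr_ae (Eventually.of_forall fun y => ?_)
  simp only [cauchyKernel]
  congr 2
  ring

theorem integrable_prod_cauchyKernel {η : ℝ} (hη : 0 < η) (ν : Measure ℝ) [IsFiniteMeasure ν] :
    Integrable (fun p : ℝ × ℝ => cauchyKernel η (p.2 - p.1)) (ν.prod volume) := by
  have hc : Continuous fun p : ℝ × ℝ => cauchyKernel η (p.2 - p.1) :=
    (continuous_cauchyKernel hη).comp (by fun_prop)
  rw [integrable_prod_iff hc.aestronglyMeasurable]
  refine ⟨Eventually.of_forall fun y => (integrable_cauchyKernel hη).comp_sub_right y, ?_⟩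
  have : ∀ y : ℝ, ∫ x, ‖cauchyKernel η (x - y)‖ = ∫ x, ‖cauchyKernel η x‖ := fun y =>
    integral_sub_right_eq_self (fun x => ‖cauchyKernel η x‖) y
  simp only [this]
  exact integrable_const _

theorem integrable_cauchySmoothing {η : ℝ} (hη : 0 < η) (ν : Measure ℝ) [IsFiniteMeasure ν] :
    Integrable (cauchySmoothing η ν) :=
  (integrable_prod_cauchyKernel hη ν).integral_prod_right

theorem integral_exp_mul_cauchySmoothing {η : ℝ} (hη : 0 < η) (ν : Measure ℝ) [IsFiniteMeasure ν]
    (t : ℝ) : ∫ x : ℝ, Complex.exp (t * x * Complex.I) * (cauchySmoothing η ν x : ℂ) =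
      charFun ν t * cauchyKernelFourier η t := by
  have hc : Continuous fun p : ℝ × ℝ => Complex.exp (t * p.2 * Complex.I) := by fun_prop
  have hint : Integrable (fun p : ℝ × ℝ => Complex.exp (t * p.2 * Complex.I) *
      (cauchyKernel η (p.2 - p.1) : ℂ)) (ν.prod volume) := by
    refine (integrable_prod_cauchyKernel hη ν).ofReal.bdd_mul (c := 1) hc.aestronglyMeasurable
      (Eventually.of_forall fun p => ?_)
    rw [← Complex.ofReal_mul, Complex.norm_exp_ofReal_mul_I]
  have h1 : ∀ x : ℝ, Complex.exp (t * x * Complex.I) * (cauchySmoothing η ν x : ℂ) =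
      ∫ y, Complex.exp (t * x * Complex.I) * (cauchyKernel η (x - y) : ℂ) ∂ν := by
    intro x
    rw [integral_const_mul, integral_complex_ofReal]
    rfl
  simp only [h1]
  rw [← integral_integral_swap (f := fun y x : ℝ => Complex.exp (t * x * Complex.I) *
    (cauchyKernel η (x - y) : ℂ)) hint, charFun_apply_real, ← integral_mul_const]
  refine integral_congr_ae (Eventually.of_forall fun y => ?_)
  simp only
  rw [cauchyKernelFourier, ← integral_const_mul]
  refine Eq.trans ?_ (integral_sub_right_eq_self (fun u : ℝ =>
    Complex.exp (t * y * Complex.I) * (Complex.exp (t * u * Complex.I) * (cauchyKernel η u : ℂ))) y)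
  refine integral_congr_ae (Eventually.of_forall fun x => ?_)
  simp only
  rw [← mul_assoc, ← Complex.exp_add]
  congr 2
  push_cast
  ring

theorem integral_cauchySmoothing {η : ℝ} (hη : 0 < η) (ν : Measure ℝ) [IsProbabilityMeasure ν] :
    ∫ x, cauchySmoothing η ν x = ∫ u, cauchyKernel η u := by
  have h := integral_exp_mul_cauchySmoothing hη ν 0
  simp only [Complex.ofReal_zero, zero_mul, Complex.exp_zero, one_mul, charFun_zero,
    cauchyKernelFourier] at h
  rw [integral_complex_ofReal, integral_complex_ofReal] at h
  simp only [probReal_univ, Complex.ofReal_one, one_mul] at h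
  exact_mod_cast h

/-- Scheffé's lemma. -/
theorem tendsto_integral_abs_sub_of_integral_eq {α : Type*} [MeasurableSpace α] {ρ : Measure α}
    {f : ℕ → α → ℝ} {g : α → ℝ} (hf : ∀ n, Integrable (f n) ρ) (hg : Integrable g ρ)
    (hf0 : ∀ n x, 0 ≤ f n x) (hg0 : ∀ x, 0 ≤ g x) (heq : ∀ n, ∫ x, f n x ∂ρ = ∫ x, g x ∂ρ)
    (hlim : ∀ x, Tendsto (fun n => f n x) atTop (𝓝 (g x))) :
    Tendsto (fun n => ∫ x, |f n x - g x| ∂ρ) atTop (𝓝 0) := by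
  -- the negative part of `f n - g` is dominated by `g`, and the two parts have equal integrals
  have h1 : ∀ n, ∫ x, |f n x - g x| ∂ρ = 2 * ∫ x, max (g x - f n x) 0 ∂ρ := by
    intro n
    have h2 : ∀ x, |f n x - g x| = (f n x - g x) + 2 * max (g x - f n x) 0 := by
      intro x
      rcases le_total (f n x) (g x) with h | h
      · rw [abs_of_nonpos (by linarith), max_eq_left (by linarith)]
        ring
      · rw [abs_of_nonneg (by linarith), max_eq_right (by linarith)]
        ring
    have h3 : Integrable (fun x => max (g x - f n x) 0) ρ := (hg.sub (hf n)).pos_part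
    have h4 : Integrable (fun x => f n x - g x) ρ := (hf n).sub hg
    simp only [h2]
    rw [integral_add h4 (h3.const_mul 2), integral_sub (hf n) hg, heq, sub_self, zero_add,
      integral_const_mul]
  simp only [h1]
  have h5 : Tendsto (fun n => ∫ x, max (g x - f n x) 0 ∂ρ) atTop (𝓝 (∫ _, (0 : ℝ) ∂ρ)) := by
    refine tendsto_integral_of_dominated_convergence g
      (fun n => ((hg.sub (hf n)).pos_part).aestronglyMeasurable) hg ?_ ?_
    · intro n
      refine Eventually.of_forall fun x => ?_
      rw [Real.norm_of_nonneg (le_max_right _ _)]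
      exact max_le (by linarith [hf0 n x]) (hg0 x)
    · refine Eventually.of_forall fun x => ?_
      have : Tendsto (fun n => max (g x - f n x) 0) atTop (𝓝 (max (g x - g x) 0)) :=
        (tendsto_const_nhds.sub (hlim x)).max tendsto_const_nhds
      simpa using this
  simpa using h5.const_mul 2

/-- Pointwise convergence of Stieltjes transforms of probability measures to the Stieltjes transform
of a probability measure implies weak convergence. Convergence on a horizontal line is convergence
of the densities of the smoothings by a Cauchy kernel, hence of their characteristic functions, from
which the factor of the kernel can be cancelled. -/
theorem tendsto_of_tendsto_stieltjes {ν : ℕ → ProbabilityMeasure ℝ} {ν₀ : ProbabilityMeasure ℝ}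
    (h : ∀ z : ℂ, 0 < z.im → Tendsto (fun n => ∫ y : ℝ, ((y : ℂ) - z)⁻¹ ∂(ν n : Measure ℝ)) atTop
      (𝓝 (∫ y : ℝ, ((y : ℂ) - z)⁻¹ ∂(ν₀ : Measure ℝ)))) : Tendsto ν atTop (𝓝 ν₀) := by
  refine ProbabilityMeasure.tendsto_of_tendsto_charFun fun t => ?_
  obtain ⟨η, hη, hne⟩ := exists_cauchyKernelFourier_ne_zero t
  have hpt : ∀ x, Tendsto (fun n => cauchySmoothing η (ν n : Measure ℝ) x) atTop
      (𝓝 (cauchySmoothing η (ν₀ : Measure ℝ) x)) := by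
    intro x
    simp only [cauchySmoothing_eq_im hη]
    exact (Complex.continuous_im.tendsto _).comp (h ⟨x, η⟩ hη)
  have hL1 := tendsto_integral_abs_sub_of_integral_eq
    (fun n => integrable_cauchySmoothing hη (ν n : Measure ℝ))
    (integrable_cauchySmoothing hη (ν₀ : Measure ℝ))
    (fun n => cauchySmoothing_nonneg hη _) (cauchySmoothing_nonneg hη _)
    (fun n => by rw [integral_cauchySmoothing hη, integral_cauchySmoothing hη]) hpt
  have hF : Tendsto (fun n => charFun (ν n : Measure ℝ) t * cauchyKernelFourier η t) atTop
      (𝓝 (charFun (ν₀ : Measure ℝ) t * cauchyKernelFourier η t)) := by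
    rw [tendsto_iff_norm_sub_tendsto_zero]
    refine squeeze_zero (fun _ => norm_nonneg _) (fun n => ?_) hL1
    have hi : ∀ ν' : ProbabilityMeasure ℝ, Integrable fun x : ℝ => Complex.exp (t * x * Complex.I) *
        (cauchySmoothing η (ν' : Measure ℝ) x : ℂ) := fun ν' =>
      (integrable_cauchySmoothing hη (ν' : Measure ℝ)).ofReal.bdd_mul (c := 1)
        (by fun_prop : Continuous fun x : ℝ =>
          Complex.exp (t * x * Complex.I)).aestronglyMeasurable
        (Eventually.of_forall fun x => by
          rw [← Complex.ofReal_mul, Complex.norm_exp_ofReal_mul_I])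
    rw [← integral_exp_mul_cauchySmoothing hη, ← integral_exp_mul_cauchySmoothing hη,
      ← integral_sub (hi _) (hi _)]
    refine (norm_integral_le_integral_norm _).trans (le_of_eq ?_)
    refine integral_congr_ae (Eventually.of_forall fun x => ?_)
    simp only
    rw [← mul_sub, norm_mul, ← Complex.ofReal_mul, Complex.norm_exp_ofReal_mul_I, one_mul,
      ← Complex.ofReal_sub, Complex.norm_real, Real.norm_eq_abs]
  have := hF.div_const (cauchyKernelFourier η t)
  simpa only [mul_div_cancel_right₀ _ hne] using this

end StieltjesContinuity

/-! ### Limit of the mean Stieltjes transform -/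

section MeanLimit

/-- Among complex numbers of nonnegative imaginary part the equation `m ^ 2 + z * m + 1 = 0` has a
stable solution: the other root of the equation has imaginary part at most `-z.im`. -/
theorem norm_sub_le_of_quadratic {z m w : ℂ} (hz : 0 < z.im) (hm : m ^ 2 + z * m + 1 = 0)
    (hm0 : 0 ≤ m.im) (hw0 : 0 ≤ w.im) : ‖w - m‖ ≤ ‖1 + z * w + w ^ 2‖ * z.im⁻¹ := by
  have h1 : 1 + z * w + w ^ 2 = (w - m) * (w + m + z) := by linear_combination hm
  have h2 : z.im ≤ ‖w + m + z‖ := by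
    refine le_trans ?_ (Complex.im_le_norm _)
    simp only [Complex.add_im]
    linarith
  rw [h1, norm_mul, ← div_eq_mul_inv, le_div_iff₀ hz]
  exact mul_le_mul_of_nonneg_left h2 (norm_nonneg _)

variable {Ω : Type*} [MeasurableSpace Ω] {μ : Measure Ω} [IsProbabilityMeasure μ]

theorem integrable_resolventMean {ι : Type*} [Fintype ι] [DecidableEq ι] {A : Ω → Matrix ι ι ℝ}
    (hA : ∀ ω, (A ω).IsHermitian) (hmeas : ∀ p q, Measurable fun ω => A ω p q) (c : ℝ) {z : ℂ}
    (hz : 0 < z.im) : Integrable (fun ω => resolventMean (c • A ω) z) μ :=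
  Integrable.of_bound (measurable_resolventMean (fun p q => by
    simpa using (hmeas p q).const_mul c) z).aestronglyMeasurable z.im⁻¹
    (Eventually.of_forall fun ω => norm_resolventMean_le (isHermitian_real_smul (hA ω) _) hz)

theorem tendsto_inv_sqrt_natCast_mul {d : ℕ} (hd : 0 < d) :
    Tendsto (fun n : ℕ => (√((n * d : ℕ) : ℝ))⁻¹) atTop (𝓝 0) :=
  (Real.tendsto_sqrt_atTop.comp (tendsto_natCast_atTop_atTop.comp
    (tendsto_id.atTop_mul_const' hd))).inv_tendsto_atTop

/-- The mean Stieltjes transforms of centered block Wigner matrices converge to the Stieltjes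
transform of the semicircle law. -/
theorem tendsto_integral_resolventMean_of_isCenteredBlockWigner {d : ℕ} (hd : 0 < d) {δ K : ℝ}
    (hδ : 0 < δ) (hδ1 : δ ≤ 1) (hK : 0 ≤ K)
    {Y : (n : ℕ) → Ω → Matrix (Fin n × Fin d) (Fin n × Fin d) ℝ}
    (hY : ∀ n, IsCenteredBlockWigner μ δ K (Y n))
    (hcolumns : ∀ n, iIndepFun
      (fun (j : Fin n) (ω : Ω) (i : {i : Fin n // i ≤ j}) (a b : Fin d) =>
        Y n ω (i.1, a) (j, b)) μ) {z : ℂ} (hz : 0 < z.im) :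
    Tendsto (fun n : ℕ => ∫ ω, resolventMean ((√((n * d : ℕ) : ℝ))⁻¹ • Y n ω) z ∂μ) atTop
      (𝓝 (∫ x : ℝ, ((x : ℂ) - z)⁻¹ ∂semicircleMeasure)) := by
  set u : ℕ → ℝ := fun n => (√((n * d : ℕ) : ℝ))⁻¹ with hu
  set m : ℂ := ∫ x : ℝ, ((x : ℂ) - z)⁻¹ ∂semicircleMeasure with hm
  set s : ℕ → Ω → ℂ := fun n ω => resolventMean (u n • Y n ω) z with hs
  set w : ℕ → ℂ := fun n => ∫ ω, s n ω ∂μ with hw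
  have hu0 : Tendsto u atTop (𝓝 0) := tendsto_inv_sqrt_natCast_mul hd
  have hsb : ∀ n ω, ‖s n ω‖ ≤ z.im⁻¹ := fun n ω =>
    norm_resolventMean_le (isHermitian_real_smul ((hY n).isHermitian ω) _) hz
  have hsi : ∀ n, Integrable (s n) μ := fun n =>
    integrable_resolventMean (hY n).isHermitian (hY n).measurable (u n) hz
  have hwb : ∀ n, ‖w n‖ ≤ z.im⁻¹ := fun n => by
    simpa using norm_integral_le_of_norm_le_const (μ := μ) (Eventually.of_forall (hsb n))
  have hss : ∀ n, Integrable (fun ω => s n ω ^ 2) μ := fun n => by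
    simpa only [sq] using (hsi n).mul_bdd (c := z.im⁻¹) (hsi n).aestronglyMeasurable
      (Eventually.of_forall (hsb n))
  -- by concentration the variance of the Stieltjes transform vanishes in the limit
  have hvar : Tendsto (fun n => ∫ ω, (s n ω - w n) ^ 2 ∂μ) atTop (𝓝 0) := by
    have := tendsto_integral_of_dominated_convergence (μ := μ)
      (F := fun n ω => (s n ω - w n) ^ 2) (f := fun _ => (0 : ℂ))
      (fun _ => (2 * z.im⁻¹) ^ 2)
      (fun n => (((hsi n).sub (integrable_const (w n))).aestronglyMeasurable.pow 2))
      (integrable_const _) (fun n => Eventually.of_forall fun ω => by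
        rw [norm_pow]
        gcongr
        exact (norm_sub_le _ _).trans (by linarith [hsb n ω, hwb n])) (by
        filter_upwards [ae_tendsto_resolventMean_sub_integral hd (fun n => (hY n).isHermitian)
          (fun n => (hY n).measurable) hcolumns u hz] with ω hω
        simpa using hω.pow 2)
    simpa using this
  have hvar' : ∀ n, ∫ ω, (s n ω - w n) ^ 2 ∂μ = ∫ ω, s n ω ^ 2 ∂μ - w n ^ 2 := by
    intro n
    have h1 : ∀ ω, (s n ω - w n) ^ 2 = s n ω ^ 2 - (2 * w n) * s n ω + w n ^ 2 := fun ω => by ring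
    simp only [h1]
    rw [integral_add (f := fun ω => s n ω ^ 2 - (2 * w n) * s n ω)
      ((hss n).sub ((hsi n).const_mul _)) (integrable_const _),
      integral_sub (hss n) ((hsi n).const_mul _), integral_const_mul, integral_const]
    simp only [probReal_univ, one_smul]
    change _ - 2 * w n * w n + _ = _
    ring
  have hloop : Tendsto (fun n => 1 + z * w n + ∫ ω, s n ω ^ 2 ∂μ) atTop (𝓝 0) := by
    set B : ℝ := 2 * z.im⁻¹ ^ (2 + δ) * (2 ^ (2 + δ) * (((d * d : ℕ) : ℝ) ^ (1 + δ) * (d * d * K)))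
    refine squeeze_zero_norm' (a := fun n => 2 * (B * u n ^ δ + 8 * d ^ 4 * z.im⁻¹ ^ 3 * u n) +
        u n ^ 2 * (2 * d ^ 2 * z.im⁻¹ ^ 2 + d * z.im⁻¹ ^ 2)) ?_ ?_
    · filter_upwards [eventually_gt_atTop 0] with n hn
      have hN : (0 : ℝ) < ((n * d : ℕ) : ℝ) := by exact_mod_cast Nat.mul_pos hn hd
      refine (hY n).norm_loop_equation_le hδ hδ1 hK (inv_pos.2 (Real.sqrt_pos.2 hN)) ?_ hz
      rw [inv_pow, Real.sq_sqrt hN.le, ← Nat.cast_mul, inv_mul_cancel₀ hN.ne']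
    · have h1 : Tendsto (fun n => u n ^ δ) atTop (𝓝 0) := by
        simpa [Real.zero_rpow hδ.ne'] using hu0.rpow_const (p := δ) (Or.inr hδ.le)
      have := (((h1.const_mul B).add (hu0.const_mul (8 * d ^ 4 * z.im⁻¹ ^ 3))).const_mul 2).add
        ((hu0.pow 2).mul_const (2 * d ^ 2 * z.im⁻¹ ^ 2 + d * z.im⁻¹ ^ 2))
      simpa using this
  have hquad : Tendsto (fun n => 1 + z * w n + w n ^ 2) atTop (𝓝 0) := by
    have h := hloop.sub hvar
    rw [sub_zero] at h
    refine h.congr fun n => ?_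
    rw [hvar']
    ring
  have hwim : ∀ n, 0 ≤ (w n).im := by
    intro n
    have h : (w n).im = ∫ ω, (s n ω).im ∂μ := (integral_im (hsi n)).symm
    rw [h]
    exact integral_nonneg fun ω =>
      resolventMean_im_nonneg (isHermitian_real_smul ((hY n).isHermitian ω) _) hz
  rw [tendsto_iff_norm_sub_tendsto_zero]
  refine squeeze_zero (fun _ => norm_nonneg _) (fun n => norm_sub_le_of_quadratic hz
    (stieltjes_semicircle_quadratic hz) (integral_inv_ofReal_sub_im_nonneg hz _) (hwim n)) ?_
  simpa using hquad.norm.mul_const z.im⁻¹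

end MeanLimit

/-! ### Removing the block diagonal and centering -/

section Reduction

theorem abs_apply_le_opNorm {ι : Type*} [Fintype ι] [DecidableEq ι] (A : Matrix ι ι ℝ) (p q : ι) :
    |A p q| ≤ opNorm A := by
  have h1 : (Matrix.toEuclideanCLM (𝕜 := ℝ) A (EuclideanSpace.single q 1)) p = A p q := by
    rw [Matrix.ofLp_toEuclideanCLM]
    simp
  rw [← h1, ← Real.norm_eq_abs]
  refine (PiLp.norm_apply_le _ p).trans ((ContinuousLinearMap.le_opNorm _ _).trans ?_)
  simp [opNorm]

theorem isHermitian_blockDiagPart {n d : ℕ} {A : Matrix (Fin n × Fin d) (Fin n × Fin d) ℝ}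
    (hA : A.IsHermitian) : (blockDiagPart A).IsHermitian := by
  refine Matrix.IsHermitian.ext fun p q => ?_
  simp only [blockDiagPart, Matrix.of_apply, star_trivial, eq_comm (a := q.1)]
  rw [isHermitian_apply_comm hA]

/-- Removing the block diagonal changes the normalized trace of the resolvent little: a row of the
block diagonal has only `d` nonzero entries. -/
theorem norm_resolventMean_sub_sub_blockDiagPart_le {n d : ℕ}
    {A : Matrix (Fin n × Fin d) (Fin n × Fin d) ℝ} (hA : A.IsHermitian) {u : ℝ} (hu : 0 ≤ u) {z : ℂ}
    (hz : 0 < z.im) :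
    ‖resolventMean (u • A) z - resolventMean (u • (A - blockDiagPart A)) z‖ ≤
      d * z.im⁻¹ ^ 2 * (u * opNorm (blockDiagPart A)) := by
  have hop : 0 ≤ opNorm (blockDiagPart A) := norm_nonneg _
  refine (norm_resolventMean_sub_le_sum (isHermitian_real_smul hA u)
    (isHermitian_real_smul (hA.sub (isHermitian_blockDiagPart hA)) u) hz).trans ?_
  have h1 : ∀ p q, |(u • A - u • (A - blockDiagPart A)) p q| ≤
      if p.1 = q.1 then u * opNorm (blockDiagPart A) else 0 := by
    intro p q
    rw [← smul_sub, sub_sub_cancel, Matrix.smul_apply, smul_eq_mul, abs_mul, abs_of_nonneg hu]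
    split_ifs with h
    · exact mul_le_mul_of_nonneg_left (abs_apply_le_opNorm _ p q) hu
    · simp [blockDiagPart, h]
  have h2 : ∑ p, ∑ q, |(u • A - u • (A - blockDiagPart A)) p q| ≤
      (Fintype.card (Fin n × Fin d) : ℝ) * (d * (u * opNorm (blockDiagPart A))) := by
    refine (Finset.sum_le_sum fun p _ => Finset.sum_le_sum fun q _ => h1 p q).trans ?_
    have h : ∀ p : Fin n × Fin d, ∑ q : Fin n × Fin d,
        (if p.1 = q.1 then u * opNorm (blockDiagPart A) else 0) =
          d * (u * opNorm (blockDiagPart A)) := by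
      intro p
      rw [Fintype.sum_prod_type]
      change ∑ i, ∑ _b : Fin d, (if p.1 = i then u * opNorm (blockDiagPart A) else 0) = _
      simp only [Finset.sum_const, Finset.card_univ, Fintype.card_fin, nsmul_eq_mul,
        ← Finset.mul_sum, Finset.sum_ite_eq, Finset.mem_univ, if_true]
    simp only [h, Finset.sum_const, Finset.card_univ, nsmul_eq_mul, le_refl]
  have h3 := mul_le_mul_of_nonneg_left h2
    (inv_nonneg.2 (Nat.cast_nonneg (α := ℝ) (Fintype.card (Fin n × Fin d))))
  rw [← mul_assoc] at h3
  have h4 : (Fintype.card (Fin n × Fin d) : ℝ)⁻¹ * (Fintype.card (Fin n × Fin d) : ℝ) ≤ 1 :=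
    inv_mul_le_one
  have h5 := h3.trans (mul_le_mul_of_nonneg_right h4
    (by positivity : 0 ≤ (d : ℝ) * (u * opNorm (blockDiagPart A))))
  calc _ ≤ 1 * (d * (u * opNorm (blockDiagPart A))) * z.im⁻¹ ^ 2 :=
        mul_le_mul_of_nonneg_right h5 (by positivity)
    _ = _ := by ring

theorem rank_smul_le {ι : Type*} [Fintype ι] [DecidableEq ι] (c : ℝ) (A : Matrix ι ι ℝ) :
    (c • A).rank ≤ A.rank := by
  have h : c • A = (c • (1 : Matrix ι ι ℝ)) * A := by simp
  rw [h]
  exact Matrix.rank_mul_le_right _ _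

/-- The random matrix obtained by setting the diagonal blocks to zero and centering all others. -/
noncomputable def centeredOffDiag {Ω : Type*} [MeasurableSpace Ω] (μ : Measure Ω) {n d : ℕ}
    (M : Ω → Matrix (Fin n × Fin d) (Fin n × Fin d) ℝ) (ω : Ω) :
    Matrix (Fin n × Fin d) (Fin n × Fin d) ℝ :=
  Matrix.of fun p q => if p.1 = q.1 then 0 else M ω p q - ∫ ω', M ω' p q ∂μ

variable {Ω : Type*} [MeasurableSpace Ω] {μ : Measure Ω} {n d : ℕ}
  {M : Ω → Matrix (Fin n × Fin d) (Fin n × Fin d) ℝ}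

theorem isHermitian_centeredOffDiag (hM : ∀ ω, (M ω).IsHermitian) (ω : Ω) :
    (centeredOffDiag μ M ω).IsHermitian := by
  refine Matrix.IsHermitian.ext fun p q => ?_
  simp only [centeredOffDiag, Matrix.of_apply, star_trivial, eq_comm (a := q.1),
    fun ω => isHermitian_apply_comm (hM ω) q p]

theorem measurable_centeredOffDiag (hmeas : ∀ p q, Measurable fun ω => M ω p q)
    (p q : Fin n × Fin d) : Measurable fun ω => centeredOffDiag μ M ω p q := by
  simp only [centeredOffDiag, Matrix.of_apply]
  split_ifs
  · exact measurable_const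
  · exact (hmeas p q).sub_const _

theorem centeredOffDiag_apply_of_lt {i j : Fin n} (hij : i < j) (ω : Ω) (a b : Fin d) :
    centeredOffDiag μ M ω (i, a) (j, b) = centeredBlock μ M i j ω a b := by
  simp only [centeredOffDiag, Matrix.of_apply, if_neg hij.ne]
  rfl

theorem iIndepFun_columns_centeredOffDiag
    (hcolumns : iIndepFun
      (fun (j : Fin n) (ω : Ω) (i : {i : Fin n // i ≤ j}) (a b : Fin d) =>
        M ω (i.1, a) (j, b)) μ) :
    iIndepFun
      (fun (j : Fin n) (ω : Ω) (i : {i : Fin n // i ≤ j}) (a b : Fin d) =>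
        centeredOffDiag μ M ω (i.1, a) (j, b)) μ := by
  refine hcolumns.comp (fun j x i a b =>
    if i.1 = j then 0 else x i a b - ∫ ω', M ω' (i.1, a) (j, b) ∂μ) fun j => ?_
  refine measurable_pi_lambda _ fun i => measurable_pi_lambda _ fun a =>
    measurable_pi_lambda _ fun b => ?_
  split_ifs
  · exact measurable_const
  · exact Measurable.sub_const (by fun_prop) _

theorem isCenteredBlockWigner_centeredOffDiag [IsProbabilityMeasure μ]
    (hM : ∀ ω, (M ω).IsHermitian) (hmeas : ∀ p q, Measurable fun ω => M ω p q)
    (hindep : iIndepFun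
      (fun (p : {p : Fin n × Fin n // p.1 < p.2}) (ω : Ω) (a b : Fin d) =>
        M ω (p.1.1, a) (p.1.2, b)) μ)
    {ε : ℝ} (hε : 0 < ε)
    (hsimple : ∀ i j : Fin n, i < j → HasSimpleStructure μ 1 ε (centeredBlock μ M i j))
    {K : ℝ} (hmoments : ∀ i j : Fin n, i < j → ∀ a b,
      ∫ ω, |centeredBlock μ M i j ω a b| ^ (2 + ε) ∂μ ≤ K) {δ : ℝ} (hδ : 0 < δ) (hδε : δ ≤ ε) :
    IsCenteredBlockWigner μ δ (1 + K) (centeredOffDiag μ M) where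
  isHermitian := isHermitian_centeredOffDiag hM
  measurable := measurable_centeredOffDiag hmeas
  diag ω p q h := by simp [centeredOffDiag, h]
  indep := by
    have h : (fun (p : {p : Fin n × Fin n // p.1 < p.2}) (ω : Ω) (a b : Fin d) =>
        centeredOffDiag μ M ω (p.1.1, a) (p.1.2, b)) = fun p =>
        (fun (x : Fin d → Fin d → ℝ) (a b : Fin d) =>
          x a b - ∫ ω', M ω' (p.1.1, a) (p.1.2, b) ∂μ) ∘ fun (ω : Ω) (a b : Fin d) =>
          M ω (p.1.1, a) (p.1.2, b) := by
      funext p ω a b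
      simp [centeredOffDiag, p.2.ne]
    rw [h]
    refine hindep.comp _ fun p => ?_
    fun_prop
  memLp i j hij a b := by
    simp only [centeredOffDiag_apply_of_lt hij]
    exact ((hsimple i j hij).moments a b).mono_exponent (ENNReal.ofReal_le_ofReal (by linarith))
  moment i j hij a b := by
    simp only [centeredOffDiag_apply_of_lt hij]
    have hp : ∀ {δ : ℝ}, 0 < δ → (ENNReal.ofReal (2 + δ)).toReal = 2 + δ := fun h =>
      ENNReal.toReal_ofReal (by linarith)
    have hL := (hsimple i j hij).moments a b
    have hint : ∀ {δ : ℝ}, 0 < δ → δ ≤ ε →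
        Integrable (fun ω => |centeredBlock μ M i j ω a b| ^ (2 + δ)) μ := by
      intro δ h h'
      have := (hL.mono_exponent (p := ENNReal.ofReal (2 + δ))
        (ENNReal.ofReal_le_ofReal (by linarith))).integrable_norm_rpow'
      rwa [hp h] at this
    refine (integral_mono (hint hδ hδε) ((integrable_const 1).add (hint hε le_rfl)) ?_).trans ?_
    · intro ω
      simp only [Pi.add_apply]
      have h0 := abs_nonneg (centeredBlock μ M i j ω a b)
      rcases le_total |centeredBlock μ M i j ω a b| 1 with h | h
      · have h1 := Real.rpow_le_one h0 h (by linarith : 0 ≤ 2 + δ)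
        have h2 := Real.rpow_nonneg h0 (2 + ε)
        linarith
      · have h1 := Real.rpow_le_rpow_of_exponent_le h (by linarith : 2 + δ ≤ 2 + ε)
        linarith
    · rw [integral_add' (integrable_const 1) (hint hε le_rfl)]
      simpa using hmoments i j hij a b
  mean i j hij a b := by
    have h1 : Integrable (fun ω => centeredOffDiag μ M ω (i, a) (j, b)) μ := by
      simp only [centeredOffDiag_apply_of_lt hij]
      exact ((hsimple i j hij).moments a b).integrable
        (ENNReal.one_le_ofReal.2 (by linarith))
    simp only [centeredOffDiag, Matrix.of_apply, if_neg hij.ne] at h1 ⊢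
    have h2 : Integrable (fun ω => M ω (i, a) (j, b)) μ :=
      (h1.add (integrable_const (∫ ω', M ω' (i, a) (j, b) ∂μ))).congr
        (Eventually.of_forall fun ω => by simp)
    rw [integral_sub h2 (integrable_const _)]
    simp
  isotropic i j hij a b b' := by
    have h := congrFun (congrFun ((hsimple i j hij).isotropic a) b) b'
    simp only [rowCrossMoment, expectation, Matrix.of_apply, Matrix.vecMulVec_apply, one_pow,
      one_smul, Matrix.one_apply] at h
    simpa only [centeredOffDiag_apply_of_lt hij] using h
  antisymm i j hij a a' haa b b' := by
    have h := congrFun (congrFun ((hsimple i j hij).antisymm a a' haa) b') b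
    simp only [rowCrossMoment, expectation, Matrix.of_apply, Matrix.vecMulVec_apply,
      Matrix.transpose_apply, Matrix.neg_apply] at h
    simpa only [centeredOffDiag_apply_of_lt hij] using h

/-- Centering changes the normalized trace of the resolvent by an amount controlled by the rank of
the mean. -/
theorem norm_resolventMean_sub_centeredOffDiag_le (hM : ∀ ω, (M ω).IsHermitian) (u : ℝ) {z : ℂ}
    (hz : 0 < z.im) (ω : Ω) :
    ‖resolventMean (u • (M ω - blockDiagPart (M ω))) z -
      resolventMean (u • centeredOffDiag μ M ω) z‖ ≤
      ((expectation μ fun ω => M ω - blockDiagPart (M ω)).rank : ℝ) / ((n * d : ℕ) : ℝ) *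
        (2 * z.im⁻¹) := by
  refine (norm_resolventMean_sub_le_rank
    (isHermitian_real_smul ((hM ω).sub (isHermitian_blockDiagPart (hM ω))) u)
    (isHermitian_real_smul (isHermitian_centeredOffDiag hM ω) u) hz).trans ?_
  have h : u • (M ω - blockDiagPart (M ω)) - u • centeredOffDiag μ M ω =
      u • expectation μ fun ω => M ω - blockDiagPart (M ω) := by
    rw [← smul_sub]
    congr 1
    ext p q
    by_cases hpq : p.1 = q.1 <;> simp [expectation, centeredOffDiag, blockDiagPart, hpq]
  rw [h, Fintype.card_prod, Fintype.card_fin, Fintype.card_fin]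
  gcongr
  exact rank_smul_le _ _

theorem tendsto_integral_of_norm_le_tendstoInMeasure [IsFiniteMeasure μ] {F : ℕ → Ω → ℂ}
    (hF : ∀ n, AEStronglyMeasurable (F n) μ) {C : ℝ} (hC : ∀ n ω, ‖F n ω‖ ≤ C) {X : ℕ → Ω → ℝ}
    (hX : TendstoInMeasure μ X atTop fun _ => 0) {c : ℝ} (hle : ∀ n ω, ‖F n ω‖ ≤ c * X n ω) :
    Tendsto (fun n => ∫ ω, F n ω ∂μ) atTop (𝓝 0) := by
  refine tendsto_of_subseq_tendsto fun ns hns => ?_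
  have hXns : TendstoInMeasure μ (fun k => X (ns k)) atTop fun _ => 0 := fun ε hε =>
    (hX ε hε).comp hns
  obtain ⟨ms, -, hms⟩ := hXns.exists_seq_tendsto_ae
  refine ⟨ms, ?_⟩
  have h := tendsto_integral_of_dominated_convergence (μ := μ)
    (F := fun k ω => F (ns (ms k)) ω) (f := fun _ => (0 : ℂ)) (fun _ => C) (fun k => hF _)
    (integrable_const _) (fun k => Eventually.of_forall fun ω => hC _ ω) (by
      filter_upwards [hms] with ω hω
      refine squeeze_zero_norm (fun k => hle (ns (ms k)) ω) ?_
      simpa using hω.const_mul c)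
  simpa using h

end Reduction

/-! ### Empirical spectral distributions -/

section EmpiricalSpectralDistribution

theorem isProbabilityMeasure_empiricalSpectralDistribution {ι : Type*} [Fintype ι] [DecidableEq ι]
    [Nonempty ι] {A : Matrix ι ι ℝ} (hA : A.IsHermitian) :
    IsProbabilityMeasure (empiricalSpectralDistribution A hA : Measure ℝ) := by
  refine ⟨?_⟩
  change (((Fintype.card ι : ℝ≥0)⁻¹) • ∑ i, Measure.dirac (hA.eigenvalues i)) Set.univ = 1
  have h : (Fintype.card ι : ℝ≥0) ≠ 0 := Nat.cast_ne_zero.2 Fintype.card_ne_zero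
  rw [Measure.smul_apply, Measure.finsetSum_apply]
  simp only [measure_univ, Finset.sum_const, Finset.card_univ, nsmul_eq_mul, mul_one]
  rw [ENNReal.smul_def, smul_eq_mul, ENNReal.coe_inv h, ENNReal.coe_natCast]
  exact ENNReal.inv_mul_cancel (by simp) (by simp)

theorem integral_empiricalSpectralDistribution {ι : Type*} [Fintype ι] [DecidableEq ι]
    {A : Matrix ι ι ℝ} (hA : A.IsHermitian) {z : ℂ} (hz : 0 < z.im) :
    ∫ x : ℝ, ((x : ℂ) - z)⁻¹ ∂(empiricalSpectralDistribution A hA : Measure ℝ) =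
      resolventMean A z := by
  change ∫ x : ℝ, ((x : ℂ) - z)⁻¹ ∂(((Fintype.card ι : ℝ≥0)⁻¹) •
    ∑ i, Measure.dirac (hA.eigenvalues i)) = _
  rw [integral_smul_nnreal_measure, integral_finsetSum_measure fun i _ =>
    integrable_inv_ofReal_sub hz _, resolventMean, trace_resolventMatrix hA hz]
  simp only [integral_dirac, NNReal.smul_def, NNReal.coe_inv, NNReal.coe_natCast,
    Complex.real_smul, Complex.ofReal_inv, Complex.ofReal_natCast]

/-- Stieltjes transforms of probability measures are Lipschitz away from the real line. -/
theorem norm_stieltjes_sub_le (ν : Measure ℝ) [IsProbabilityMeasure ν] {z w : ℂ} (hz : 0 < z.im)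
    (hw : 0 < w.im) : ‖∫ x : ℝ, ((x : ℂ) - z)⁻¹ ∂ν - ∫ x : ℝ, ((x : ℂ) - w)⁻¹ ∂ν‖ ≤
      ‖z - w‖ * (z.im⁻¹ * w.im⁻¹) := by
  rw [← integral_sub (integrable_inv_ofReal_sub hz ν) (integrable_inv_ofReal_sub hw ν)]
  refine (norm_integral_le_of_norm_le_const (C := ‖z - w‖ * (z.im⁻¹ * w.im⁻¹))
    (Eventually.of_forall fun x => ?_)).trans (by simp)
  rw [inv_sub_inv' (ofReal_sub_ne_zero hz x) (ofReal_sub_ne_zero hw x), norm_mul, norm_mul]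
  have h : (x : ℂ) - w - ((x : ℂ) - z) = z - w := by ring
  rw [h, mul_comm ‖((x : ℂ) - z)⁻¹‖, mul_assoc]
  gcongr
  · exact norm_inv_ofReal_sub_le hz x
  · exact norm_inv_ofReal_sub_le hw x

/-- To prove that the Stieltjes transforms converge at every point of the upper half plane it is
enough to do so on a dense set of points. -/
theorem tendsto_stieltjes_of_dense {ν : ℕ → ProbabilityMeasure ℝ} {ν₀ : ProbabilityMeasure ℝ}
    {D : Set ℂ} (hD : Dense D)
    (h : ∀ z ∈ D, 0 < z.im → Tendsto (fun n => ∫ x : ℝ, ((x : ℂ) - z)⁻¹ ∂(ν n : Measure ℝ)) atTop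
      (𝓝 (∫ x : ℝ, ((x : ℂ) - z)⁻¹ ∂(ν₀ : Measure ℝ)))) {z : ℂ} (hz : 0 < z.im) :
    Tendsto (fun n => ∫ x : ℝ, ((x : ℂ) - z)⁻¹ ∂(ν n : Measure ℝ)) atTop
      (𝓝 (∫ x : ℝ, ((x : ℂ) - z)⁻¹ ∂(ν₀ : Measure ℝ))) := by
  rw [Metric.tendsto_atTop]
  intro e he
  have hη : 0 < z.im := hz
  -- a point of the dense set so close to `z` that its imaginary part exceeds `z.im / 2`
  set r : ℝ := min (z.im / 2) (e / 3 / (z.im⁻¹ * (z.im / 2)⁻¹)) with hr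
  have hr0 : 0 < r := lt_min (by positivity) (by positivity)
  obtain ⟨w, hwD, hw⟩ := hD.exists_dist_lt z hr0
  rw [dist_eq_norm] at hw
  have hwim : z.im / 2 < w.im := by
    have h1 := (Complex.abs_im_le_norm (z - w)).trans_lt (hw.trans_le (min_le_left _ _))
    rw [Complex.sub_im, abs_lt] at h1
    linarith [h1.2]
  have hw0 : 0 < w.im := by linarith
  have hclose : ∀ ρ : ProbabilityMeasure ℝ, ‖∫ x : ℝ, ((x : ℂ) - z)⁻¹ ∂(ρ : Measure ℝ) -
      ∫ x : ℝ, ((x : ℂ) - w)⁻¹ ∂(ρ : Measure ℝ)‖ ≤ e / 3 := by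
    intro ρ
    refine (norm_stieltjes_sub_le _ hz hw0).trans ?_
    have h1 : ‖z - w‖ ≤ e / 3 / (z.im⁻¹ * (z.im / 2)⁻¹) := (hw.trans_le (min_le_right _ _)).le
    have h2 : z.im⁻¹ * w.im⁻¹ ≤ z.im⁻¹ * (z.im / 2)⁻¹ := by gcongr
    calc _ ≤ e / 3 / (z.im⁻¹ * (z.im / 2)⁻¹) * (z.im⁻¹ * (z.im / 2)⁻¹) := by gcongr
      _ = e / 3 := div_mul_cancel₀ _ (by positivity)
  obtain ⟨k, hk⟩ := (Metric.tendsto_atTop.1 (h w hwD hw0)) (e / 3) (by positivity)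
  refine ⟨k, fun n hn => ?_⟩
  have h1 := hk n hn
  rw [dist_eq_norm] at h1 ⊢
  have h2 := hclose (ν n)
  have h3 := hclose ν₀
  rw [norm_sub_rev] at h3
  set a := ∫ x : ℝ, ((x : ℂ) - z)⁻¹ ∂(ν n : Measure ℝ)
  set b := ∫ x : ℝ, ((x : ℂ) - w)⁻¹ ∂(ν n : Measure ℝ)
  set a' := ∫ x : ℝ, ((x : ℂ) - z)⁻¹ ∂(ν₀ : Measure ℝ)
  set b' := ∫ x : ℝ, ((x : ℂ) - w)⁻¹ ∂(ν₀ : Measure ℝ)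
  calc ‖a - a'‖ = ‖(a - b) + (b - b') + (b' - a')‖ := by congr 1; ring
    _ ≤ ‖a - b‖ + ‖b - b'‖ + ‖b' - a'‖ := norm_add₃_le
    _ < e := by linarith

/-- Almost sure weak convergence of empirical spectral distributions to the semicircle law follows
from almost sure convergence of the normalized traces of the resolvents, point by point. -/
theorem ae_tendsto_empiricalSpectralDistribution {Ω : Type*} [MeasurableSpace Ω] {μ : Measure Ω}
    {ι : ℕ → Type*} [∀ n, Fintype (ι n)] [∀ n, DecidableEq (ι n)]
    (hι : ∀ᶠ n in atTop, Nonempty (ι n)) {A : (n : ℕ) → Ω → Matrix (ι n) (ι n) ℝ}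
    (hA : ∀ n ω, (A n ω).IsHermitian)
    (h : ∀ z : ℂ, 0 < z.im → ∀ᵐ ω ∂μ, Tendsto (fun n => resolventMean (A n ω) z) atTop
      (𝓝 (∫ x : ℝ, ((x : ℂ) - z)⁻¹ ∂semicircleMeasure))) :
    ∀ᵐ ω ∂μ, Tendsto (fun n => empiricalSpectralDistribution (A n ω) (hA n ω)) atTop
      (𝓝 semicircleLaw) := by
  obtain ⟨D, hDc, hD⟩ := TopologicalSpace.exists_countable_dense ℂ
  have hall : ∀ᵐ ω ∂μ, ∀ z ∈ D, 0 < z.im → Tendsto (fun n => resolventMean (A n ω) z) atTop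
      (𝓝 (∫ x : ℝ, ((x : ℂ) - z)⁻¹ ∂semicircleMeasure)) := by
    rw [ae_ball_iff hDc]
    intro z _
    by_cases hz : 0 < z.im
    · filter_upwards [h z hz] with ω hω _ using hω
    · exact Eventually.of_forall fun ω hz' => absurd hz' hz
  filter_upwards [hall] with ω hω
  let ν₀ : ProbabilityMeasure ℝ := ⟨semicircleMeasure, inferInstance⟩
  -- the spectral distribution of an empty matrix vanishes and is replaced by a probability measure
  let ν : ℕ → ProbabilityMeasure ℝ := fun n => open scoped Classical in
    if hn : Nonempty (ι n) then ⟨empiricalSpectralDistribution (A n ω) (hA n ω),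
      isProbabilityMeasure_empiricalSpectralDistribution (hA n ω)⟩ else ν₀
  have hν : ∀ᶠ n in atTop, ν n =
      (empiricalSpectralDistribution (A n ω) (hA n ω) : Measure ℝ) := by
    filter_upwards [hι] with n hn
    exact congrArg (fun ρ : ProbabilityMeasure ℝ => (ρ : Measure ℝ)) (dif_pos hn)
  have hconv : Tendsto ν atTop (𝓝 ν₀) := by
    refine tendsto_of_tendsto_stieltjes fun z hz => tendsto_stieltjes_of_dense hD
      (fun z hzD hz => ?_) hz
    refine (hω z hzD hz).congr' ?_
    filter_upwards [hν] with n hn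
    rw [hn, integral_empiricalSpectralDistribution (hA n ω) hz]
  rw [ProbabilityMeasure.tendsto_nhds_iff_toFiniteMeasure_tendsto_nhds] at hconv
  have h0 : ν₀.toFiniteMeasure = semicircleLaw := rfl
  rw [h0] at hconv
  refine hconv.congr' ?_
  filter_upwards [hν] with n hn
  exact Subtype.ext hn

end EmpiricalSpectralDistribution

theorem mainTheorem7 {Ω : Type*} [MeasurableSpace Ω] (μ : Measure Ω) [IsProbabilityMeasure μ]
    (d : ℕ) (hd : 0 < d)
    (M : (n : ℕ) → Ω → Matrix (Fin n × Fin d) (Fin n × Fin d) ℝ)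
    (hM : ∀ n ω, (M n ω).IsHermitian)
    (hmeas : ∀ n p q, Measurable fun ω => M n ω p q)
    -- the blocks strictly above the block diagonal are independent
    (hindep : ∀ n, iIndepFun
      (fun (p : {p : Fin n × Fin n // p.1 < p.2}) (ω : Ω) (a b : Fin d) =>
        M n ω (p.1.1, a) (p.1.2, b)) μ)
    -- the block columns, cut off below the block diagonal, are independent of one another
    (hcolumns : ∀ n, iIndepFun
      (fun (j : Fin n) (ω : Ω) (i : {i : Fin n // i ≤ j}) (a b : Fin d) =>
        M n ω (i.1, a) (j, b)) μ)
    -- the norm of the block diagonal is `o_P(√N)`, with `N = n * d`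
    (hdiag : TendstoInMeasure μ
      (fun (n : ℕ) ω => opNorm (blockDiagPart (M n ω)) / √((n * d : ℕ) : ℝ)) atTop (fun _ => 0))
    -- the rank of the mean of the part off the block diagonal is `o(N)`
    (hrank : Tendsto
      (fun n : ℕ => ((expectation μ fun ω => M n ω - blockDiagPart (M n ω)).rank : ℝ) /
        ((n * d : ℕ) : ℝ)) atTop (𝓝 0))
    (ε : ℝ) (hε : 0 < ε)
    (hsimple : ∀ n (i j : Fin n), i < j →
      HasSimpleStructure μ 1 ε (centeredBlock μ (M n) i j))
    -- the moments of order `2 + ε` are bounded uniformly in the block and in `n`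
    (hmoments : ∃ K : ℝ, ∀ n (i j : Fin n), i < j → ∀ a b,
      ∫ ω, |centeredBlock μ (M n) i j ω a b| ^ (2 + ε) ∂μ ≤ K)
    -- the cross-covariances of the rows are bounded uniformly in the block and in `n`
    (hcross : ∃ C : ℝ, ∀ n (i j : Fin n), i < j → ∀ k l, k ≠ l →
      opNorm (rowCrossMoment μ (centeredBlock μ (M n) i j) k l) ≤ C) :
    ∀ᵐ ω ∂μ, Tendsto
      (fun n : ℕ => empiricalSpectralDistribution ((√((n * d : ℕ) : ℝ))⁻¹ • M n ω)
        (isHermitian_real_smul (hM n ω) _))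
      atTop (𝓝 semicircleLaw) := by
  obtain ⟨K, hK⟩ := hmoments
  set u : ℕ → ℝ := fun n => (√((n * d : ℕ) : ℝ))⁻¹ with hu
  have hu0 : ∀ n, 0 ≤ u n := fun n => by positivity
  refine ae_tendsto_empiricalSpectralDistribution (A := fun n ω => u n • M n ω) ?_
    (fun n ω => isHermitian_real_smul (hM n ω) _) fun z hz => ?_
  · filter_upwards [eventually_gt_atTop 0] with n hn
    exact ⟨(⟨0, hn⟩, ⟨0, hd⟩)⟩
  set Y : (n : ℕ) → Ω → Matrix (Fin n × Fin d) (Fin n × Fin d) ℝ := fun n =>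
    centeredOffDiag μ (M n) with hYdef
  have hC : ∀ n ω, (M n ω - blockDiagPart (M n ω)).IsHermitian := fun n ω =>
    (hM n ω).sub (isHermitian_blockDiagPart (hM n ω))
  have hCm : ∀ n p q, Measurable fun ω => (M n ω - blockDiagPart (M n ω)) p q := by
    intro n p q
    by_cases hpq : p.1 = q.1
    · simp [blockDiagPart, hpq]
    · simpa [blockDiagPart, hpq] using hmeas n p q
  have hiM : ∀ n, Integrable (fun ω => resolventMean (u n • M n ω) z) μ := fun n =>
    integrable_resolventMean (hM n) (hmeas n) _ hz
  have hiC : ∀ n, Integrable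
      (fun ω => resolventMean (u n • (M n ω - blockDiagPart (M n ω))) z) μ := fun n =>
    integrable_resolventMean (hC n) (hCm n) _ hz
  have hiY : ∀ n, Integrable (fun ω => resolventMean (u n • Y n ω) z) μ := fun n =>
    integrable_resolventMean (isHermitian_centeredOffDiag (hM n))
      (measurable_centeredOffDiag (hmeas n)) _ hz
  -- the diagonal blocks do not contribute in the limit
  have h1 : Tendsto (fun n => ∫ ω, (resolventMean (u n • M n ω) z -
      resolventMean (u n • (M n ω - blockDiagPart (M n ω))) z) ∂μ) atTop (𝓝 0) := by
    refine tendsto_integral_of_norm_le_tendstoInMeasure (C := z.im⁻¹ + z.im⁻¹)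
      (c := d * z.im⁻¹ ^ 2) (fun n => ((hiM n).sub (hiC n)).aestronglyMeasurable)
      (fun n ω => (norm_sub_le _ _).trans (add_le_add
        (norm_resolventMean_le (isHermitian_real_smul (hM n ω) _) hz)
        (norm_resolventMean_le (isHermitian_real_smul (hC n ω) _) hz))) hdiag fun n ω => ?_
    rw [div_eq_inv_mul]
    exact norm_resolventMean_sub_sub_blockDiagPart_le (hM n ω) (hu0 n) hz
  -- the mean of the other blocks has small rank and does not contribute either
  have h2 : Tendsto (fun n => ∫ ω, (resolventMean (u n • (M n ω - blockDiagPart (M n ω))) z -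
      resolventMean (u n • Y n ω) z) ∂μ) atTop (𝓝 0) := by
    refine squeeze_zero_norm (fun n => ?_) (by simpa using hrank.mul_const (2 * z.im⁻¹))
    simpa using norm_integral_le_of_norm_le_const (μ := μ) (Eventually.of_forall
      (norm_resolventMean_sub_centeredOffDiag_le (μ := μ) (hM n) (u n) hz))
  -- the expansion of the resolvent uses `2 + δ` moments with `δ ≤ 1`
  have hδ : 0 < min ε 1 := lt_min hε one_pos
  have h3 := tendsto_integral_resolventMean_of_isCenteredBlockWigner (μ := μ) hd hδ
    (min_le_right ε 1) (K := 1 + |K|) (by positivity) (Y := Y)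
    (fun n => isCenteredBlockWigner_centeredOffDiag (hM n) (hmeas n) (hindep n) hε (hsimple n)
      (fun i j hij a b => (hK n i j hij a b).trans (le_abs_self K)) hδ (min_le_left ε 1))
    (fun n => iIndepFun_columns_centeredOffDiag (hcolumns n)) hz
  have hmean : Tendsto (fun n => ∫ ω, resolventMean (u n • M n ω) z ∂μ) atTop
      (𝓝 (∫ x : ℝ, ((x : ℂ) - z)⁻¹ ∂semicircleMeasure)) := by
    have h := (h1.add h2).add h3
    simp only [zero_add] at h
    refine h.congr fun n => ?_
    rw [integral_sub (hiM n) (hiC n), integral_sub (hiC n) (hiY n)]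
    ring
  filter_upwards [ae_tendsto_resolventMean_sub_integral hd hM hmeas hcolumns u hz] with ω hω
  simpa using hω.add hmean
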